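/- **Setting.** Let $n\ge 0$ and let $\mathcal M\subseteq\mathbb R^{n+1}$ be an open set with its global coordinates $(x^0,\dots,x^n)$, so that $T^*\mathcal M=\mathcal M\times\mathbb R^{n+1}$ has coordinates $(x,\xi)$, and put $|\xi|^2=\sum_{\alpha=0}^n\xi_\alpha^2$ and $\langle\xi,Y\rangle=\xi_\alpha Y^\alpha$. Let $g$ be a $C^2$ Lorentzian metric on $\mathcal M$. For a $C^1$ function $a$ on $T^*\mathcal M\setminus\{0\}$ write $$Xa=(g^{-1})^{\alpha\beta}\xi_\beta\,\partial_{x^\alpha}a-\tfrac12(\partial_\mu g^{-1})^{\alpha\beta}\xi_\alpha\xi_\beta\,\partial_{\xi_\mu}a .$$ Let $S^*\mathcal M=(T^*\mathcal M\setminus\{0\})/{\sim}$, where $(x,\xi)\sim(x,\lambda\xi)$ for all $\lambda>0$; functions of $(x,\xi)$ that are homogeneous of degree $0$ in $\xi$ are regarded as functions on $S^*\mathcal M$. *Measure solution.* A non-negative Radon measure $\mu$ on $T^*\mathcal M$ with $\int|\xi|^2\,d\mu<\infty$ is a measure solution of the Einstein–massless Vlasov system on $(\mathcal M,g)$ if 1.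 $\int_{\mathcal M}\mathrm{Ric}(Y,Y)\,d\mathrm{Vol}_g=\int_{T^*\mathcal M}\langle\xi,Y\rangle^2\,d\mu$ for every smooth compactly supported vector field $Y$ on $\mathcal M$; 2. $\mu$ is supported on $\{g^{-1}(\xi,\xi)=0\}$; 3. $\int_{T^*\mathcal M\setminus\{0\}}Xa\,d\mu=0$ for every $a\in C_c^\infty(T^*\mathcal M\setminus\{0\})$. *Radially-averaged measure solution.* A non-negative finite Radon measure $\nu$ on $S^*\mathcal M$ is a radially-averaged measure solution on $(\mathcal M,g)$ if 1. $\int_{\mathcal M}\mathrm{Ric}(Y,Y)\,d\mathrm{Vol}_g=\int_{S^*\mathcal M}\langle\xi,Y\rangle^2\,\frac{d\nu}{|\xi|^2}$ for every smooth compactly supported vector field $Y$ on $\mathcal M$; 2. $\nu$ is supported on the zero mass shell: $\int_{S^*\mathcal M}f\,g^{-1}(\xi,\xi)\,\frac{d\nu}{|\xi|^2}=0$ for every $f\in C_c(S^*\mathcal M)$; 3. $\int_{S^*\mathcal M}X\widetilde a\,\frac{d\nu}{|\xi|^2}=0$ for every $C^1$ function $\widetilde a:T^*\mathcal M\setminus\{0\}\to\mathbb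 R$ that is homogeneous of degree $1$ in $\xi$ and vanishes for $x$ outside a compact subset of $\mathcal M$. The measure $\nu$ is the *radial average* of $\mu$ if $\int_{S^*\mathcal M}\varphi\,d\nu=\int_{T^*\mathcal M\setminus\{0\}}\varphi\,|\xi|^2\,d\mu$ for all $\varphi\in C_c(S^*\mathcal M)$. Finally, $(\mathcal M,g)$ is *globally hyperbolic* if it has a Cauchy hypersurface, i.e. a spacelike $C^1$ hypersurface that every inextendible ($C^1$, regular) causal curve meets exactly once. **Lemma.** For every measure solution $\mu$ on $(\mathcal M,g)$ there is a radially-averaged measure solution $\nu$ on the same $(\mathcal M,g)$ which is the radial average of $\mu$. Conversely, if $(\mathcal M,g)$ is globally hyperbolic, then for every radially-averaged measure solution $\nu$ on $(\mathcal M,g)$ there is a measure solution $\mu$ on the same $(\mathcal M,g)$ whose radial average is $\nu$. -/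

import Mathlib

open MeasureTheory Set Filter Topology
open scoped ContDiff

namespace EinsteinVlasov

noncomputable section

/-- The coordinate space `ℝ^{n+1}`, with coordinates indexed by `0, …, n`. It is used for points,
tangent vectors and covectors; the norm of a covector is `|ξ|² = ∑ α, ξ_α ^ 2`. -/
abbrev Coord (n : ℕ) : Type := EuclideanSpace ℝ (Fin (n + 1))

/-- The coordinate basis vector `e_α`. -/
abbrev basisVec {n : ℕ} (α : Fin (n + 1)) : Coord n := EuclideanSpace.single α (1 : ℝ)

/-- The coordinate derivative `∂_α f (x)`. -/
def partialDeriv {n : ℕ} (α : Fin (n + 1)) (f : Coord n → ℝ) (x : Coord n) : ℝ :=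
  fderiv ℝ f x (basisVec α)

/-! ### Lorentzian metrics -/

/-- Components `g_{αβ}(x)` of a metric. Only the values at points of the spacetime `M` matter. -/
abbrev MetricField (n : ℕ) : Type := Coord n → Matrix (Fin (n + 1)) (Fin (n + 1)) ℝ

/-- `g_x(v, w) = g_{αβ}(x) v^α w^β`. -/
def metricForm {n : ℕ} (g : MetricField n) (x v w : Coord n) : ℝ :=
  ∑ α, ∑ β, g x α β * v α * w β

/-- The components `(g⁻¹)^{αβ}(x)` of the inverse metric. -/
def inverseMetric {n : ℕ} (g : MetricField n) (x : Coord n) :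
    Matrix (Fin (n + 1)) (Fin (n + 1)) ℝ :=
  (g x)⁻¹

/-- `g⁻¹_x(ξ, η) = (g⁻¹)^{αβ}(x) ξ_α η_β` on covectors. -/
def cometricForm {n : ℕ} (g : MetricField n) (x ξ η : Coord n) : ℝ :=
  ∑ α, ∑ β, inverseMetric g x α β * ξ α * η β

/-- `g` is a Lorentzian metric of class `C^k` on the open set `M ⊆ ℝ^{n+1}`: a symmetric bilinear
form of signature `(-, +, …, +)` at each point, with `C^k` components. -/
structure IsLorentzianMetric {n : ℕ} (k : ℕ∞) (M : TopologicalSpace.Opens (Coord n))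
    (g : MetricField n) : Prop where
  contDiffOn : ∀ α β, ContDiffOn ℝ k (fun x => g x α β) M
  symm : ∀ x ∈ M, ∀ α β, g x α β = g x β α
  signature : ∀ x ∈ M, ∃ v : Coord n, metricForm g x v v < 0 ∧
    ∀ w : Coord n, w ≠ 0 → metricForm g x v w = 0 → 0 < metricForm g x w w

/-- The Christoffel symbols `Γ^l_{μν}`. -/
def christoffel {n : ℕ} (g : MetricField n) (l μ ν : Fin (n + 1)) (x : Coord n) : ℝ :=
  (1 / 2) * ∑ σ, inverseMetric g x l σ *
    (partialDeriv μ (fun y => g y σ ν) x + partialDeriv ν (fun y => g y σ μ) x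
      - partialDeriv σ (fun y => g y μ ν) x)

/-- The components `Ric_{μν}` of the Ricci curvature. -/
def ricci {n : ℕ} (g : MetricField n) (μ ν : Fin (n + 1)) (x : Coord n) : ℝ :=
  (∑ l, partialDeriv l (christoffel g l μ ν) x) - (∑ l, partialDeriv ν (christoffel g l l μ) x)
    + (∑ l, ∑ σ, christoffel g l l σ x * christoffel g σ μ ν x)
    - ∑ l, ∑ σ, christoffel g l ν σ x * christoffel g σ l μ x

/-- `Ric_x(v, v) = Ric_{μν}(x) v^μ v^ν`. -/
def ricciForm {n : ℕ} (g : MetricField n) (x v : Coord n) : ℝ :=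
  ∑ μ, ∑ ν, ricci g μ ν x * v μ * v ν

/-- The density `√|det g|` of the volume form `dVol_g` with respect to `dx^0 ⋯ dx^n`. -/
def volDensity {n : ℕ} (g : MetricField n) (x : Coord n) : ℝ :=
  Real.sqrt |(g x).det|

/-- The pairing `⟨ξ, v⟩ = ξ_α v^α` of a covector and a vector. -/
def pairing {n : ℕ} (ξ v : Coord n) : ℝ :=
  ∑ α, ξ α * v α

/-- Smooth compactly supported vector fields on `M` (extended by zero outside `M`). -/
structure IsTestVectorField {n : ℕ} (M : TopologicalSpace.Opens (Coord n))
    (Y : Coord n → Coord n) : Prop where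
  smooth : ContDiff ℝ ∞ Y
  compact : HasCompactSupport Y
  support : tsupport Y ⊆ M

/-- `∫_M Ric(Y, Y) dVol_g`. -/
def ricciIntegral {n : ℕ} (M : TopologicalSpace.Opens (Coord n)) (g : MetricField n)
    (Y : Coord n → Coord n) : ℝ :=
  ∫ x in (M : Set (Coord n)), ricciForm g x (Y x) * volDensity g x

/-! ### The cotangent bundle, the geodesic flow and measure solutions -/

/-- The cotangent bundle `T^*M` in the coordinates `(x, ξ)`. -/
abbrev Cotangent {n : ℕ} (M : TopologicalSpace.Opens (Coord n)) : Type := M × Coord n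

/-- The derivative of `a(x, ξ)` along the generator of the geodesic flow on the cotangent bundle,
`(g⁻¹)^{αβ} ξ_β ∂_{x^α} a - 1/2 (∂_μ g⁻¹)^{αβ} ξ_α ξ_β ∂_{ξ_μ} a`. -/
def flowDeriv {n : ℕ} (g : MetricField n) (a : Coord n × Coord n → ℝ) (x ξ : Coord n) : ℝ :=
  (∑ α, ∑ β, inverseMetric g x α β * ξ β * fderiv ℝ a (x, ξ) (basisVec α, 0))
    - (1 / 2) * ∑ μ, ∑ α, ∑ β,
        partialDeriv μ (fun y => inverseMetric g y α β) x * ξ α * ξ β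
          * fderiv ℝ a (x, ξ) (0, basisVec μ)

/-- Functions in `C_c^∞(T^*M ∖ {0})` (extended by zero). -/
structure IsTestFunction {n : ℕ} (M : TopologicalSpace.Opens (Coord n))
    (a : Coord n × Coord n → ℝ) : Prop where
  smooth : ContDiff ℝ ∞ a
  compact : HasCompactSupport a
  support : tsupport a ⊆ (M : Set (Coord n)) ×ˢ {ξ | ξ ≠ 0}

/-- `μ` is a non-negative Radon measure on `T^*M` with `∫ |ξ|² dμ < ∞` that solves the massless
Vlasov equation. (A locally finite Borel measure on `T^*M` is Radon.) -/
structure SolvesMasslessVlasov {n : ℕ} (M : TopologicalSpace.Opens (Coord n)) (g : MetricField n)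
    (μ : Measure (Cotangent M)) : Prop where
  radon : IsLocallyFiniteMeasure μ
  finite_energy : ∫⁻ p : Cotangent M, ENNReal.ofReal (‖p.2‖ ^ 2) ∂μ < ⊤
  null_support : μ {p : Cotangent M | cometricForm g p.1 p.2 p.2 ≠ 0} = 0
  transport : ∀ a : Coord n × Coord n → ℝ, IsTestFunction M a →
    ∫ p in {p : Cotangent M | p.2 ≠ 0}, flowDeriv g a p.1 p.2 ∂μ = 0

/-- `(M, g, μ)` is a measure solution to the Einstein–massless Vlasov system. -/
structure IsMeasureSolution {n : ℕ} (M : TopologicalSpace.Opens (Coord n)) (g : MetricField n)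
    (μ : Measure (Cotangent M)) : Prop where
  einstein : ∀ Y : Coord n → Coord n, IsTestVectorField M Y →
    ricciIntegral M g Y = ∫ p : Cotangent M, pairing p.2 (Y p.1) ^ 2 ∂μ
  vlasov : SolvesMasslessVlasov M g μ

/-! ### The cosphere bundle and radially-averaged measure solutions -/

/-- `T^*M ∖ {0}`. -/
abbrev PuncturedCotangent {n : ℕ} (M : TopologicalSpace.Opens (Coord n)) : Type :=
  {p : Cotangent M // p.2 ≠ 0}

/-- `(x, ξ) ∼ (y, η)` iff `x = y` and `ξ = c η` for some `c > 0`. -/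
def raySetoid {n : ℕ} (M : TopologicalSpace.Opens (Coord n)) : Setoid (PuncturedCotangent M) where
  r p q := p.1.1 = q.1.1 ∧ ∃ c : ℝ, 0 < c ∧ p.1.2 = c • q.1.2
  iseqv :=
    { refl := fun p => ⟨rfl, 1, one_pos, (one_smul ℝ p.1.2).symm⟩
      symm := by
        rintro p q ⟨h, c, hc, hpq⟩
        exact ⟨h.symm, c⁻¹, inv_pos.mpr hc, by rw [hpq, inv_smul_smul₀ hc.ne']⟩
      trans := by
        rintro p q r ⟨h, c, hc, hpq⟩ ⟨h', d, hd, hqr⟩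
        exact ⟨h.trans h', c * d, mul_pos hc hd, by rw [hpq, hqr, mul_smul]⟩ }

/-- The cosphere bundle `S^*M = (T^*M ∖ {0}) / ∼`. -/
def Cosphere {n : ℕ} (M : TopologicalSpace.Opens (Coord n)) : Type := Quotient (raySetoid M)

/-- The quotient topology on the cosphere bundle. -/
instance {n : ℕ} (M : TopologicalSpace.Opens (Coord n)) : TopologicalSpace (Cosphere M) :=
  inferInstanceAs (TopologicalSpace (Quotient (raySetoid M)))

instance {n : ℕ} (M : TopologicalSpace.Opens (Coord n)) : MeasurableSpace (Cosphere M) :=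
  borel (Cosphere M)

instance {n : ℕ} (M : TopologicalSpace.Opens (Coord n)) : BorelSpace (Cosphere M) := ⟨rfl⟩

/-- The class `[(x, ξ)]` of a nonzero covector. -/
def Cosphere.mk {n : ℕ} {M : TopologicalSpace.Opens (Coord n)} (p : PuncturedCotangent M) :
    Cosphere M :=
  Quotient.mk (raySetoid M) p

/-- A representative `(x, ξ)` of a point of the cosphere bundle. It is only inserted into
functions of `(x, ξ)` that are homogeneous of degree `0` in `ξ`, which do not depend on the
choice of the representative. -/
def Cosphere.rep {n : ℕ} {M : TopologicalSpace.Opens (Coord n)} (θ : Cosphere M) : Cotangent M :=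
  (Quotient.out (s := raySetoid M) θ).1

theorem Cosphere.rep_mk {n : ℕ} {M : TopologicalSpace.Opens (Coord n)}
    (p : PuncturedCotangent M) :
    (Cosphere.mk p).rep.1 = p.1.1 ∧ ∃ c : ℝ, 0 < c ∧ (Cosphere.mk p).rep.2 = c • p.1.2 :=
  Quotient.mk_out (s := raySetoid M) p

/-- `C^1` functions on `T^*M ∖ {0}` that are homogeneous of degree `1` in `ξ` and whose support
is contained in `T^*K` for a compact `K ⊆ M`. -/
structure IsHomogeneousTestFunction {n : ℕ} (M : TopologicalSpace.Opens (Coord n))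
    (a : Coord n × Coord n → ℝ) : Prop where
  contDiffOn : ContDiffOn ℝ 1 a ((M : Set (Coord n)) ×ˢ {ξ | ξ ≠ 0})
  homogeneous : ∀ x ∈ M, ∀ ξ : Coord n, ξ ≠ 0 → ∀ c : ℝ, 0 < c → a (x, c • ξ) = c * a (x, ξ)
  compact : ∃ K : Set (Coord n), IsCompact K ∧ K ⊆ M ∧
    ∀ x ∈ M, x ∉ K → ∀ ξ : Coord n, ξ ≠ 0 → a (x, ξ) = 0

/-- `(M, g, ν)` is a radially-averaged measure solution to the Einstein–massless Vlasov system,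
`ν` being a non-negative finite Radon measure on `S^*M`. -/
structure IsRadiallyAveragedSolution {n : ℕ} (M : TopologicalSpace.Opens (Coord n))
    (g : MetricField n) (ν : Measure (Cosphere M)) : Prop where
  finite : IsFiniteMeasure ν
  einstein : ∀ Y : Coord n → Coord n, IsTestVectorField M Y →
    ricciIntegral M g Y = ∫ θ, pairing θ.rep.2 (Y θ.rep.1) ^ 2 / ‖θ.rep.2‖ ^ 2 ∂ν
  null_support : ∀ f : Cosphere M → ℝ, Continuous f → HasCompactSupport f →
    ∫ θ, f θ * cometricForm g θ.rep.1 θ.rep.2 θ.rep.2 / ‖θ.rep.2‖ ^ 2 ∂ν = 0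
  transport : ∀ a : Coord n × Coord n → ℝ, IsHomogeneousTestFunction M a →
    ∫ θ, flowDeriv g a θ.rep.1 θ.rep.2 / ‖θ.rep.2‖ ^ 2 ∂ν = 0

/-- `ν` is the radial average of `|ξ|² μ`:
`∫_{S^*M} φ dν = ∫_{T^*M ∖ {0}} φ([(x, ξ)]) |ξ|² dμ` for all `φ ∈ C_c(S^*M)`. -/
def IsRadialAverage {n : ℕ} {M : TopologicalSpace.Opens (Coord n)}
    (μ : Measure (Cotangent M)) (ν : Measure (Cosphere M)) : Prop :=
  ∀ φ : Cosphere M → ℝ, Continuous φ → HasCompactSupport φ →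
    ∫ θ, φ θ ∂ν =
      ∫ p : PuncturedCotangent M, φ (Cosphere.mk p) * ‖p.1.2‖ ^ 2
        ∂(μ.comap (Subtype.val : PuncturedCotangent M → Cotangent M))

/-! ### Global hyperbolicity -/

/-- An inextendible causal curve in `M`: a regular `C^1` curve with causal tangent that has no
endpoint in `M`. An inextendible curve is parametrized by an open interval, which may be taken to
be `ℝ`. -/
structure IsInextendibleCausalCurve {n : ℕ} (M : TopologicalSpace.Opens (Coord n))
    (g : MetricField n) (γ : ℝ → Coord n) : Prop where
  contDiff : ContDiff ℝ 1 γ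
  mem : ∀ s, γ s ∈ M
  regular : ∀ s, deriv γ s ≠ 0
  causal : ∀ s, metricForm g (γ s) (deriv γ s) (deriv γ s) ≤ 0
  no_future_endpoint : ¬ ∃ p ∈ M, Tendsto γ atTop (𝓝 p)
  no_past_endpoint : ¬ ∃ p ∈ M, Tendsto γ atBot (𝓝 p)

/-- The differential `du` of `u` at `x`, as a covector. -/
def differential {n : ℕ} (u : Coord n → ℝ) (x : Coord n) : Coord n :=
  WithLp.toLp 2 (fun α => partialDeriv α u x)

/-- `S` is a Cauchy hypersurface of `(M, g)`: a spacelike `C^1` hypersurface (locally the zero set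
of a `C^1` function with timelike differential) that every inextendible causal curve meets exactly
once. -/
structure IsCauchyHypersurface {n : ℕ} (M : TopologicalSpace.Opens (Coord n)) (g : MetricField n)
    (S : Set (Coord n)) : Prop where
  subset : S ⊆ M
  spacelike : ∀ p ∈ S, ∃ U : Set (Coord n), IsOpen U ∧ p ∈ U ∧ U ⊆ M ∧
    ∃ u : Coord n → ℝ, ContDiffOn ℝ 1 u U ∧ (∀ x ∈ U, x ∈ S ↔ u x = 0) ∧
      ∀ x ∈ U, cometricForm g x (differential u x) (differential u x) < 0
  meets_once : ∀ γ : ℝ → Coord n, IsInextendibleCausalCurve M g γ → ∃! s, γ s ∈ S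

/-- `(M, g)` is globally hyperbolic: it has a Cauchy hypersurface. -/
def GloballyHyperbolic {n : ℕ} (M : TopologicalSpace.Opens (Coord n)) (g : MetricField n) : Prop :=
  ∃ S : Set (Coord n), IsCauchyHypersurface M g S

end

end EinsteinVlasov

/-! From `μ` to `ν`, let `ν` be the image of `|ξ|² μ` under the projection to the cosphere bundle.
It is finite because `μ` has finite energy, and all conditions except transport follow from
homogeneity. For transport, a test function `a` homogeneous of degree `1` is neither smooth nor
compactly supported in `ξ`. Mollification admits `C^1` test functions
(`integral_flowDeriv_of_contDiff_one`). A cut-off in `t log |ξ|²` then handles large and small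
momenta (`integral_flowDeriv_of_homogeneous`): its derivative is `O(|ξ|⁻¹)`, the geodesic force is
`O(|ξ|²)` and `a` is `O(|ξ|)`, so the error is dominated by `|ξ|²`, which is `μ`-integrable, and
tends to zero pointwise as `t → 0`.

From `ν` to `μ`, a norm of the momentum has to be chosen on each null ray consistently along
geodesics. On a globally hyperbolic spacetime, let `ρ(x, ξ)` be the Euclidean norm of the momentum
at the point where the null geodesic of `(x, ξ)` crosses the Cauchy hypersurface. It is positive,
homogeneous of degree `1`, conserved, and continuous on the null cone (`exists_conserved`). Then `μ`
is `ρ² ν` placed on the level set `ρ = 1`, that is, at `ω / ρ(x, ω)` on the ray of the unit covector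
`ω`. The factor `ρ²` makes `ν` the radial average of `μ`, and local bounds on `ρ` make `μ` locally
finite.

Formally the Vlasov equation for `μ` is the averaged one for `ρ · a(x, ξ / ρ)`, because `X ρ = 0`.
But `ρ` is not known to be differentiable, so this is no admissible test function. The averaged
equation is therefore integrated to invariance under the flow (`integral_comp_flow`), extended to
measurable functions (`integral_comp_flow_of_measurable`), applied to `ρ · a(x, ξ / ρ)`, and
differentiated at time zero (`integral_conserved_section`), where only `a` has to be `C^1`.

Inextendible curves are parametrized by `ℝ`, so a complete flow is required. The geodesic field is
multiplied by `f(x) / |ξ|`, where `f` is positive on the spacetime and decays fast enough at its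
boundary and at infinity (`exists_cutoff`). The new flow is complete, commutes with dilations of `ξ`
and has the same orbits up to parametrization. -/

namespace EinsteinVlasov

/-! ### Global flows of bounded Lipschitz fields and their `C^1` dependence on initial data. -/

section Flow

variable {F : Type*} [NormedAddCommGroup F] [NormedSpace ℝ F]

/-- `Φ` is a global flow of the vector field `G`. -/
structure IsGlobalFlow (G : F → F) (Φ : ℝ → F → F) : Prop where
  zero : ∀ q, Φ 0 q = q
  hasDerivAt : ∀ q t, HasDerivAt (fun s => Φ s q) (G (Φ t q)) t

/-- A field bounded by `L` moves a point by at most `L (m + 1)` in time `m + 1`, so Picard–Lindelöf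
holds on every interval with a ball of that radius. Uniqueness glues the solutions. -/
theorem exists_isGlobalFlow [CompleteSpace F] {G : F → F} {K L : NNReal} (hK : LipschitzWith K G)
    (hL : ∀ q, ‖G q‖ ≤ L) : ∃ Φ, IsGlobalFlow G Φ := by
  have key : ∀ (q : F) (m : ℕ), ∃ α : ℝ → F, α 0 = q ∧
      ∀ t ∈ Ioo (-(m + 1 : ℝ)) (m + 1), HasDerivAt α (G (α t)) t := by
    intro q m
    have hm : (0 : ℝ) ∈ Icc (-(m + 1 : ℝ)) (m + 1) := ⟨by linarith, by positivity⟩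
    have hpl : IsPicardLindelof (fun _ => G) (tmin := -(m + 1 : ℝ)) (tmax := m + 1)
        ⟨0, hm⟩ q (L * (m + 1)) 0 L K := by
      refine .of_time_independent (fun x _ => hL x) hK.lipschitzOnWith ?_
      simp
    obtain ⟨α, h0, h⟩ := hpl.exists_eq_forall_mem_Icc_hasDerivWithinAt₀
    exact ⟨α, h0, fun t ht => (h t ⟨ht.1.le, ht.2.le⟩).hasDerivAt (Icc_mem_nhds ht.1 ht.2)⟩
  choose α h0 h using key
  have agree : ∀ q (m k : ℕ), m ≤ k → EqOn (α q m) (α q k) (Ioo (-(m + 1 : ℝ)) (m + 1)) := by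
    intro q m k hmk
    have hmk' : (m : ℝ) ≤ k := by exact_mod_cast hmk
    refine ODE_solution_unique_of_mem_Ioo (v := fun _ => G) (s := fun _ => univ) (K := K) (t₀ := 0)
      (fun t _ => hK.lipschitzOnWith) ⟨by linarith, by positivity⟩
      (fun t ht => ⟨h q m t ht, trivial⟩)
      (fun t ht => ⟨h q k t ⟨by linarith [ht.1], by linarith [ht.2]⟩, trivial⟩)
      (by rw [h0, h0])
  refine ⟨fun t q => α q ⌈|t|⌉₊ t, fun q => h0 _ _, fun q t => ?_⟩
  have ht : |t| < ⌈|t|⌉₊ + 1 := (Nat.le_ceil _).trans_lt (by linarith)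
  refine ((h q ⌈|t|⌉₊ t (abs_lt.1 ht))).congr_of_eventuallyEq ?_
  have hev : ∀ᶠ s in 𝓝 t, |s| < (⌈|t|⌉₊ + 1 : ℝ) := continuous_abs.continuousAt.eventually_lt_const ht
  filter_upwards [hev] with s hs
  have hs' : |s| < ⌈|s|⌉₊ + 1 := (Nat.le_ceil _).trans_lt (by linarith)
  rcases le_total ⌈|s|⌉₊ ⌈|t|⌉₊ with hle | hle
  · exact agree q _ _ hle (abs_lt.1 hs')
  · exact (agree q _ _ hle (abs_lt.1 hs)).symm

namespace IsGlobalFlow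

variable {G : F → F} {Φ : ℝ → F → F} {K : NNReal}

theorem neg (h : IsGlobalFlow G Φ) : IsGlobalFlow (fun q => -G q) (fun t => Φ (-t)) where
  zero q := by simp [h.zero]
  hasDerivAt q t := by
    have := (h.hasDerivAt q (-t)).scomp t (hasDerivAt_neg t)
    simpa [Function.comp_def] using this

theorem eq_of_hasDerivAt (h : IsGlobalFlow G Φ) (hK : LipschitzWith K G) {γ : ℝ → F}
    (hγ : ∀ t, HasDerivAt γ (G (γ t)) t) (t : ℝ) : γ t = Φ t (γ 0) := by
  have := ODE_solution_unique_univ (v := fun _ => G) (s := fun _ => univ) (K := K) (t₀ := 0)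
    (fun t => hK.lipschitzOnWith) (fun t => ⟨hγ t, trivial⟩)
    (fun t => ⟨h.hasDerivAt (γ 0) t, trivial⟩) (h.zero _).symm
  exact congrFun this t

theorem add (h : IsGlobalFlow G Φ) (hK : LipschitzWith K G) (s t : ℝ) (q : F) :
    Φ (s + t) q = Φ s (Φ t q) := by
  have := h.eq_of_hasDerivAt hK (γ := fun s => Φ (s + t) q)
    (fun u => (h.hasDerivAt q (u + t)).comp_add_const u t) s
  simpa using this

theorem continuous_time (h : IsGlobalFlow G Φ) (q : F) : Continuous fun t => Φ t q :=
  continuous_iff_continuousAt.2 fun t => (h.hasDerivAt q t).continuousAt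

theorem dist_le_of_nonneg (h : IsGlobalFlow G Φ) (hK : LipschitzWith K G) {t : ℝ} (ht : 0 ≤ t)
    (p q : F) : dist (Φ t p) (Φ t q) ≤ dist p q * Real.exp (K * t) := by
  have := dist_le_of_trajectories_ODE (v := fun _ => G) (K := K) (a := 0) (b := t)
    (δ := dist p q) (fun _ => hK)
    (h.continuous_time p).continuousOn (fun s _ => (h.hasDerivAt p s).hasDerivWithinAt)
    (h.continuous_time q).continuousOn (fun s _ => (h.hasDerivAt q s).hasDerivWithinAt)
    (by rw [h.zero, h.zero]) t ⟨ht, le_rfl⟩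
  simpa using this

theorem dist_le (h : IsGlobalFlow G Φ) (hK : LipschitzWith K G) (t : ℝ)
    (p q : F) : dist (Φ t p) (Φ t q) ≤ dist p q * Real.exp (K * |t|) := by
  rcases le_total 0 t with ht | ht
  · simpa [abs_of_nonneg ht] using h.dist_le_of_nonneg hK ht p q
  · have := h.neg.dist_le_of_nonneg hK.neg (neg_nonneg.2 ht) p q
    simpa [abs_of_nonpos ht] using this

theorem continuous_uncurry (h : IsGlobalFlow G Φ) (hK : LipschitzWith K G) :
    Continuous fun z : ℝ × F => Φ z.1 z.2 := by
  refine continuous_iff_continuousAt.2 fun ⟨t, q⟩ => ?_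
  rw [ContinuousAt, tendsto_iff_dist_tendsto_zero]
  have hb : Tendsto (fun z : ℝ × F => dist z.2 q * Real.exp (K * |z.1|) + dist (Φ z.1 q) (Φ t q))
      (𝓝 (t, q)) (𝓝 (dist q q * Real.exp (K * |t|) + dist (Φ t q) (Φ t q))) := by
    have h1 : Continuous fun z : ℝ × F =>
        dist z.2 q * Real.exp (K * |z.1|) + dist (Φ z.1 q) (Φ t q) := by
      have := (h.continuous_time q).comp (continuous_fst (X := ℝ) (Y := F))
      exact ((continuous_snd.dist continuous_const).mul (by fun_prop)).add
        (this.dist continuous_const)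
    exact h1.tendsto (t, q)
  simp only [dist_self, zero_mul, zero_add] at hb
  refine squeeze_zero (fun _ => dist_nonneg) (fun z => ?_) hb
  exact (dist_triangle _ (Φ z.1 q) _).trans (add_le_add_left (h.dist_le hK _ _ _) _)

theorem gronwallBound_zero_mul (K ε x : ℝ) :
    gronwallBound 0 K ε x = ε * gronwallBound 0 K 1 x := by
  by_cases hK : K = 0
  · simp [hK, gronwallBound_K0]
  · simp [gronwallBound_of_K_ne_0 hK]; ring

/-- On a short time interval the flow of a `C^1` vector field is differentiable in the initial
condition, with derivative solving the linearised equation. -/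
theorem exists_hasFDerivAt [CompleteSpace F] (h : IsGlobalFlow G Φ) (hK : LipschitzWith K G)
    (hG : ContDiff ℝ 1 G) (q : F) :
    ∃ A : ℝ → F →L[ℝ] F, A 0 = ContinuousLinearMap.id ℝ F ∧
      (∀ t ∈ Icc (0 : ℝ) (1 / (2 * K + 1)),
        HasDerivWithinAt A ((fderiv ℝ G (Φ t q)).comp (A t)) (Icc 0 (1 / (2 * K + 1))) t) ∧
      ∀ t ∈ Icc (0 : ℝ) (1 / (2 * K + 1)), HasFDerivAt (Φ t) (A t) q := by
  set T : ℝ := 1 / (2 * K + 1) with hTdef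
  have hT : 0 ≤ T := by positivity
  have hDK : ∀ p, ‖fderiv ℝ G p‖ ≤ K := fun p => norm_fderiv_le_of_lipschitz ℝ hK
  have hDG : Continuous (fderiv ℝ G) := hG.continuous_fderiv one_ne_zero
  have hlip : ∀ t, LipschitzWith K (fun B : F →L[ℝ] F => (fderiv ℝ G (Φ t q)).comp B) := by
    intro t
    refine LipschitzWith.of_dist_le_mul fun B C => ?_
    rw [dist_eq_norm, dist_eq_norm, ← ContinuousLinearMap.comp_sub]
    exact (ContinuousLinearMap.opNorm_comp_le _ _).trans
      (mul_le_mul_of_nonneg_right (hDK _) (norm_nonneg _))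
  -- Operators in the unit ball about the identity have norm at most `2`, so the linearised field is
  -- bounded there by `2 K`. The time `T = 1 / (2 K + 1)` is too short to leave this ball.
  have hpl : IsPicardLindelof (fun t (B : F →L[ℝ] F) => (fderiv ℝ G (Φ t q)).comp B)
      (tmin := 0) (tmax := T) ⟨0, le_rfl, hT⟩ (ContinuousLinearMap.id ℝ F) 1 0 (2 * K) K := by
    refine ⟨fun t _ => (hlip t).lipschitzOnWith, fun B _ => ?_, fun t _ B hB => ?_, ?_⟩
    · exact ((hDG.comp (h.continuous_time q)).clm_comp continuous_const).continuousOn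
    · have hB' : ‖B‖ ≤ 2 := by
        have h1 : ‖B - ContinuousLinearMap.id ℝ F‖ ≤ 1 := by
          rw [← dist_eq_norm]; simpa using hB
        have h2 := norm_add_le (B - ContinuousLinearMap.id ℝ F) (ContinuousLinearMap.id ℝ F)
        have h3 := ContinuousLinearMap.norm_id_le (𝕜 := ℝ) (E := F)
        rw [sub_add_cancel] at h2
        linarith
      calc ‖(fderiv ℝ G (Φ t q)).comp B‖ ≤ ‖fderiv ℝ G (Φ t q)‖ * ‖B‖ :=
            ContinuousLinearMap.opNorm_comp_le _ _
        _ ≤ K * 2 := mul_le_mul (hDK _) hB' (norm_nonneg _) K.coe_nonneg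
        _ = ((2 * K : NNReal) : ℝ) := by push_cast; ring
    · simp only [sub_zero, sub_self, NNReal.coe_mul, NNReal.coe_ofNat, NNReal.coe_one,
        NNReal.coe_zero, max_eq_left hT]
      rw [hTdef, mul_one_div, div_le_one (by positivity)]
      linarith
  obtain ⟨A, hA0, hA⟩ := hpl.exists_eq_forall_mem_Icc_hasDerivWithinAt₀
  refine ⟨A, hA0, hA, fun t ht => ?_⟩
  have hAc : ContinuousOn A (Icc 0 T) := fun s hs => (hA s hs).continuousWithinAt
  set C : ℝ := Real.exp (K * T) with hC
  have hCpos : 0 < C := Real.exp_pos _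
  set D : ℝ := gronwallBound 0 K 1 t with hD
  have hD0 : 0 ≤ D := by
    have := gronwallBound_mono (δ := 0) (ε := 1) (K := K) le_rfl zero_le_one K.coe_nonneg ht.1
    simpa [gronwallBound_x0] using this
  rw [hasFDerivAt_iff_isLittleO_nhds_zero, Asymptotics.isLittleO_iff]
  intro c hc
  -- The Gronwall estimate below bounds the remainder by `ε * C * D * ‖v‖`.
  obtain ⟨ε, hε, hεc⟩ : ∃ ε : ℝ, 0 < ε ∧ ε * C * D ≤ c := by
    refine ⟨c / (C * (D + 1)), by positivity, ?_⟩
    rw [div_mul_eq_mul_div, div_mul_eq_mul_div, div_le_iff₀ (by positivity)]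
    nlinarith [mul_pos hc hCpos]
  have hcomp : IsCompact ((fun s => Φ s q) '' Icc 0 T) :=
    isCompact_Icc.image (h.continuous_time q)
  have hu := hcomp.uniformContinuousAt_of_continuousAt (fderiv ℝ G)
    (fun x _ => hDG.continuousAt) (Metric.dist_mem_uniformity hε)
  obtain ⟨δ, hδ, hδ'⟩ := Metric.mem_uniformity_dist.1 hu
  have hev : ∀ᶠ v : F in 𝓝 0, ‖v‖ < δ / C := by
    have := Metric.ball_mem_nhds (0 : F) (show 0 < δ / C by positivity)
    filter_upwards [this] with v hv using by simpa using hv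
  filter_upwards [hev] with v hv
  have hclose : ∀ s ∈ Icc (0 : ℝ) T, ‖Φ s (q + v) - Φ s q‖ ≤ ‖v‖ * C := by
    intro s hs
    have := h.dist_le_of_nonneg hK hs.1 (q + v) q
    rw [dist_eq_norm, dist_eq_norm, add_sub_cancel_left] at this
    refine this.trans (mul_le_mul_of_nonneg_left ?_ (norm_nonneg _))
    exact Real.exp_le_exp.2 (mul_le_mul_of_nonneg_left hs.2 K.coe_nonneg)
  have hrem : ∀ s ∈ Icc (0 : ℝ) T,
      ‖G (Φ s (q + v)) - G (Φ s q) - fderiv ℝ G (Φ s q) (Φ s (q + v) - Φ s q)‖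
        ≤ ε * (‖v‖ * C) := by
    intro s hs
    have h1 : ‖G (Φ s (q + v)) - G (Φ s q) - fderiv ℝ G (Φ s q) (Φ s (q + v) - Φ s q)‖
        ≤ ε * ‖Φ s (q + v) - Φ s q‖ := by
      refine (convex_ball (Φ s q) δ).norm_image_sub_le_of_norm_fderiv_le'
        (fun x _ => (hG.differentiable one_ne_zero) x) (fun x hx => ?_) (Metric.mem_ball_self hδ) ?_
      · have := hδ' (a := Φ s q) (b := x) (by rw [dist_comm]; exact hx) (mem_image_of_mem _ hs)
        rw [← dist_eq_norm, dist_comm]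
        exact (show dist (fderiv ℝ G (Φ s q)) (fderiv ℝ G x) < ε from this).le
      · rw [mem_ball_iff_norm]
        refine (hclose s hs).trans_lt ?_
        rwa [← lt_div_iff₀ hCpos]
    exact h1.trans (mul_le_mul_of_nonneg_left (hclose s hs) hε.le)
  -- The remainder `Φ s (q + v) - Φ s q - A s v` starts at `0` and solves the linearised equation up
  -- to the Taylor error of `G`, which `hrem` bounds.
  have hy := norm_le_gronwallBound_of_norm_deriv_right_le
    (f := fun s => Φ s (q + v) - Φ s q - A s v)
    (f' := fun s => G (Φ s (q + v)) - G (Φ s q) - (fderiv ℝ G (Φ s q)) (A s v))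
    (δ := 0) (K := K) (ε := ε * (‖v‖ * C)) (a := 0) (b := T)
    (((h.continuous_time _).sub (h.continuous_time _)).continuousOn.sub
      (hAc.clm_apply continuousOn_const))
    (fun s hs => by
      have hA' : HasDerivWithinAt A _ (Ici s) s :=
        (hA s ⟨hs.1, hs.2.le⟩).mono_of_mem_nhdsWithin
          (mem_of_superset (Icc_mem_nhdsGE hs.2) (Icc_subset_Icc_left hs.1))
      have := hA'.clm_apply (hasDerivWithinAt_const s (Ici s) v)
      simp only [map_zero, add_zero, ContinuousLinearMap.comp_apply] at this
      exact ((h.hasDerivAt _ s).hasDerivWithinAt.sub (h.hasDerivAt _ s).hasDerivWithinAt).sub this)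
    (by simp [h.zero, hA0])
    (fun s hs => by
      have e : G (Φ s (q + v)) - G (Φ s q) - (fderiv ℝ G (Φ s q)) (A s v) =
          (fderiv ℝ G (Φ s q)) (Φ s (q + v) - Φ s q - A s v) +
          (G (Φ s (q + v)) - G (Φ s q) - fderiv ℝ G (Φ s q) (Φ s (q + v) - Φ s q)) := by
        rw [map_sub _ (Φ s (q + v) - Φ s q)]; abel
      rw [e]
      refine (norm_add_le _ _).trans (add_le_add ?_ (hrem s ⟨hs.1, hs.2.le⟩))
      exact (ContinuousLinearMap.le_opNorm _ _).trans
        (mul_le_mul_of_nonneg_right (hDK _) (norm_nonneg _)))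
    t ht
  rw [sub_zero, gronwallBound_zero_mul] at hy
  calc _ ≤ ε * (‖v‖ * C) * D := hy
    _ = (ε * C * D) * ‖v‖ := by ring
    _ ≤ c * ‖v‖ := mul_le_mul_of_nonneg_right hεc (norm_nonneg _)

/-- What remains is the continuity of the derivative `A q t` in `q`. It follows from Gronwall
applied to two linearised equations whose coefficients are uniformly close along nearby orbits. -/
theorem contDiff_of_mem_Icc [CompleteSpace F] (h : IsGlobalFlow G Φ) (hK : LipschitzWith K G)
    (hG : ContDiff ℝ 1 G) {t : ℝ} (ht : t ∈ Icc (0 : ℝ) (1 / (2 * K + 1))) :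
    ContDiff ℝ 1 (Φ t) := by
  choose A hA0 hA hAf using h.exists_hasFDerivAt hK hG
  set T : ℝ := 1 / (2 * K + 1) with hTdef
  have hT : 0 ≤ T := by positivity
  have hDK : ∀ p, ‖fderiv ℝ G p‖ ≤ K := fun p => norm_fderiv_le_of_lipschitz ℝ hK
  have hDG : Continuous (fderiv ℝ G) := hG.continuous_fderiv one_ne_zero
  set C : ℝ := Real.exp (K * T) with hC
  have hAC : ∀ p, ∀ s ∈ Icc (0 : ℝ) T, ‖A p s‖ ≤ C := by
    intro p s hs
    rw [← (hAf p s hs).fderiv]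
    refine norm_fderiv_le_of_lipschitz ℝ (C := ⟨C, (Real.exp_pos _).le⟩)
      (LipschitzWith.of_dist_le_mul fun x y => ?_)
    refine (h.dist_le_of_nonneg hK hs.1 x y).trans ?_
    rw [mul_comm]
    refine mul_le_mul_of_nonneg_right ?_ dist_nonneg
    exact Real.exp_le_exp.2 (mul_le_mul_of_nonneg_left hs.2 K.coe_nonneg)
  have hAc : ∀ p, ContinuousOn (A p) (Icc 0 T) := fun p s hs => (hA p s hs).continuousWithinAt
  have hA' : ∀ p, ∀ s ∈ Ico 0 T, HasDerivWithinAt (A p) ((fderiv ℝ G (Φ s p)).comp (A p s))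
      (Ici s) s := fun p s hs => (hA p s ⟨hs.1, hs.2.le⟩).mono_of_mem_nhdsWithin
        (mem_of_superset (Icc_mem_nhdsGE hs.2) (Icc_subset_Icc_left hs.1))
  refine contDiff_one_iff_hasFDerivAt.2 ⟨fun q => A q t, ?_, fun q => hAf q t ht⟩
  set D : ℝ := gronwallBound 0 K 1 t with hD
  have hD0 : 0 ≤ D := by
    have := gronwallBound_mono (δ := 0) (ε := 1) (K := K) le_rfl zero_le_one K.coe_nonneg ht.1
    simpa [gronwallBound_x0] using this
  refine Metric.continuous_iff.2 fun q c hc => ?_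
  have hCpos : 0 < C := Real.exp_pos _
  set ε : ℝ := c / (C * (D + 1)) with hεdef
  have hε : 0 < ε := by positivity
  have hcomp : IsCompact ((fun s => Φ s q) '' Icc 0 T) :=
    isCompact_Icc.image (h.continuous_time q)
  have hu := hcomp.uniformContinuousAt_of_continuousAt (fderiv ℝ G)
    (fun x _ => hDG.continuousAt) (Metric.dist_mem_uniformity hε)
  obtain ⟨δ, hδ, hδ'⟩ := Metric.mem_uniformity_dist.1 hu
  refine ⟨δ / C, by positivity, fun p hp => ?_⟩
  have hlip : ∀ t, LipschitzWith K (fun B : F →L[ℝ] F => (fderiv ℝ G (Φ t q)).comp B) := by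
    intro t
    refine LipschitzWith.of_dist_le_mul fun B C => ?_
    rw [dist_eq_norm, dist_eq_norm, ← ContinuousLinearMap.comp_sub]
    exact (ContinuousLinearMap.opNorm_comp_le _ _).trans
      (mul_le_mul_of_nonneg_right (hDK _) (norm_nonneg _))
  -- `A p` solves the linearised equation along the orbit of `q` with error `(DG (Φ s p) - DG (Φ s
  -- q)) ∘ A p s`, of norm at most `ε * C`.
  have := dist_le_of_approx_trajectories_ODE
    (v := fun s (B : F →L[ℝ] F) => (fderiv ℝ G (Φ s q)).comp B)
    (f := A p) (g := A q) (εf := ε * C) (εg := 0) (δ := 0) hlip (hAc p) (hA' p)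
    (fun s hs => by
      rw [dist_eq_norm, ← ContinuousLinearMap.sub_comp]
      refine (ContinuousLinearMap.opNorm_comp_le _ _).trans
        (mul_le_mul ?_ (hAC p s ⟨hs.1, hs.2.le⟩) (norm_nonneg _) hε.le)
      rw [← dist_eq_norm, dist_comm]
      have h1 : dist (Φ s q) (Φ s p) < δ := by
        rw [dist_comm]
        refine (h.dist_le_of_nonneg hK hs.1 p q).trans_lt ?_
        refine (mul_le_mul_of_nonneg_left (Real.exp_le_exp.2
          (mul_le_mul_of_nonneg_left hs.2.le K.coe_nonneg)) dist_nonneg).trans_lt ?_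
        rwa [← lt_div_iff₀ hCpos]
      exact (show dist _ _ < ε from hδ' h1 (mem_image_of_mem _ ⟨hs.1, hs.2.le⟩)).le)
    (hAc q) (hA' q) (fun s _ => by rw [dist_self]) (by rw [hA0, hA0, dist_self]) t ht
  rw [sub_zero, add_zero, gronwallBound_zero_mul] at this
  refine this.trans_lt ?_
  rw [hεdef, div_mul_eq_mul_div, div_mul_eq_mul_div, div_lt_iff₀ (by positivity)]
  nlinarith [mul_pos hc hCpos]

/-- The group law writes the time-`t` map as an iterate of a short-time map. Negative times follow
by reversing the field. -/
theorem contDiff [CompleteSpace F] (h : IsGlobalFlow G Φ) (hK : LipschitzWith K G)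
    (hG : ContDiff ℝ 1 G) (t : ℝ) : ContDiff ℝ 1 (Φ t) := by
  have pos : ∀ {G : F → F} {Φ : ℝ → F → F}, IsGlobalFlow G Φ → LipschitzWith K G →
      ContDiff ℝ 1 G → ∀ t, 0 ≤ t → ContDiff ℝ 1 (Φ t) := by
    intro G Φ h hK hG t ht
    obtain ⟨m, hm⟩ := exists_nat_ge (t * (2 * K + 1))
    have hm' : t / (m + 1) ∈ Icc (0 : ℝ) (1 / (2 * K + 1)) := by
      refine ⟨by positivity, ?_⟩
      rw [div_le_div_iff₀ (by positivity) (by positivity)]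
      linarith
    have key : ∀ k : ℕ, ContDiff ℝ 1 (Φ (k * (t / (m + 1)))) := by
      intro k
      induction k with
      | zero =>
        have : Φ ((0 : ℕ) * (t / (m + 1))) = id := by
          ext q; simp [h.zero]
        rw [this]; exact contDiff_id
      | succ k ih =>
        have : Φ ((k + 1 : ℕ) * (t / (m + 1))) = Φ (k * (t / (m + 1))) ∘ Φ (t / (m + 1)) := by
          ext q
          rw [Function.comp_apply, ← h.add hK]
          congr 1
          push_cast; ring
        rw [this]
        exact ih.comp (h.contDiff_of_mem_Icc hK hG hm')
    have := key (m + 1)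
    rwa [Nat.cast_add, Nat.cast_one, mul_div_cancel₀ _ (by positivity)] at this
  rcases le_total 0 t with ht | ht
  · exact pos h hK hG t ht
  · have := pos h.neg hK.neg hG.neg (-t) (neg_nonneg.2 ht)
    simpa using this

end IsGlobalFlow

end Flow

end EinsteinVlasov

/-! ### Lorentzian algebra and the geodesic vector field on the cotangent bundle. -/

namespace EinsteinVlasov

noncomputable section

section Metric

variable {n : ℕ} {k : ℕ∞} {M : TopologicalSpace.Opens (Coord n)} {g : MetricField n} {x : Coord n}

open scoped Matrix in
theorem metricForm_eq_dotProduct (g : MetricField n) (x v w : Coord n) :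
    metricForm g x v w = v.ofLp ⬝ᵥ (g x *ᵥ w.ofLp) := by
  simp only [metricForm, dotProduct, Matrix.mulVec, Finset.mul_sum]
  exact Finset.sum_congr rfl fun _ _ => Finset.sum_congr rfl fun _ _ => by ring

open scoped Matrix in
theorem cometricForm_eq_dotProduct (g : MetricField n) (x v w : Coord n) :
    cometricForm g x v w = v.ofLp ⬝ᵥ (inverseMetric g x *ᵥ w.ofLp) := by
  simp only [cometricForm, dotProduct, Matrix.mulVec, Finset.mul_sum]
  exact Finset.sum_congr rfl fun _ _ => Finset.sum_congr rfl fun _ _ => by ring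

/-- The vector `g⁻¹_x(ξ, ·)` obtained from a covector by raising its index. -/
def raiseIndex (g : MetricField n) (x ξ : Coord n) : Coord n :=
  WithLp.toLp 2 fun α => ∑ β, inverseMetric g x α β * ξ β

/-- The momentum component `-1/2 (∂_μ g⁻¹)^{αβ} ξ_α ξ_β` of the geodesic vector field. -/
def geodesicForce (g : MetricField n) (x ξ : Coord n) : Coord n :=
  WithLp.toLp 2 fun μ =>
    -(1 / 2) * ∑ α, ∑ β, partialDeriv μ (fun y => inverseMetric g y α β) x * ξ α * ξ β

/-- The generator of the geodesic flow on the cotangent bundle. -/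
def hamField (g : MetricField n) (p : Coord n × Coord n) : Coord n × Coord n :=
  (raiseIndex g p.1 p.2, geodesicForce g p.1 p.2)

theorem eq_sum_basisVec (v : Coord n) : v = ∑ α, v α • basisVec α := by
  ext i
  simp [Finset.sum_apply, Pi.single_apply]

/-- This turns the coordinate expression into a derivative along a vector field, to which flows and
the chain rule apply. -/
theorem flowDeriv_eq_fderiv (g : MetricField n) (a : Coord n × Coord n → ℝ) (x ξ : Coord n) :
    flowDeriv g a x ξ = fderiv ℝ a (x, ξ) (hamField g (x, ξ)) := by
  have h : hamField g (x, ξ) =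
      (∑ α, (raiseIndex g x ξ) α • ((basisVec α, 0) : Coord n × Coord n)) +
      ∑ μ, (geodesicForce g x ξ) μ • ((0, basisVec μ) : Coord n × Coord n) := by
    ext1
    · simpa [hamField, Prod.fst_sum] using eq_sum_basisVec (raiseIndex g x ξ)
    · simpa [hamField, Prod.snd_sum] using eq_sum_basisVec (geodesicForce g x ξ)
  rw [h, map_add, map_sum, map_sum]
  simp only [map_smul, smul_eq_mul, raiseIndex, geodesicForce, flowDeriv, Finset.sum_mul,
    Finset.mul_sum, sub_eq_add_neg, ← Finset.sum_neg_distrib]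
  congr 1
  exact Finset.sum_congr rfl fun _ _ => Finset.sum_congr rfl fun _ _ =>
    Finset.sum_congr rfl fun _ _ => by ring

theorem raiseIndex_smul (g : MetricField n) (x ξ : Coord n) (c : ℝ) :
    raiseIndex g x (c • ξ) = c • raiseIndex g x ξ := by
  ext α
  simp only [raiseIndex, PiLp.smul_apply, smul_eq_mul, Finset.mul_sum]
  exact Finset.sum_congr rfl fun _ _ => by ring

theorem geodesicForce_smul (g : MetricField n) (x ξ : Coord n) (c : ℝ) :
    geodesicForce g x (c • ξ) = c ^ 2 • geodesicForce g x ξ := by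
  ext α
  simp only [geodesicForce, PiLp.smul_apply, smul_eq_mul, Finset.mul_sum]
  exact Finset.sum_congr rfl fun _ _ => Finset.sum_congr rfl fun _ _ => by ring

theorem metricForm_add_smul (g : MetricField n) (x u v w : Coord n) (a b : ℝ) :
    metricForm g x u (a • v + b • w) = a * metricForm g x u v + b * metricForm g x u w := by
  simp only [metricForm_eq_dotProduct, WithLp.ofLp_add, WithLp.ofLp_smul, Matrix.mulVec_add,
    Matrix.mulVec_smul, dotProduct_add, dotProduct_smul, smul_eq_mul]

namespace IsLorentzianMetric

theorem metricForm_comm (hg : IsLorentzianMetric k M g) (hx : x ∈ M) (v w : Coord n) :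
    metricForm g x v w = metricForm g x w v := by
  unfold metricForm
  rw [Finset.sum_comm]
  exact Finset.sum_congr rfl fun _ _ => Finset.sum_congr rfl fun _ _ => by
    rw [hg.symm x hx]; ring

/-- A kernel vector would be orthogonal to everything, in particular to the timelike `v` and to
itself, against positivity on the complement of `v`. -/
theorem det_ne_zero (hg : IsLorentzianMetric k M g) (hx : x ∈ M) : (g x).det ≠ 0 := by
  intro h
  obtain ⟨w, hw, hw'⟩ := Matrix.exists_mulVec_eq_zero_iff.2 h
  obtain ⟨v, -, hv⟩ := hg.signature x hx
  have hz : ∀ u : Coord n, metricForm g x u (WithLp.toLp 2 w) = 0 := fun u => by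
    rw [metricForm_eq_dotProduct]; simp [hw']
  have := hv (WithLp.toLp 2 w) (fun h0 => hw (by simpa using h0)) (hz v)
  rw [hz] at this
  exact lt_irrefl _ this

theorem contDiffOn_det (hg : IsLorentzianMetric k M g) :
    ContDiffOn ℝ k (fun x => (g x).det) M := by
  simp only [Matrix.det_apply]
  exact ContDiffOn.sum fun σ _ => ContDiffOn.const_smul _ (contDiffOn_prod fun i _ =>
    hg.contDiffOn _ _)

theorem contDiffOn_inverseMetric (hg : IsLorentzianMetric k M g) (α β : Fin (n + 1)) :
    ContDiffOn ℝ k (fun x => inverseMetric g x α β) M := by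
  have h1 : ContDiffOn ℝ k (fun x => (g x).adjugate α β) M := by
    simp only [Matrix.adjugate_apply, Matrix.det_apply]
    refine ContDiffOn.sum fun σ _ => ContDiffOn.const_smul _ (contDiffOn_prod fun i _ => ?_)
    by_cases h : σ i = β
    · simp only [Matrix.updateRow_apply, h, if_true]; exact contDiffOn_const
    · simp only [Matrix.updateRow_apply, h, if_false]; exact hg.contDiffOn _ _
  refine ((hg.contDiffOn_det.inv fun x hx => hg.det_ne_zero hx).mul h1).congr fun x hx => ?_
  simp [inverseMetric, Matrix.inv_def, Ring.inverse_eq_inv']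

theorem inverseMetric_symm (hg : IsLorentzianMetric k M g) (hx : x ∈ M) (α β : Fin (n + 1)) :
    inverseMetric g x α β = inverseMetric g x β α := by
  have h : (g x).transpose = g x := by
    ext i j; exact hg.symm x hx j i
  have h2 : (inverseMetric g x).transpose = inverseMetric g x := by
    rw [inverseMetric, Matrix.transpose_nonsing_inv, h]
  conv_lhs => rw [← h2]
  rfl

theorem cometricForm_comm (hg : IsLorentzianMetric k M g) (hx : x ∈ M) (v w : Coord n) :
    cometricForm g x v w = cometricForm g x w v := by
  unfold cometricForm
  rw [Finset.sum_comm]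
  exact Finset.sum_congr rfl fun _ _ => Finset.sum_congr rfl fun _ _ => by
    rw [hg.inverseMetric_symm hx]; ring

open scoped Matrix in
theorem metricForm_raiseIndex (hg : IsLorentzianMetric k M g) (hx : x ∈ M) (v ξ : Coord n) :
    metricForm g x v (raiseIndex g x ξ) = pairing ξ v := by
  have h : (raiseIndex g x ξ).ofLp = inverseMetric g x *ᵥ ξ.ofLp := rfl
  rw [metricForm_eq_dotProduct, h, Matrix.mulVec_mulVec, inverseMetric,
    Matrix.mul_nonsing_inv _ (isUnit_iff_ne_zero.2 (hg.det_ne_zero hx)), Matrix.one_mulVec]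
  simp [pairing, dotProduct, mul_comm]

theorem pairing_raiseIndex (ξ η : Coord n) :
    pairing ξ (raiseIndex g x η) = cometricForm g x ξ η := by
  rw [cometricForm_eq_dotProduct]; rfl

theorem metricForm_raiseIndex_raiseIndex (hg : IsLorentzianMetric k M g) (hx : x ∈ M)
    (ξ η : Coord n) :
    metricForm g x (raiseIndex g x ξ) (raiseIndex g x η) = cometricForm g x η ξ := by
  rw [hg.metricForm_raiseIndex hx, pairing_raiseIndex]

theorem raiseIndex_ne_zero (hg : IsLorentzianMetric k M g) (hx : x ∈ M) {ξ : Coord n}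
    (hξ : ξ ≠ 0) : raiseIndex g x ξ ≠ 0 := by
  intro h
  apply hξ
  ext α
  have := hg.metricForm_raiseIndex hx (basisVec α) ξ
  rw [h] at this
  simpa [metricForm, pairing, Pi.single_apply] using this.symm

/-- Let `u` be the timelike vector from the signature. The combination `g(u,w) v - g(u,v) w` is
orthogonal to `u`, so its square should be positive. But the square equals `g(u,w)² g(v,v) < 0`,
where `g(u,w) ≠ 0` because a nonzero null `w` cannot be orthogonal to `u`. -/
theorem null_eq_zero_of_orthogonal_timelike (hg : IsLorentzianMetric k M g) (hx : x ∈ M)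
    {v w : Coord n} (hv : metricForm g x v v < 0) (hw : metricForm g x w w = 0)
    (hvw : metricForm g x v w = 0) : w = 0 := by
  obtain ⟨u, hu, hpos⟩ := hg.signature x hx
  by_contra hw0
  have hwv : metricForm g x w v = 0 := by rw [hg.metricForm_comm hx, hvw]
  have huw : metricForm g x u w ≠ 0 := fun h => by
    have := hpos w hw0 h
    rw [hw] at this
    exact lt_irrefl _ this
  have hz : metricForm g x u ((metricForm g x u w) • v + (-metricForm g x u v) • w) = 0 := by
    rw [metricForm_add_smul]; ring
  have hz2 : ∀ a b : ℝ, metricForm g x (a • v + b • w) (a • v + b • w) =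
      a ^ 2 * metricForm g x v v := by
    intro a b
    rw [metricForm_add_smul, hg.metricForm_comm hx _ v, hg.metricForm_comm hx _ w,
      metricForm_add_smul, metricForm_add_smul, hvw, hwv, hw]
    ring
  have hne : (metricForm g x u w) • v + (-metricForm g x u v) • w ≠ 0 := by
    intro h0
    have h1 := hz2 (metricForm g x u w) (-metricForm g x u v)
    rw [h0] at h1
    have h2 : metricForm g x (0 : Coord n) 0 = 0 := by simp [metricForm]
    rw [h2] at h1
    exact (mul_neg_of_pos_of_neg (pow_pos (abs_pos.2 huw) 2) hv).ne (by rw [sq_abs, ← h1])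
  have := hpos _ hne hz
  rw [hz2] at this
  nlinarith [sq_nonneg (metricForm g x u w)]

/-- A nonzero null covector is not orthogonal to a timelike one. -/
theorem cometricForm_ne_zero_of_timelike_of_null (hg : IsLorentzianMetric k M g) (hx : x ∈ M)
    {η ξ : Coord n} (hη : cometricForm g x η η < 0) (hξ : cometricForm g x ξ ξ = 0)
    (hξ0 : ξ ≠ 0) : cometricForm g x η ξ ≠ 0 := by
  intro h
  refine hg.raiseIndex_ne_zero hx hξ0 (hg.null_eq_zero_of_orthogonal_timelike hx
    (v := raiseIndex g x η) ?_ ?_ ?_)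
  · rwa [hg.metricForm_raiseIndex_raiseIndex hx]
  · rwa [hg.metricForm_raiseIndex_raiseIndex hx]
  · rwa [hg.metricForm_raiseIndex_raiseIndex hx, hg.cometricForm_comm hx]

theorem contDiffOn_partialDeriv_inverseMetric (hg : IsLorentzianMetric 2 M g)
    (μ α β : Fin (n + 1)) :
    ContDiffOn ℝ 1 (fun x => partialDeriv μ (fun y => inverseMetric g y α β) x) M := by
  have h := (hg.contDiffOn_inverseMetric α β).fderiv_of_isOpen (m := 1) M.isOpen
    (by norm_num [one_add_one_eq_two])
  exact h.clm_apply contDiffOn_const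

theorem contDiff_coord_apply {m : WithTop ℕ∞} (α : Fin (n + 1)) :
    ContDiff ℝ m (fun p : Coord n × Coord n => p.2 α) :=
  (contDiff_euclidean.1 contDiff_snd) α

theorem contDiffOn_comp_fst {m : WithTop ℕ∞} {f : Coord n → ℝ}
    (hf : ContDiffOn ℝ m f M) :
    ContDiffOn ℝ m (fun p : Coord n × Coord n => f p.1) ((M : Set (Coord n)) ×ˢ univ) :=
  hf.comp contDiff_fst.contDiffOn fun _ hp => hp.1

theorem contDiffOn_hamField (hg : IsLorentzianMetric 2 M g) :
    ContDiffOn ℝ 1 (hamField g) ((M : Set (Coord n)) ×ˢ univ) := by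
  refine ContDiffOn.prodMk ?_ ?_
  · refine contDiffOn_euclidean.2 fun α => ?_
    change ContDiffOn ℝ 1 (fun p : Coord n × Coord n => ∑ β, inverseMetric g p.1 α β * p.2 β) _
    refine ContDiffOn.sum (n := 1) fun β _ => ContDiffOn.mul (contDiffOn_comp_fst
      ((hg.contDiffOn_inverseMetric α β).of_le ?_)) (contDiff_coord_apply β).contDiffOn
    norm_num
  · refine contDiffOn_euclidean.2 fun μ => ?_
    refine contDiffOn_const.mul (ContDiffOn.sum fun α _ => ContDiffOn.sum fun β _ => ?_)
    exact ((contDiffOn_comp_fst (hg.contDiffOn_partialDeriv_inverseMetric μ α β)).mul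
      (contDiff_coord_apply α).contDiffOn).mul (contDiff_coord_apply β).contDiffOn

theorem contDiffOn_cometricForm (hg : IsLorentzianMetric 2 M g) :
    ContDiffOn ℝ 1 (fun p : Coord n × Coord n => cometricForm g p.1 p.2 p.2)
      ((M : Set (Coord n)) ×ˢ univ) := by
  refine ContDiffOn.sum fun α _ => ContDiffOn.sum fun β _ => ?_
  exact ((contDiffOn_comp_fst ((hg.contDiffOn_inverseMetric α β).of_le (by norm_num))).mul
      (contDiff_coord_apply α).contDiffOn).mul (contDiff_coord_apply β).contDiffOn

/-- The geodesic flow conserves `g⁻¹(ξ, ξ)`. -/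
theorem fderiv_cometricForm_hamField (hg : IsLorentzianMetric 2 M g) (hx : x ∈ M) (ξ : Coord n) :
    fderiv ℝ (fun p : Coord n × Coord n => cometricForm g p.1 p.2 p.2) (x, ξ)
      (hamField g (x, ξ)) = 0 := by
  have hx' : (M : Set (Coord n)) ∈ 𝓝 x := M.isOpen.mem_nhds hx
  have hG : ∀ α β, HasFDerivAt (fun p : Coord n × Coord n => inverseMetric g p.1 α β)
      ((fderiv ℝ (fun y => inverseMetric g y α β) x).comp
        (ContinuousLinearMap.fst ℝ (Coord n) (Coord n))) (x, ξ) := fun α β =>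
    HasFDerivAt.comp (g := fun y => inverseMetric g y α β) (f := Prod.fst) (x, ξ)
      (((hg.contDiffOn_inverseMetric α β).contDiffAt hx').differentiableAt
        (by norm_num)).hasFDerivAt hasFDerivAt_fst
  have hξ : ∀ α, HasFDerivAt (fun p : Coord n × Coord n => p.2 α)
      ((EuclideanSpace.proj α).comp (ContinuousLinearMap.snd ℝ (Coord n) (Coord n))) (x, ξ) :=
    fun α => ((EuclideanSpace.proj (𝕜 := ℝ) α).comp
      (ContinuousLinearMap.snd ℝ (Coord n) (Coord n))).hasFDerivAt
  have hd := HasFDerivAt.fun_sum (u := Finset.univ) fun α _ =>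
    HasFDerivAt.fun_sum (u := Finset.univ) fun β _ => ((hG α β).mul (hξ α)).mul (hξ β)
  have hD : ∀ α β, fderiv ℝ (fun y => inverseMetric g y α β) x (raiseIndex g x ξ) =
      ∑ μ, raiseIndex g x ξ μ * partialDeriv μ (fun y => inverseMetric g y α β) x := by
    intro α β
    conv_lhs => rw [eq_sum_basisVec (raiseIndex g x ξ), map_sum]
    simp [partialDeriv]
  -- The factor `-1/2` in the force enters here: the change of `g⁻¹` along the base motion cancels
  -- the two equal momentum terms of `e3`.
  have e1 : ∑ α, ∑ β, fderiv ℝ (fun y => inverseMetric g y α β) x (raiseIndex g x ξ) * ξ α * ξ β =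
      -2 * pairing (geodesicForce g x ξ) (raiseIndex g x ξ) := by
    simp only [hD, pairing, geodesicForce, Finset.sum_mul, Finset.mul_sum]
    rw [Finset.sum_congr rfl fun α _ => Finset.sum_comm, Finset.sum_comm]
    exact Finset.sum_congr rfl fun _ _ => Finset.sum_congr rfl fun _ _ =>
      Finset.sum_congr rfl fun _ _ => by ring
  have e2 := hg.cometricForm_comm hx (geodesicForce g x ξ) ξ
  rw [pairing_raiseIndex] at e1
  have e3 : fderiv ℝ (fun p : Coord n × Coord n => cometricForm g p.1 p.2 p.2) (x, ξ)
      (hamField g (x, ξ)) =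
      (∑ α, ∑ β, fderiv ℝ (fun y => inverseMetric g y α β) x (raiseIndex g x ξ) * ξ α * ξ β) +
      cometricForm g x (geodesicForce g x ξ) ξ + cometricForm g x ξ (geodesicForce g x ξ) := by
    have hd' : fderiv ℝ (fun p : Coord n × Coord n => cometricForm g p.1 p.2 p.2) (x, ξ) = _ :=
      HasFDerivAt.fderiv hd
    rw [hd']
    simp only [cometricForm]
    simp only [_root_.sum_apply, ← Finset.sum_add_distrib]
    refine Finset.sum_congr rfl fun α _ => Finset.sum_congr rfl fun β _ => ?_
    simp [hamField]
    ring
  rw [e3, e1, ← e2]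
  ring

end IsLorentzianMetric

end Metric

end

end EinsteinVlasov

/-! ### Smooth exhaustions and a positive factor that makes a field bounded and Lipschitz. -/

namespace EinsteinVlasov

section Cutoff

/-- An open set has an increasing sequence of smooth compactly supported cutoff functions, each
compact subset being eventually contained in the set where they are equal to `1`. -/
theorem exists_smooth_exhaustion {V : Type*} [NormedAddCommGroup V] [NormedSpace ℝ V]
    [FiniteDimensional ℝ V] {Ω : Set V} (hΩ : IsOpen Ω) :
    ∃ χ : ℕ → V → ℝ, (∀ k, ContDiff ℝ ∞ (χ k)) ∧ (∀ k, HasCompactSupport (χ k)) ∧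
      (∀ k, tsupport (χ k) ⊆ Ω) ∧ (∀ k x, χ k x ∈ Icc 0 1) ∧ (∀ x, Monotone fun k => χ k x) ∧
      ∀ K ⊆ Ω, IsCompact K → ∃ k, ∀ x ∈ K, χ k x = 1 := by
  obtain ⟨f, hfs, hf, hfr⟩ := hΩ.exists_contDiff_support_eq (n := ⊤)
  have hf01 : ∀ x, 0 ≤ f x ∧ f x ≤ 1 := fun x => hfr (mem_range_self x)
  let b : ℕ → ContDiffBump (0 : V) := fun k =>
    ⟨k + 1, k + 2, by positivity, by linarith⟩
  -- The first factor vanishes for `k f ≤ 1` and is `1` for `k f ≥ 2`, where `f` is positive exactly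
  -- on `Ω`. The bump function bounds the support.
  let χ : ℕ → V → ℝ := fun k x => Real.smoothTransition (k * f x - 1) * b k x
  have hsub : ∀ k, tsupport (χ k) ⊆ {x | 1 ≤ k * f x} ∩ Metric.closedBall 0 (k + 2) := by
    intro k
    refine closure_minimal (fun x hx => ?_)
      ((isClosed_le continuous_const (continuous_const.mul hf.continuous)).inter
        Metric.isClosed_closedBall)
    have h1 := left_ne_zero_of_mul hx
    have h2 := right_ne_zero_of_mul hx
    constructor
    · by_contra h
      exact h1 (Real.smoothTransition.zero_of_nonpos (by simp only [mem_ofPred_eq] at h; linarith))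
    · have : x ∈ Function.support (b k) := h2
      rw [(b k).support_eq] at this
      exact Metric.ball_subset_closedBall this
  refine ⟨χ, fun k => ?_, fun k => ?_, fun k x hx => ?_, fun k x => ?_, fun x => ?_, ?_⟩
  · exact (Real.smoothTransition.contDiff.comp ((contDiff_const.mul hf).sub contDiff_const)).mul
      (b k).contDiff
  · exact (isCompact_closedBall (0 : V) (k + 2)).of_isClosed_subset (isClosed_tsupport _)
      ((hsub k).trans inter_subset_right)
  · rw [← hfs, Function.mem_support]
    intro h
    have := (hsub k hx).1
    simp only [mem_ofPred_eq, h, mul_zero] at this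
    linarith
  · exact ⟨mul_nonneg (Real.smoothTransition.nonneg _) (b k).nonneg,
      mul_le_one₀ (Real.smoothTransition.le_one _) (b k).nonneg (b k).le_one⟩
  · refine monotone_nat_of_le_succ fun k => ?_
    refine mul_le_mul (Real.smoothTransition.monotone ?_) ?_ (b k).nonneg
      (Real.smoothTransition.nonneg _)
    · push_cast; nlinarith [(hf01 x).1]
    · by_cases h : b k x = 0
      · rw [h]; exact (b (k + 1)).nonneg
      · have : x ∈ Function.support (b k) := h
        rw [(b k).support_eq] at this
        rw [(b (k + 1)).one_of_mem_closedBall]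
        · exact (b k).le_one
        · have h2 := Metric.ball_subset_closedBall this
          simp only [b, Metric.mem_closedBall, dist_zero_right, Nat.cast_add, Nat.cast_one] at h2 ⊢
          linarith
  · intro K hK hKc
    rcases K.eq_empty_or_nonempty with rfl | hne
    · exact ⟨0, by simp⟩
    obtain ⟨x0, hx0, hmin⟩ := hKc.exists_isMinOn hne hf.continuous.continuousOn
    have hpos : 0 < f x0 := lt_of_le_of_ne (hf01 x0).1 (Ne.symm (by
      have := hK hx0; rwa [← hfs] at this))
    obtain ⟨R, hR⟩ := hKc.isBounded.exists_norm_le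
    obtain ⟨k, hk⟩ := exists_nat_ge (max (2 / f x0) R)
    refine ⟨k, fun x hx => ?_⟩
    have h1 : 2 ≤ k * f x := by
      have h3 : 2 / f x0 ≤ k := (le_max_left _ _).trans hk
      rw [div_le_iff₀ hpos] at h3
      exact h3.trans (mul_le_mul_of_nonneg_left (hmin hx) (Nat.cast_nonneg _))
    have h2 : b k x = 1 := by
      apply (b k).one_of_mem_closedBall
      simp only [b, Metric.mem_closedBall, dist_zero_right]
      linarith [hR x hx, (le_max_right (2 / f x0) R).trans hk]
    simp only [χ]
    rw [h2, mul_one]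
    exact Real.smoothTransition.one_of_one_le (by linarith)

theorem exists_bound_of_contDiff_one {V W : Type*} [NormedAddCommGroup V] [NormedSpace ℝ V]
    [NormedAddCommGroup W] [NormedSpace ℝ W] {f : V → W} (hf : ContDiff ℝ 1 f)
    (hc : HasCompactSupport f) :
    ∃ C : NNReal, 0 < C ∧ ∀ i : ℕ, i ≤ 1 → ∀ x, ‖iteratedFDeriv ℝ i f x‖ ≤ C := by
  have h : ∀ i : ℕ, i ≤ 1 → ∃ R, ∀ x, ‖iteratedFDeriv ℝ i f x‖ ≤ R := by
    intro i hi
    have : BddAbove (range fun x => ‖iteratedFDeriv ℝ i f x‖) := by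
      apply (hf.continuous_iteratedFDeriv
        (mod_cast hi)).norm.bddAbove_range_of_hasCompactSupport
      exact HasCompactSupport.comp_left (hc.iteratedFDeriv i) norm_zero
    obtain ⟨R, hR⟩ := this
    exact ⟨R, fun x => hR (mem_range_self _)⟩
  obtain ⟨R0, h0⟩ := h 0 zero_le_one
  obtain ⟨R1, h1⟩ := h 1 le_rfl
  refine ⟨Real.toNNReal (max (max R0 R1) 1), Real.toNNReal_pos.2 (by simp), fun i hi x =>
    le_trans ?_ (Real.le_coe_toNNReal _)⟩
  interval_cases i
  · exact (h0 x).trans ((le_max_left _ _).trans (le_max_left _ _))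
  · exact (h1 x).trans ((le_max_right _ _).trans (le_max_left _ _))

/-- A vector field that is `C^1` over an open set can be multiplied by a function of the base point,
positive on this set, so that its extension by zero is `C^1`, bounded and Lipschitz. -/
theorem exists_cutoff {V V' W : Type*} [NormedAddCommGroup V] [NormedSpace ℝ V]
    [FiniteDimensional ℝ V] [NormedAddCommGroup V'] [NormedSpace ℝ V']
    [NormedAddCommGroup W] [NormedSpace ℝ W] [CompleteSpace W] {Ω : Set V} (hΩ : IsOpen Ω)
    {H : V × V' → W} (hH : ContDiffOn ℝ 1 H (Ω ×ˢ univ)) {K' : Set V'} (hK' : IsCompact K')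
    (hHK : ∀ x, ∀ w ∉ K', H (x, w) = 0) :
    ∃ f : V → ℝ, Continuous f ∧ (∀ x ∈ Ω, 0 < f x) ∧ (∀ x ∉ Ω, f x = 0) ∧
      ContDiff ℝ 1 (fun p : V × V' => f p.1 • H p) ∧
      ∃ K L : NNReal, LipschitzWith K (fun p : V × V' => f p.1 • H p) ∧
        ∀ p : V × V', ‖f p.1 • H p‖ ≤ L := by
  obtain ⟨χ, hχ, hχc, hχs, hχ01, -, hχ1⟩ := exists_smooth_exhaustion hΩ
  let t : ℕ → V × V' → W := fun k p => χ k p.1 • H p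
  have ht : ∀ k, ContDiff ℝ 1 (t k) := by
    intro k
    rw [contDiff_iff_contDiffAt]
    intro p
    by_cases hp : p.1 ∈ tsupport (χ k)
    · have hmem : (Ω ×ˢ univ : Set (V × V')) ∈ 𝓝 p :=
        (hΩ.prod isOpen_univ).mem_nhds ⟨hχs k hp, trivial⟩
      exact (((hχ k).of_le (mod_cast le_top)).comp contDiff_fst).contDiffAt.smul
        (hH.contDiffAt hmem)
    · have h0 : ∀ᶠ q : V × V' in 𝓝 p, t k q = 0 := by
        have := (continuous_fst.tendsto p).eventually
          ((isClosed_tsupport (χ k)).isOpen_compl.mem_nhds hp)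
        filter_upwards [this] with q hq
        simp [t, image_eq_zero_of_notMem_tsupport hq]
      exact contDiffAt_const.congr_of_eventuallyEq h0
  have htc : ∀ k, HasCompactSupport (t k) := by
    intro k
    refine HasCompactSupport.intro ((hχc k).isCompact.prod hK') fun p hp => ?_
    by_cases h1 : p.1 ∈ tsupport (χ k)
    · have h2 : p.2 ∉ K' := fun h => hp ⟨h1, h⟩
      simp [t, hHK p.1 p.2 h2]
    · simp [t, image_eq_zero_of_notMem_tsupport h1]
  choose B hB0 hB using fun k => exists_bound_of_contDiff_one (ht k) (htc k)
  obtain ⟨δ, δpos, c, δc, -⟩ := NNReal.exists_pos_sum_of_countable one_ne_zero ℕ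
  have hδ : Summable fun k => (δ k : ℝ) := (NNReal.hasSum_coe.2 δc).summable
  -- With these weights the terms `r k • t k` and their first derivatives are bounded by the
  -- summable `δ k`. The sum `c` then serves both as Lipschitz constant and as bound.
  let r : ℕ → ℝ := fun k => δ k / (B k + 1)
  have hr0 : ∀ k, 0 < r k := fun k => div_pos (δpos k) (by positivity)
  have hrδ : ∀ k, r k ≤ δ k := fun k =>
    div_le_self (NNReal.coe_nonneg _) (by linarith [(B k).coe_nonneg])
  have hrB : ∀ k, r k * B k ≤ δ k := fun k => by
    simp only [r]
    rw [div_mul_eq_mul_div, div_le_iff₀ (by positivity)]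
    nlinarith [(δ k).coe_nonneg, (B k).coe_nonneg]
  let f : V → ℝ := fun x => ∑' k, r k * χ k x
  have hfb : ∀ k x, ‖r k * χ k x‖ ≤ δ k := by
    intro k x
    rw [Real.norm_of_nonneg (mul_nonneg (hr0 k).le (hχ01 k x).1)]
    exact (mul_le_of_le_one_right (hr0 k).le (hχ01 k x).2).trans (hrδ k)
  have hfsum : ∀ x, Summable fun k => r k * χ k x := fun x =>
    Summable.of_norm_bounded hδ fun k => hfb k x
  have hfH : (fun p : V × V' => f p.1 • H p) = fun p => ∑' k, r k • t k p := by
    ext p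
    simp only [f, t, smul_smul]
    rw [Summable.tsum_smul_const (hfsum p.1)]
  have hbd : ∀ (i k : ℕ) (p : V × V'), i ≤ 1 → ‖iteratedFDeriv ℝ i (fun p => r k • t k p) p‖ ≤ δ k := by
    intro i k p hi
    rw [show (fun p => r k • t k p) = r k • t k from rfl, iteratedFDeriv_const_smul_apply
      ((ht k).contDiffAt.of_le (mod_cast hi)), norm_smul, Real.norm_of_nonneg (hr0 k).le]
    exact (mul_le_mul_of_nonneg_left (hB k i hi p) (hr0 k).le).trans (hrB k)
  have hb0 : ∀ (k : ℕ) (p : V × V'), ‖r k • t k p‖ ≤ δ k := fun k p => by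
    simpa using hbd 0 k p zero_le_one
  have hsum0 : ∀ p, Summable fun k => r k • t k p := fun p =>
    Summable.of_norm_bounded hδ fun k => hb0 k p
  refine ⟨f, ?_, fun x hx => ?_, fun x hx => ?_, ?_, c, c, ?_, ?_⟩
  · exact continuous_tsum (fun k => continuous_const.mul (hχ k).continuous) hδ hfb
  · obtain ⟨k, hk⟩ := hχ1 {x} (by simpa using hx) isCompact_singleton
    refine (hfsum x).tsum_pos (fun k => mul_nonneg (hr0 k).le (hχ01 k x).1) k ?_
    rw [hk x rfl, mul_one]
    exact hr0 k
  · have : ∀ k, χ k x = 0 := fun k => image_eq_zero_of_notMem_tsupport fun h => hx (hχs k h)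
    simp [f, this]
  · rw [hfH]
    exact contDiff_tsum (N := 1) (v := fun _ k => (δ k : ℝ)) (fun k => (ht k).const_smul (r k))
      (fun _ _ => hδ) (fun i k p hi => hbd i k p (mod_cast hi))
  · rw [hfH]
    refine LipschitzWith.of_dist_le_mul fun p q => ?_
    have hl : ∀ k, ‖r k • t k p - r k • t k q‖ ≤ δ k * dist p q := by
      intro k
      rw [dist_eq_norm]
      refine convex_univ.norm_image_sub_le_of_norm_fderiv_le (f := fun p => r k • t k p) (𝕜 := ℝ)
        (fun z _ => (((ht k).const_smul (r k)).differentiable one_ne_zero) z) (fun z _ => ?_)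
        trivial trivial
      simpa [norm_iteratedFDeriv_one] using hbd 1 k z le_rfl
    rw [dist_eq_norm, ← (hsum0 p).tsum_sub (hsum0 q)]
    exact tsum_of_norm_bounded ((NNReal.hasSum_coe.2 δc).mul_right (dist p q)) hl
  · intro p
    rw [congrFun hfH p]
    exact tsum_of_norm_bounded (NNReal.hasSum_coe.2 δc) fun k => hb0 k p

end Cutoff

end EinsteinVlasov

/-! ### A complete, dilation-equivariant reparametrization of the geodesic flow. -/

namespace EinsteinVlasov

noncomputable section

section NullFlow

theorem _root_.HasDerivAt.prod_fst {E F : Type*} [NormedAddCommGroup E] [NormedSpace ℝ E]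
    [NormedAddCommGroup F] [NormedSpace ℝ F] {c : ℝ → E × F} {c' : E × F} {s : ℝ}
    (h : HasDerivAt c c' s) : HasDerivAt (fun t => (c t).1) c'.1 s :=
  (ContinuousLinearMap.fst ℝ E F).hasFDerivAt.comp_hasDerivAt s h

theorem _root_.HasDerivAt.prod_snd {E F : Type*} [NormedAddCommGroup E] [NormedSpace ℝ E]
    [NormedAddCommGroup F] [NormedSpace ℝ F] {c : ℝ → E × F} {c' : E × F} {s : ℝ}
    (h : HasDerivAt c c' s) : HasDerivAt (fun t => (c t).2) c'.2 s :=
  (ContinuousLinearMap.snd ℝ E F).hasFDerivAt.comp_hasDerivAt s h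

variable {n : ℕ} {M : TopologicalSpace.Opens (Coord n)} {g : MetricField n}

/-- `T^*M ∖ {0}` as a subset of the coordinate space. -/
def puncturedSet (M : TopologicalSpace.Opens (Coord n)) : Set (Coord n × Coord n) :=
  (M : Set (Coord n)) ×ˢ {ξ | ξ ≠ 0}

theorem isOpen_puncturedSet (M : TopologicalSpace.Opens (Coord n)) : IsOpen (puncturedSet M) :=
  M.isOpen.prod isOpen_ne

/-- `Ψ` is a complete flow on `T^*M ∖ {0}` that reparametrizes the geodesic flow and commutes with
dilations of the momentum. -/
structure IsReparametrizedFlow (M : TopologicalSpace.Opens (Coord n)) (g : MetricField n)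
    (f : Coord n → ℝ) (Ψ : ℝ → Coord n × Coord n → Coord n × Coord n) : Prop where
  continuous : Continuous f
  pos : ∀ x ∈ M, 0 < f x
  mem : ∀ s, ∀ p ∈ puncturedSet M, Ψ s p ∈ puncturedSet M
  zero : ∀ p ∈ puncturedSet M, Ψ 0 p = p
  add : ∀ s t, ∀ p ∈ puncturedSet M, Ψ (s + t) p = Ψ s (Ψ t p)
  hasDerivAt : ∀ s, ∀ p ∈ puncturedSet M, HasDerivAt (fun t => Ψ t p)
    ((f (Ψ s p).1 / ‖(Ψ s p).2‖) • hamField g (Ψ s p)) s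
  smul : ∀ s, ∀ p ∈ puncturedSet M, ∀ c : ℝ, 0 < c →
    Ψ s (p.1, c • p.2) = ((Ψ s p).1, c • (Ψ s p).2)
  contDiffOn : ∀ s, ContDiffOn ℝ 1 (Ψ s) (puncturedSet M)
  continuousOn : ContinuousOn (fun z : ℝ × (Coord n × Coord n) => Ψ z.1 z.2)
    (univ ×ˢ puncturedSet M)

/-- The geodesic vector field in the coordinates `(x, ω, r)`, `ξ = e^r ω`, `|ω| = 1`, divided
by `|ξ|`. -/
def sphericalField (g : MetricField n) (η : Coord n → ℝ) (p : Coord n × Coord n) :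
    Coord n × Coord n × ℝ :=
  η p.2 • (raiseIndex g p.1 p.2,
    geodesicForce g p.1 p.2 - inner ℝ (geodesicForce g p.1 p.2) p.2 • p.2,
    inner ℝ (geodesicForce g p.1 p.2) p.2)

/-- The map `(x, ω, r) ↦ (x, e^r ω)`. -/
def fromSpherical (q : Coord n × Coord n × ℝ) : Coord n × Coord n :=
  (q.1, Real.exp q.2.2 • q.2.1)

/-- The map `(x, ξ) ↦ (x, ξ / |ξ|, log |ξ|)`. -/
def toSpherical (p : Coord n × Coord n) : Coord n × Coord n × ℝ :=
  (p.1, ‖p.2‖⁻¹ • p.2, Real.log ‖p.2‖)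

theorem fromSpherical_toSpherical {p : Coord n × Coord n} (hp : p.2 ≠ 0) :
    fromSpherical (toSpherical p) = p := by
  have h : 0 < ‖p.2‖ := norm_pos_iff.2 hp
  ext1
  · rfl
  · simp only [fromSpherical, toSpherical, Real.exp_log h, smul_smul, mul_inv_cancel₀ h.ne',
      one_smul]

theorem toSpherical_fromSpherical {q : Coord n × Coord n × ℝ} (hq : ‖q.2.1‖ = 1) :
    toSpherical (fromSpherical q) = q := by
  have h : ‖Real.exp q.2.2 • q.2.1‖ = Real.exp q.2.2 := by
    rw [norm_smul, hq, mul_one, Real.norm_of_nonneg (Real.exp_pos _).le]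
  simp only [fromSpherical, toSpherical, h, smul_smul, inv_mul_cancel₀ (Real.exp_pos _).ne',
    one_smul, Real.log_exp]

theorem norm_toSpherical {p : Coord n × Coord n} (hp : p.2 ≠ 0) : ‖(toSpherical p).2.1‖ = 1 := by
  simp only [toSpherical, norm_smul, norm_inv, norm_norm]
  exact inv_mul_cancel₀ (norm_ne_zero_iff.2 hp)

theorem contDiffOn_toSpherical (M : TopologicalSpace.Opens (Coord n)) :
    ContDiffOn ℝ 1 (toSpherical (n := n)) (puncturedSet M) := by
  have h : ContDiffOn ℝ 1 (fun p : Coord n × Coord n => ‖p.2‖) (puncturedSet M) :=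
    contDiff_snd.contDiffOn.norm ℝ fun p hp => hp.2
  exact contDiff_fst.contDiffOn.prodMk (((h.inv fun p hp => norm_ne_zero_iff.2 hp.2).smul
    contDiff_snd.contDiffOn).prodMk (h.log fun p hp => norm_ne_zero_iff.2 hp.2))

theorem contDiff_fromSpherical : ContDiff ℝ 1 (fromSpherical (n := n)) := by
  unfold fromSpherical
  fun_prop

theorem contDiffOn_sphericalField (hg : IsLorentzianMetric 2 M g) {η : Coord n → ℝ}
    (hη : ContDiff ℝ 1 η) :
    ContDiffOn ℝ 1 (sphericalField g η) ((M : Set (Coord n)) ×ˢ univ) := by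
  have h := hg.contDiffOn_hamField
  have h1 : ContDiffOn ℝ 1 (fun p : Coord n × Coord n => raiseIndex g p.1 p.2)
    ((M : Set (Coord n)) ×ˢ univ) := contDiff_fst.comp_contDiffOn h
  have h2 : ContDiffOn ℝ 1 (fun p : Coord n × Coord n => geodesicForce g p.1 p.2)
    ((M : Set (Coord n)) ×ˢ univ) := contDiff_snd.comp_contDiffOn h
  have h0 : ContDiffOn ℝ 1 (fun p : Coord n × Coord n => p.2) ((M : Set (Coord n)) ×ˢ univ) :=
    contDiff_snd.contDiffOn
  have h3 : ContDiffOn ℝ 1 (fun p : Coord n × Coord n =>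
    (inner ℝ (geodesicForce g p.1 p.2) p.2 : ℝ)) ((M : Set (Coord n)) ×ˢ univ) :=
    contDiff_inner.comp_contDiffOn (h2.prodMk h0)
  have h4 : ContDiffOn ℝ 1 (fun p : Coord n × Coord n => η p.2) ((M : Set (Coord n)) ×ˢ univ) :=
    (hη.comp contDiff_snd).contDiffOn
  exact h4.smul (h1.prodMk ((h2.sub (h3.smul h0)).prodMk h3))

/-- Along the flow, `y = |ω|² - 1` solves the linear equation `y' = -2 w y` with bounded `w`, so it
stays zero if it starts at zero. -/
theorem norm_eq_one_of_flow {f : Coord n → ℝ} {η : Coord n → ℝ}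
    {Φ : ℝ → Coord n × Coord n × ℝ → Coord n × Coord n × ℝ} {L : NNReal}
    (hL : ∀ p : Coord n × Coord n, ‖f p.1 • sphericalField g η p‖ ≤ L)
    (hΦ : IsGlobalFlow (fun q => f q.1 • sphericalField g η (q.1, q.2.1)) Φ)
    {q : Coord n × Coord n × ℝ} (hq : ‖q.2.1‖ = 1) (s : ℝ) : ‖(Φ s q).2.1‖ = 1 := by
  let G := fun q : Coord n × Coord n × ℝ => f q.1 • sphericalField g η (q.1, q.2.1)
  let w : ℝ → ℝ := fun s => (G (Φ s q)).2.2
  have hw : ∀ s, ‖w s‖ ≤ L := fun s =>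
    (norm_snd_le (G (Φ s q)).2).trans ((norm_snd_le (G (Φ s q))).trans
      (hL ((Φ s q).1, (Φ s q).2.1)))
  let y : ℝ → ℝ := fun s => ‖(Φ s q).2.1‖ ^ 2 - 1
  have hy : ∀ s, HasDerivAt y (-2 * w s * y s) s := by
    intro s
    have h1 : HasDerivAt (fun s => (Φ s q).2.1) (G (Φ s q)).2.1 s :=
      (hΦ.hasDerivAt q s).prod_snd.prod_fst
    have h2 := h1.norm_sq.sub_const 1
    refine h2.congr_deriv ?_
    simp only [w, y, G, sphericalField, Prod.smul_snd, Prod.smul_fst, inner_smul_right,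
      inner_sub_right, real_inner_self_eq_norm_sq, smul_eq_mul]
    rw [real_inner_comm]
    ring
  have h0 := ODE_solution_unique_univ (v := fun s z => -2 * w s * z) (s := fun _ => univ)
    (K := 2 * L) (t₀ := 0) (f := y) (g := fun _ => 0)
    (fun t => (LipschitzWith.of_dist_le_mul fun a b => by
      rw [Real.dist_eq, Real.dist_eq, ← mul_sub, abs_mul, abs_mul]
      refine mul_le_mul_of_nonneg_right ?_ (abs_nonneg _)
      have := hw t
      rw [Real.norm_eq_abs] at this
      push_cast
      norm_num
      exact this).lipschitzOnWith)
    (fun t => ⟨hy t, trivial⟩) (fun t => ⟨by simpa using hasDerivAt_const t (0 : ℝ), trivial⟩)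
    (by simp [y, hΦ.zero, hq])
  have := congrFun h0 s
  simp only [y, sub_eq_zero] at this
  exact (pow_eq_one_iff_of_nonneg (norm_nonneg _) two_ne_zero).1 this

/-- The complete flow of a multiple of the geodesic vector field, in the coordinates
`(x, ω, r)`. -/
structure IsSphericalFlow (M : TopologicalSpace.Opens (Coord n)) (g : MetricField n)
    (f : Coord n → ℝ) (Φ : ℝ → Coord n × Coord n × ℝ → Coord n × Coord n × ℝ) : Prop where
  zero : ∀ q, Φ 0 q = q
  add : ∀ s t q, Φ (s + t) q = Φ s (Φ t q)
  mem : ∀ q : Coord n × Coord n × ℝ, q.1 ∈ M → ∀ s, (Φ s q).1 ∈ M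
  norm : ∀ q : Coord n × Coord n × ℝ, ‖q.2.1‖ = 1 → ∀ s, ‖(Φ s q).2.1‖ = 1
  shift : ∀ (q : Coord n × Coord n × ℝ) (c s : ℝ), Φ s (q + (0, 0, c)) = Φ s q + (0, 0, c)
  hasDerivAt : ∀ q : Coord n × Coord n × ℝ, ‖q.2.1‖ = 1 → ∀ s, HasDerivAt (fun t => Φ t q)
    (f (Φ s q).1 • sphericalField g (fun _ => 1) ((Φ s q).1, (Φ s q).2.1)) s
  contDiff : ∀ s, ContDiff ℝ 1 (Φ s)
  continuous_uncurry : Continuous fun z : ℝ × (Coord n × Coord n × ℝ) => Φ z.1 z.2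

/-- In the coordinates `(x, ω, r)` the field does not involve `r`, so only `x` and `ω` have to be
cut off. The cut-off `η` in `ω` is `1` on the unit sphere, which is invariant, and does not affect
the orbits there. -/
theorem exists_isSphericalFlow (hg : IsLorentzianMetric 2 M g) :
    ∃ f Φ, Continuous f ∧ (∀ x ∈ M, 0 < f x) ∧ IsSphericalFlow M g f Φ := by
  obtain ⟨η, hη, hη1, hη0⟩ : ∃ η : Coord n → ℝ, ContDiff ℝ 1 η ∧
      (∀ u : Coord n, ‖u‖ = 1 → η u = 1) ∧ ∀ u ∉ Metric.closedBall (0 : Coord n) 3, η u = 0 := by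
    let η : ContDiffBump (0 : Coord n) := ⟨2, 3, by norm_num, by norm_num⟩
    refine ⟨η, η.contDiff, fun u hu => η.one_of_mem_closedBall (by simp [η, hu]), fun u hu => ?_⟩
    exact η.zero_of_le_dist (by simp only [Metric.mem_closedBall, not_le] at hu; exact hu.le)
  obtain ⟨f, hf, hfM, hfM', hfH, K, L, hK, hL⟩ := exists_cutoff M.isOpen
    (contDiffOn_sphericalField hg hη) (isCompact_closedBall (0 : Coord n) 3)
    (fun x w hw => by simp only [sphericalField, hη0 w hw, zero_smul])
  obtain ⟨G, hG⟩ : ∃ G : Coord n × Coord n × ℝ → Coord n × Coord n × ℝ,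
    G = fun q => f q.1 • sphericalField g η (q.1, q.2.1) := ⟨_, rfl⟩
  have hP : ContDiff ℝ 1 (fun q : Coord n × Coord n × ℝ => (q.1, q.2.1)) := by fun_prop
  have hGc : ContDiff ℝ 1 G := by rw [hG]; exact hfH.comp hP
  have hGK : LipschitzWith K G := by
    rw [hG]
    refine LipschitzWith.of_dist_le_mul fun p q => (hK.dist_le_mul (p.1, p.2.1) (q.1, q.2.1)).trans ?_
    refine mul_le_mul_of_nonneg_left ?_ K.coe_nonneg
    rw [Prod.dist_eq, Prod.dist_eq, Prod.dist_eq]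
    exact max_le_max le_rfl (le_max_left _ _)
  have hGL : ∀ q, ‖G q‖ ≤ L := fun q => by rw [hG]; exact hL (q.1, q.2.1)
  obtain ⟨Φ, hΦ⟩ := exists_isGlobalFlow hGK hGL
  have hnorm : ∀ q : Coord n × Coord n × ℝ, ‖q.2.1‖ = 1 → ∀ s, ‖(Φ s q).2.1‖ = 1 :=
    fun q hq s => norm_eq_one_of_flow hL (by rwa [hG] at hΦ) hq s
  refine ⟨f, Φ, hf, hfM, hΦ.zero, hΦ.add hGK, ?_, hnorm, ?_, ?_, hΦ.contDiff hGK hGc,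
    hΦ.continuous_uncurry hGK⟩
  · intro q hq s
    -- Since `f = 0` off `M`, points over the complement are stationary. An orbit reaching one would
    -- have been there always.
    by_contra h
    have hG0 : G (Φ s q) = 0 := by simp only [hG, hfM' _ h, zero_smul]
    have := hΦ.eq_of_hasDerivAt hGK (γ := fun _ => Φ s q)
      (fun t => by rw [hG0]; exact hasDerivAt_const _ _) (-s)
    rw [← hΦ.add hGK, neg_add_cancel, hΦ.zero] at this
    rw [this] at h
    exact h hq
  · intro q c s
    have hGs : ∀ q, G (q + (0, 0, c)) = G q := fun q => by
      simp only [hG, Prod.fst_add, Prod.snd_add, add_zero]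
    have := hΦ.eq_of_hasDerivAt hGK (γ := fun t => Φ t q + (0, 0, c)) (fun t => by
      rw [hGs]; exact (hΦ.hasDerivAt q t).add_const (0, 0, c)) s
    rw [this, hΦ.zero]
  · intro q hq s
    refine (hΦ.hasDerivAt q s).congr_deriv ?_
    simp only [hG, sphericalField, hη1 _ (hnorm q hq s)]

/-- The flow is conjugated back by `ξ = e^r ω`. Dilations of `ξ` become translations of `r`, which
the spherical flow respects. -/
theorem exists_isReparametrizedFlow (hg : IsLorentzianMetric 2 M g) :
    ∃ f Ψ, IsReparametrizedFlow M g f Ψ := by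
  obtain ⟨f, Φ, hf, hfM, hΦ⟩ := exists_isSphericalFlow hg
  refine ⟨f, fun s p => fromSpherical (Φ s (toSpherical p)), hf, hfM, ?_, ?_, ?_, ?_, ?_, ?_, ?_⟩
  · intro s p hp
    refine ⟨hΦ.mem _ hp.1 s, smul_ne_zero (Real.exp_pos _).ne' fun h => ?_⟩
    have := hΦ.norm _ (norm_toSpherical hp.2) s
    rw [h, norm_zero] at this
    exact zero_ne_one this
  · intro p hp
    simp only [hΦ.zero]
    exact fromSpherical_toSpherical hp.2
  · intro s t p hp
    rw [hΦ.add, toSpherical_fromSpherical (hΦ.norm _ (norm_toSpherical hp.2) t)]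
  · intro s p hp
    set q := Φ s (toSpherical p) with hq
    have hq1 : ‖q.2.1‖ = 1 := hΦ.norm _ (norm_toSpherical hp.2) s
    obtain ⟨v, hv⟩ : ∃ v, v = f q.1 • sphericalField g (fun _ => 1) (q.1, q.2.1) := ⟨_, rfl⟩
    have hd : HasDerivAt (fun t => Φ t (toSpherical p)) v s := by
      rw [hv]; exact hΦ.hasDerivAt _ (norm_toSpherical hp.2) s
    have h1 : HasDerivAt (fun t => (Φ t (toSpherical p)).1) v.1 s :=
      hd.prod_fst
    have h0 : HasDerivAt (fun t => (Φ t (toSpherical p)).2) v.2 s :=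
      hd.prod_snd
    have h2 : HasDerivAt (fun t => (Φ t (toSpherical p)).2.1) v.2.1 s :=
      h0.prod_fst
    have h3 : HasDerivAt (fun t => (Φ t (toSpherical p)).2.2) v.2.2 s :=
      h0.prod_snd
    have h4 : HasDerivAt (fun t => fromSpherical (Φ t (toSpherical p))) _ s :=
      h1.prodMk (h3.exp.fun_smul h2)
    have hn : ‖(fromSpherical q).2‖ = Real.exp q.2.2 := by
      simp only [fromSpherical, norm_smul, hq1, mul_one, Real.norm_of_nonneg (Real.exp_pos _).le]
    refine h4.congr_deriv (Eq.symm ?_)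
    rw [hn]
    simp only [← hq, hv, sphericalField, one_smul, hamField, fromSpherical,
      raiseIndex_smul, geodesicForce_smul]
    have he := (Real.exp_pos q.2.2).ne'
    ext1
    · simp only [Prod.smul_fst, smul_smul]
      rw [div_mul_cancel₀ _ he]
    · simp only [Prod.smul_snd, Prod.smul_fst, smul_smul, smul_sub, smul_eq_mul]
      have e1 : f q.1 / Real.exp q.2.2 * Real.exp q.2.2 ^ 2 = Real.exp q.2.2 * f q.1 := by
        field_simp
      rw [e1]
      module
  · intro s p hp c hc
    have hnp : ‖p.2‖ ≠ 0 := norm_ne_zero_iff.2 hp.2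
    have : toSpherical (p.1, c • p.2) = toSpherical p + (0, 0, Real.log c) := by
      have hnc : ‖c • p.2‖ = c * ‖p.2‖ := by rw [norm_smul, Real.norm_of_nonneg hc.le]
      simp only [toSpherical, hnc, Prod.mk_add_mk, add_zero, smul_smul,
        Real.log_mul hc.ne' hnp]
      rw [add_comm (Real.log c)]
      congr 3
      field_simp
    simp only [this, hΦ.shift, fromSpherical, Prod.fst_add, Prod.snd_add, add_zero, Real.exp_add,
      Real.exp_log hc, smul_smul]
    rw [mul_comm]
  · intro s
    exact contDiff_fromSpherical.comp_contDiffOn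
      ((hΦ.contDiff s).comp_contDiffOn (contDiffOn_toSpherical M))
  · refine contDiff_fromSpherical.continuous.comp_continuousOn
      ((hΦ.continuous_uncurry).comp_continuousOn
        (f := fun z : ℝ × (Coord n × Coord n) => (z.1, toSpherical z.2)) ?_)
    exact continuousOn_fst.prodMk ((contDiffOn_toSpherical M).continuousOn.comp continuousOn_snd
      fun z hz => hz.2)

end NullFlow

end

end EinsteinVlasov

/-! ### Null geodesics, their crossing of a Cauchy hypersurface, and the conserved function. -/

namespace EinsteinVlasov

noncomputable section

section CauchyTime

variable {n : ℕ} {M : TopologicalSpace.Opens (Coord n)} {g : MetricField n} {f : Coord n → ℝ}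
  {Ψ : ℝ → Coord n × Coord n → Coord n × Coord n} {p : Coord n × Coord n} {S : Set (Coord n)}

/-- The zero mass shell in `T^*M ∖ {0}`. -/
def nullSet (M : TopologicalSpace.Opens (Coord n)) (g : MetricField n) :
    Set (Coord n × Coord n) :=
  {p | p ∈ puncturedSet M ∧ cometricForm g p.1 p.2 p.2 = 0}

theorem cometricForm_smul (g : MetricField n) (x ξ : Coord n) (c : ℝ) :
    cometricForm g x (c • ξ) (c • ξ) = c ^ 2 * cometricForm g x ξ ξ := by
  simp only [cometricForm, PiLp.smul_apply, smul_eq_mul, Finset.mul_sum]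
  exact Finset.sum_congr rfl fun _ _ => Finset.sum_congr rfl fun _ _ => by ring

theorem smul_mem_puncturedSet (hp : p ∈ puncturedSet M) {c : ℝ} (hc : 0 < c) :
    (p.1, c • p.2) ∈ puncturedSet M :=
  ⟨hp.1, smul_ne_zero hc.ne' hp.2⟩

theorem smul_mem_nullSet (hp : p ∈ nullSet M g) {c : ℝ} (hc : 0 < c) :
    (p.1, c • p.2) ∈ nullSet M g :=
  ⟨smul_mem_puncturedSet hp.1 hc, by rw [cometricForm_smul, hp.2, mul_zero]⟩

theorem puncturedSet_subset : puncturedSet M ⊆ (M : Set (Coord n)) ×ˢ univ :=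
  prod_mono subset_rfl (subset_univ _)

theorem isOpen_puncturedSet_diff_nullSet (hg : IsLorentzianMetric 2 M g) :
    IsOpen (puncturedSet M \ nullSet M g) := by
  have h := (hg.contDiffOn_cometricForm.continuousOn.mono puncturedSet_subset).isOpen_inter_preimage
    (isOpen_puncturedSet M) (isOpen_compl_singleton (x := (0 : ℝ)))
  have he : puncturedSet M \ nullSet M g =
      puncturedSet M ∩ (fun p => cometricForm g p.1 p.2 p.2) ⁻¹' {0}ᶜ :=
    Set.ext fun p => ⟨fun hp => ⟨hp.1, fun h0 => hp.2 ⟨hp.1, h0⟩⟩, fun hp => ⟨hp.1, fun h0 => hp.2 h0.2⟩⟩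
  rwa [he]

theorem measurableSet_nullSet (hg : IsLorentzianMetric 2 M g) :
    MeasurableSet (nullSet M g) := by
  have h : nullSet M g = puncturedSet M \ (puncturedSet M \ nullSet M g) := by
    rw [sdiff_sdiff_cancel_left fun p hp => hp.1]
  rw [h]
  exact (isOpen_puncturedSet M).measurableSet.diff (isOpen_puncturedSet_diff_nullSet hg).measurableSet

namespace IsReparametrizedFlow

theorem continuous_time (h : IsReparametrizedFlow M g f Ψ) (hp : p ∈ puncturedSet M) :
    Continuous fun s => Ψ s p :=
  continuous_iff_continuousAt.2 fun s => (h.hasDerivAt s p hp).continuousAt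

theorem mem_nullSet (h : IsReparametrizedFlow M g f Ψ) (hg : IsLorentzianMetric 2 M g)
    (hp : p ∈ nullSet M g) (s : ℝ) : Ψ s p ∈ nullSet M g := by
  refine ⟨h.mem s p hp.1, ?_⟩
  have hd : ∀ s, HasDerivAt (fun s => cometricForm g (Ψ s p).1 (Ψ s p).2 (Ψ s p).2) 0 s := by
    intro s
    have hm := h.mem s p hp.1
    have h1 := ((hg.contDiffOn_cometricForm.contDiffAt ((M.isOpen.prod isOpen_univ).mem_nhds
      (puncturedSet_subset hm))).differentiableAt one_ne_zero).hasFDerivAt.comp_hasDerivAt s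
      (h.hasDerivAt s p hp.1)
    refine h1.congr_deriv ?_
    have := hg.fderiv_cometricForm_hamField hm.1 (Ψ s p).2
    rw [map_smul]
    exact smul_eq_zero_of_right _ this
  have := is_const_of_deriv_eq_zero (fun s => (hd s).differentiableAt) (fun s => (hd s).deriv) s 0
  simp only [h.zero p hp.1] at this
  rw [this, hp.2]

theorem continuous_velocity (h : IsReparametrizedFlow M g f Ψ) (hg : IsLorentzianMetric 2 M g)
    (hp : p ∈ puncturedSet M) :
    Continuous fun s => (f (Ψ s p).1 / ‖(Ψ s p).2‖) • hamField g (Ψ s p) := by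
  have hc := h.continuous_time hp
  have h1 : Continuous fun s => f (Ψ s p).1 / ‖(Ψ s p).2‖ :=
    (h.continuous.comp (continuous_fst.comp hc)).div (continuous_snd.comp hc).norm
      fun s => norm_ne_zero_iff.2 (h.mem s p hp).2
  have h2 : Continuous fun s => hamField g (Ψ s p) :=
    hg.contDiffOn_hamField.continuousOn.comp_continuous hc
      fun s => puncturedSet_subset (h.mem s p hp)
  exact h1.smul h2

theorem velocity_ne_zero (h : IsReparametrizedFlow M g f Ψ) (hg : IsLorentzianMetric 2 M g)
    (hp : p ∈ puncturedSet M) (s : ℝ) :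
    ((f (Ψ s p).1 / ‖(Ψ s p).2‖) • hamField g (Ψ s p)).1 ≠ 0 := by
  have hm := h.mem s p hp
  exact smul_ne_zero (div_pos (h.pos _ hm.1) (norm_pos_iff.2 hm.2)).ne'
    (hg.raiseIndex_ne_zero hm.1 hm.2)

/-- Orbits of the flow do not converge in `M`. -/
theorem not_tendsto (h : IsReparametrizedFlow M g f Ψ) (hg : IsLorentzianMetric 2 M g)
    (hp : p ∈ puncturedSet M) {u : ℕ → ℝ} {y : Coord n} (hy : y ∈ M)
    (hu : ∀ t, Tendsto (fun k => (Ψ (t + u k) p).1) atTop (𝓝 y)) : False := by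
  have hm := fun k => h.mem (u k) p hp
  have hpos : ∀ k, 0 < ‖(Ψ (u k) p).2‖⁻¹ := fun k => inv_pos.2 (norm_pos_iff.2 (hm k).2)
  -- The momenta may be unbounded or tend to zero, but their directions accumulate at some unit `v`.
  obtain ⟨v, hv, φ, hmono, hφ⟩ := (isCompact_sphere (0 : Coord n) 1).tendsto_subseq
    (x := fun k => ‖(Ψ (u k) p).2‖⁻¹ • (Ψ (u k) p).2) (fun k => by
      rw [mem_sphere_zero_iff_norm, norm_smul, norm_inv, norm_norm]
      exact inv_mul_cancel₀ (norm_ne_zero_iff.2 (hm k).2))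
  have hv0 : v ≠ 0 := fun h0 => by simp [h0] at hv
  have hq : (y, v) ∈ puncturedSet M := ⟨hy, hv0⟩
  have hlim : Tendsto (fun k => ((Ψ (u (φ k)) p).1, ‖(Ψ (u (φ k)) p).2‖⁻¹ • (Ψ (u (φ k)) p).2))
      atTop (𝓝 (y, v)) := by
    have h0 : Tendsto (fun k => (Ψ (u k) p).1) atTop (𝓝 y) := by simpa using hu 0
    exact (h0.comp hmono.tendsto_atTop).prodMk_nhds hφ
  -- Since the flow commutes with dilations, the orbit of `(y, v)` is a limit of time-shifted orbits
  -- of `p` with rescaled momenta, all of whose base points tend to `y`. It thus has constant base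
  -- point, although its velocity is nonzero.
  have hconst : ∀ t, (Ψ t (y, v)).1 = y := by
    intro t
    have h1 : Tendsto (fun k => (Ψ t ((Ψ (u (φ k)) p).1,
        ‖(Ψ (u (φ k)) p).2‖⁻¹ • (Ψ (u (φ k)) p).2)).1) atTop (𝓝 (Ψ t (y, v)).1) :=
      (continuous_fst.tendsto _).comp ((((h.contDiffOn t).continuousOn.continuousAt
        ((isOpen_puncturedSet M).mem_nhds hq)).tendsto).comp hlim)
    have h2 : Tendsto (fun k => (Ψ (t + u (φ k)) p).1) atTop (𝓝 y) := by
        exact (hu t).comp hmono.tendsto_atTop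
    refine tendsto_nhds_unique h1 (h2.congr fun k => ?_)
    rw [h.smul t _ (hm _) _ (hpos _), ← h.add t _ p hp]
  have hd := (h.hasDerivAt 0 _ hq).prod_fst
  simp only [hconst] at hd
  have := hd.unique (hasDerivAt_const (0 : ℝ) y)
  have h3 := h.velocity_ne_zero hg hq 0
  rw [hconst] at h3
  exact h3 this

/-- Completeness of the flow supplies the parameter domain `ℝ`. The tangent is null because the mass
shell is invariant, and `not_tendsto` along the times `k` and `-k` excludes endpoints. -/
theorem isInextendibleCausalCurve (h : IsReparametrizedFlow M g f Ψ)
    (hg : IsLorentzianMetric 2 M g) (hp : p ∈ nullSet M g) :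
    IsInextendibleCausalCurve M g fun s => (Ψ s p).1 := by
  have hd := fun s => (h.hasDerivAt s p hp.1).prod_fst
  have hderiv : (deriv fun s => (Ψ s p).1) = fun s => _ := funext fun s => (hd s).deriv
  refine ⟨?_, fun s => (h.mem s p hp.1).1, fun s => ?_, fun s => ?_, ?_, ?_⟩
  · rw [contDiff_one_iff_deriv]
    refine ⟨fun s => (hd s).differentiableAt, ?_⟩
    rw [hderiv]
    exact continuous_fst.comp (h.continuous_velocity hg hp.1)
  · rw [(hd s).deriv]
    exact h.velocity_ne_zero hg hp.1 s
  · rw [(hd s).deriv]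
    have hs := h.mem_nullSet hg hp s
    simp only [Prod.smul_fst, hamField]
    rw [← raiseIndex_smul, hg.metricForm_raiseIndex_raiseIndex hs.1.1, cometricForm_smul, hs.2,
      mul_zero]
  · rintro ⟨y, hy, hlim⟩
    refine h.not_tendsto hg hp.1 (u := fun k => k) hy fun t => hlim.comp ?_
    exact tendsto_atTop_add_const_left _ t tendsto_natCast_atTop_atTop
  · rintro ⟨y, hy, hlim⟩
    refine h.not_tendsto hg hp.1 (u := fun k => -k) hy fun t => hlim.comp ?_
    exact tendsto_atBot_add_const_left _ t (tendsto_neg_atTop_atBot.comp tendsto_natCast_atTop_atTop)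

end IsReparametrizedFlow

theorem fderiv_eq_pairing_differential (u : Coord n → ℝ) (x v : Coord n) :
    fderiv ℝ u x v = pairing (differential u x) v := by
  conv_lhs => rw [eq_sum_basisVec v, map_sum]
  simp only [map_smul, smul_eq_mul, pairing, differential, partialDeriv]
  exact Finset.sum_congr rfl fun _ _ => mul_comm _ _

/-- A function with a nonzero derivative at a zero changes sign there. -/
theorem eventually_sign_of_hasDerivAt {φ : ℝ → ℝ} {c s : ℝ} (h : HasDerivAt φ c s) (hc : c ≠ 0)
    (hφ : φ s = 0) :
    (∀ᶠ t in 𝓝[<] s, c * φ t < 0) ∧ ∀ᶠ t in 𝓝[>] s, 0 < c * φ t := by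
  have h1 : HasDerivAt (fun t => c * φ t) (c * c) s := h.const_mul c
  have h2 := (hasDerivAt_iff_tendsto_slope.1 h1).eventually
    (lt_mem_nhds (mul_self_pos.2 hc))
  have key : ∀ t, slope (fun t => c * φ t) s t = (c * φ t) / (t - s) := fun t => by
    rw [slope_def_field, hφ, mul_zero, sub_zero]
  constructor
  · have h3 := h2.filter_mono (nhdsWithin_mono s (fun t (ht : t < s) => ht.ne))
    filter_upwards [h3, self_mem_nhdsWithin] with t ht hts
    rw [key] at ht
    have hts' : t - s < 0 := sub_neg.2 hts
    rcases div_pos_iff.1 ht with h4 | h4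
    · linarith [h4.2]
    · exact h4.1
  · have h3 := h2.filter_mono (nhdsWithin_mono s (fun t (ht : s < t) => ht.ne'))
    filter_upwards [h3, self_mem_nhdsWithin] with t ht hts
    rw [key] at ht
    have hts' : 0 < t - s := sub_pos.2 hts
    rcases div_pos_iff.1 ht with h4 | h4
    · exact h4.1
    · linarith [h4.2]

/-- Near the time at which a null geodesic crosses a Cauchy hypersurface, all nearby ones cross
it. -/
theorem IsReparametrizedFlow.eventually_exists_crossing (h : IsReparametrizedFlow M g f Ψ)
    (hg : IsLorentzianMetric 2 M g) (hS : IsCauchyHypersurface M g S) (hp : p ∈ nullSet M g)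
    {s : ℝ} (hs : (Ψ s p).1 ∈ S) {ε : ℝ} (hε : 0 < ε) :
    ∀ᶠ q in 𝓝 p, ∃ t, |t - s| < ε ∧ (Ψ t q).1 ∈ S := by
  obtain ⟨U, hU, hsU, hUM, u, hu, hSu, htime⟩ := hS.spacelike _ hs
  have hm := h.mem_nullSet hg hp s
  set c : ℝ := fderiv ℝ u (Ψ s p).1
    ((f (Ψ s p).1 / ‖(Ψ s p).2‖) • hamField g (Ψ s p)).1 with hcdef
  -- Transversality: `du` is timelike, and the velocity is a multiple of a raised nonzero null
  -- covector, so their pairing does not vanish.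
  have hc : c ≠ 0 := by
    rw [hcdef, Prod.smul_fst, map_smul, fderiv_eq_pairing_differential]
    simp only [hamField]
    rw [IsLorentzianMetric.pairing_raiseIndex]
    exact smul_ne_zero (div_pos (h.pos _ hm.1.1) (norm_pos_iff.2 hm.1.2)).ne'
      (hg.cometricForm_ne_zero_of_timelike_of_null hm.1.1 (htime _ hsU) hm.2 hm.1.2)
  have hφ : HasDerivAt (fun t => u (Ψ t p).1) c s :=
    ((hu.contDiffAt (hU.mem_nhds hsU)).differentiableAt one_ne_zero).hasFDerivAt.comp_hasDerivAt s
      (h.hasDerivAt s p hp.1).prod_fst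
  obtain ⟨hneg, hpos⟩ := eventually_sign_of_hasDerivAt hφ hc ((hSu _ hsU).1 hs)
  have hcont : Continuous fun t => (Ψ t p).1 := continuous_fst.comp (h.continuous_time hp.1)
  obtain ⟨δ, hδ, hδU⟩ := Metric.mem_nhds_iff.1 (hcont.continuousAt.preimage_mem_nhds
    (hU.mem_nhds hsU))
  have hmin : 0 < min δ ε := lt_min hδ hε
  obtain ⟨s1, ⟨h1n, h1l⟩⟩ := (hneg.and (Ioo_mem_nhdsLT (show s - min δ ε < s by linarith))).exists
  obtain ⟨s2, ⟨h2p, h2l⟩⟩ := (hpos.and (Ioo_mem_nhdsGT (show s < s + min δ ε by linarith))).exists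
  have hsub : ∀ t ∈ Icc s1 s2, |t - s| < min δ ε := fun t ht => by
    rw [abs_lt]; constructor <;> linarith [ht.1, ht.2, h1l.1, h2l.2]
  have hUp : ∀ t ∈ Icc s1 s2, (Ψ t p).1 ∈ U := fun t ht =>
    hδU (by rw [Metric.mem_ball, Real.dist_eq]; exact (hsub t ht).trans_le (min_le_left _ _))
  have hopen : IsOpen ((univ ×ˢ puncturedSet M) ∩
      (fun z : ℝ × (Coord n × Coord n) => (Ψ z.1 z.2).1) ⁻¹' U) :=
    (continuous_fst.comp_continuousOn h.continuousOn).isOpen_inter_preimage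
      (isOpen_univ.prod (isOpen_puncturedSet M)) hU
  -- The tube lemma keeps nearby orbits inside `U` throughout `[s1, s2]`. There `c * u` changes
  -- sign, so the intermediate value theorem gives a crossing.
  obtain ⟨A, B, -, hB, hA1, hB1, hAB⟩ := generalized_tube_lemma (isCompact_Icc (a := s1) (b := s2))
    (isCompact_singleton (x := p)) hopen (by
      rintro ⟨t, q⟩ ⟨ht, rfl⟩
      exact ⟨⟨trivial, hp.1⟩, hUp t ht⟩)
  have h12 : s1 ≤ s2 := (h1l.2.trans h2l.1).le
  have hcu : ∀ t ∈ Icc s1 s2, ContinuousAt (fun q => c * u (Ψ t q).1) p := by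
    intro t ht
    have e1 : ContinuousAt (fun q => (Ψ t q).1) p := continuous_fst.continuousAt.comp
      ((h.contDiffOn t).continuousOn.continuousAt ((isOpen_puncturedSet M).mem_nhds hp.1))
    exact continuousAt_const.mul (ContinuousAt.comp (g := u)
      (hu.continuousOn.continuousAt (hU.mem_nhds (hUp t ht))) e1)
  filter_upwards [hB.mem_nhds (hB1 rfl),
    (hcu s1 ⟨le_rfl, h12⟩).eventually_lt_const h1n,
    (hcu s2 ⟨h12, le_rfl⟩).eventually_const_lt h2p] with q hq hq1 hq2
  have hqU : ∀ t ∈ Icc s1 s2, q ∈ puncturedSet M ∧ (Ψ t q).1 ∈ U := fun t ht => by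
    have := hAB (mk_mem_prod (hA1 ht) hq)
    exact ⟨this.1.2, this.2⟩
  have hqΩ := (hqU s1 ⟨le_rfl, h12⟩).1
  have hcq : ContinuousOn (fun t => c * u (Ψ t q).1) (Icc s1 s2) :=
    continuousOn_const.mul (hu.continuousOn.comp
      (continuous_fst.comp (h.continuous_time hqΩ)).continuousOn fun t ht => (hqU t ht).2)
  obtain ⟨t, ht, ht0⟩ := intermediate_value_Icc h12 hcq ⟨hq1.le, hq2.le⟩
  refine ⟨t, (hsub t ht).trans_le (min_le_right _ _), (hSu _ (hqU t ht).2).2 ?_⟩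
  exact (mul_eq_zero.1 ht0).resolve_left hc

/-- On a globally hyperbolic spacetime there is a positive function on `T^*M ∖ {0}`, homogeneous of
degree `1`, which is constant along null geodesics. -/
theorem IsReparametrizedFlow.exists_conserved (h : IsReparametrizedFlow M g f Ψ)
    (hg : IsLorentzianMetric 2 M g) (hS : IsCauchyHypersurface M g S) :
    ∃ ρ : Coord n × Coord n → ℝ, Measurable ρ ∧ (∀ p ∈ puncturedSet M, 0 < ρ p) ∧
      (∀ p ∈ puncturedSet M, ∀ c : ℝ, 0 < c → ρ (p.1, c • p.2) = c * ρ p) ∧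
      ContinuousOn ρ (nullSet M g) ∧ ∀ p ∈ nullSet M g, ∀ s, ρ (Ψ s p) = ρ p := by
  classical
  have hex : ∀ p ∈ nullSet M g, ∃ s, (Ψ s p).1 ∈ S ∧ ∀ t, (Ψ t p).1 ∈ S → t = s := fun p hp =>
    hS.meets_once _ (h.isInextendibleCausalCurve hg hp)
  choose! τ hτ hτu using hex
  -- A nearby orbit crosses close to time `τ p`, and its crossing time is unique, hence equal to `τ
  -- q`.
  have hτc : ContinuousOn τ (nullSet M g) := by
    intro p hp
    refine Metric.tendsto_nhds.2 fun ε hε => ?_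
    filter_upwards [(h.eventually_exists_crossing hg hS hp (hτ p hp) hε).filter_mono
      nhdsWithin_le_nhds, self_mem_nhdsWithin] with q hq hqN
    obtain ⟨t, ht, htS⟩ := hq
    rwa [Real.dist_eq, ← hτu q hqN t htS]
  -- Off the null cone any positive, measurable function of degree `1` would do.
  let ρ : Coord n × Coord n → ℝ := (nullSet M g).piecewise (fun p => ‖(Ψ (τ p) p).2‖) fun p => ‖p.2‖
  have hρN : ∀ p ∈ nullSet M g, ρ p = ‖(Ψ (τ p) p).2‖ := fun p hp => piecewise_eq_of_mem _ _ _ hp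
  have hρN' : ∀ p ∉ nullSet M g, ρ p = ‖p.2‖ := fun p hp => piecewise_eq_of_notMem _ _ _ hp
  have hc : ContinuousOn (fun p => ‖(Ψ (τ p) p).2‖) (nullSet M g) :=
    (continuous_snd.comp_continuousOn (h.continuousOn.comp (hτc.prodMk continuousOn_id)
      fun p hp => ⟨trivial, hp.1⟩)).norm
  refine ⟨ρ, ?_, fun p hp => ?_, fun p hp c hc => ?_, hc.congr hρN, fun p hp s => ?_⟩
  · exact hc.measurable_piecewise continuous_snd.norm.continuousOn (measurableSet_nullSet hg)
  · by_cases hpN : p ∈ nullSet M g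
    · rw [hρN p hpN]
      exact norm_pos_iff.2 (h.mem _ p hp).2
    · rw [hρN' p hpN]
      exact norm_pos_iff.2 hp.2
  · by_cases hpN : p ∈ nullSet M g
    · have hcN := smul_mem_nullSet hpN hc
      have hτ' : τ (p.1, c • p.2) = τ p := by
        refine (hτu _ hcN _ ?_).symm
        rw [h.smul _ _ hp _ hc]
        exact hτ p hpN
      rw [hρN p hpN, hρN _ hcN, hτ', h.smul _ _ hp _ hc, norm_smul, Real.norm_of_nonneg hc.le]
    · have hcN : (p.1, c • p.2) ∉ nullSet M g := fun hcN => hpN (by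
        have := smul_mem_nullSet hcN (inv_pos.2 hc)
        simpa [smul_smul, inv_mul_cancel₀ hc.ne'] using this)
      rw [hρN' p hpN, hρN' _ hcN, norm_smul, Real.norm_of_nonneg hc.le]
  · have hsN := h.mem_nullSet hg hp s
    have hτ' : τ (Ψ s p) = τ p - s := by
      refine (hτu _ hsN _ ?_).symm
      rw [← h.add _ _ _ hp.1, sub_add_cancel]
      exact hτ p hp
    rw [hρN p hp, hρN _ hsN, hτ', ← h.add _ _ _ hp.1, sub_add_cancel]

end CauchyTime

end

end EinsteinVlasov

/-! ### Measures on open sets are determined by smooth test functions. -/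

namespace EinsteinVlasov

noncomputable section

section MeasureExt

/-- Measures on an open set that are finite on compact sets are determined by the integrals of
smooth compactly supported functions. -/
theorem measure_eq_of_lintegral_smooth_eq {V : Type*} [NormedAddCommGroup V] [NormedSpace ℝ V]
    [FiniteDimensional ℝ V] [MeasurableSpace V] [BorelSpace V] {Ω : Set V} (hΩ : IsOpen Ω)
    {σ₁ σ₂ : Measure V} (h₁ : σ₁ Ωᶜ = 0) (h₂ : σ₂ Ωᶜ = 0)
    (h : ∀ c : V → ℝ, ContDiff ℝ ∞ c → HasCompactSupport c → tsupport c ⊆ Ω → (∀ x, 0 ≤ c x) →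
      ∫⁻ x, ENNReal.ofReal (c x) ∂σ₁ = ∫⁻ x, ENNReal.ofReal (c x) ∂σ₂ ∧
        ∫⁻ x, ENNReal.ofReal (c x) ∂σ₂ < ⊤) : σ₁ = σ₂ := by
  -- The indicator of an open set is an increasing limit of smooth cut-offs.
  have hopen : ∀ U ⊆ Ω, IsOpen U → σ₁ U = σ₂ U := by
    intro U hUΩ hU
    obtain ⟨χ, hχ, hχc, hχs, hχ01, hχm, hχ1⟩ := exists_smooth_exhaustion hU
    have key : ∀ σ : Measure V, σ U = ⨆ k, ∫⁻ x, ENNReal.ofReal (χ k x) ∂σ := by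
      intro σ
      rw [← lintegral_iSup (fun k => (hχ k).continuous.measurable.ennreal_ofReal)
        (fun i j hij x => ENNReal.ofReal_le_ofReal (hχm x hij)),
        ← lintegral_indicator_one hU.measurableSet]
      congr 1
      ext x
      by_cases hx : x ∈ U
      · obtain ⟨k, hk⟩ := hχ1 {x} (by simpa using hx) isCompact_singleton
        rw [indicator_of_mem hx]
        refine le_antisymm ?_ (iSup_le fun j => ?_)
        · refine le_iSup_of_le k ?_
          rw [hk x rfl]
          simp
        · rw [Pi.one_apply, ← ENNReal.ofReal_one]
          exact ENNReal.ofReal_le_ofReal (hχ01 j x).2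
      · rw [indicator_of_notMem hx]
        have : ∀ k, χ k x = 0 := fun k =>
          image_eq_zero_of_notMem_tsupport fun hx' => hx (hχs k hx')
        simp [this]
    rw [key, key]
    exact iSup_congr fun k => (h _ (hχ k) (hχc k) ((hχs k).trans hUΩ) fun x => (hχ01 k x).1).1
  obtain ⟨χ, hχ, hχc, hχs, hχ01, hχm, hχ1⟩ := exists_smooth_exhaustion hΩ
  -- These open sets exhaust `Ω` and have finite measure by Markov's inequality, so equality on the
  -- π-system of open sets gives equality on each of them.
  let B : ℕ → Set V := fun k => {x | 1 / 2 < χ k x}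
  have hB : ∀ k, IsOpen (B k) := fun k => isOpen_lt continuous_const (hχ k).continuous
  have hBΩ : ∀ k, B k ⊆ Ω := fun k x hx =>
    hχs k (subset_tsupport _ (ne_of_gt (lt_trans (by norm_num) hx)))
  have hBU : ⋃ k, B k = Ω := by
    refine Subset.antisymm (iUnion_subset hBΩ) fun x hx => ?_
    obtain ⟨k, hk⟩ := hχ1 {x} (by simpa using hx) isCompact_singleton
    refine mem_iUnion.2 ⟨k, ?_⟩
    simp only [B, mem_ofPred_eq, hk x rfl]
    norm_num
  have hfin : ∀ k, σ₂ (B k) < ⊤ := by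
    intro k
    have h3 := (h _ (hχ k) (hχc k) (hχs k) fun x => (hχ01 k x).1).2
    have h4 := mul_meas_ge_le_lintegral (μ := σ₂)
      ((hχ k).continuous.measurable.ennreal_ofReal) (ENNReal.ofReal (1 / 2))
    have h5 : ENNReal.ofReal (1 / 2) * σ₂ (B k) < ⊤ := by
      refine lt_of_le_of_lt (le_trans ?_ h4) h3
      gcongr
      intro x hx
      exact ENNReal.ofReal_le_ofReal (le_of_lt hx)
    by_contra h6
    rw [not_lt, top_le_iff] at h6
    rw [h6, ENNReal.mul_top (by simp)] at h5
    exact lt_irrefl _ h5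
  have hr : σ₁.restrict Ω = σ₂.restrict Ω := by
    rw [← hBU, Measure.restrict_iUnion_congr]
    intro k
    have : IsFiniteMeasure (σ₁.restrict (B k)) :=
      ⟨by rw [Measure.restrict_apply_univ, hopen _ (hBΩ k) (hB k)]; exact hfin k⟩
    refine ext_of_generate_finite {s | IsOpen s} BorelSpace.measurable_eq isPiSystem_isOpen
      (fun U hU => ?_) ?_
    · rw [Measure.restrict_apply hU.measurableSet, Measure.restrict_apply hU.measurableSet]
      exact hopen _ (inter_subset_right.trans (hBΩ k)) (IsOpen.inter hU (hB k))
    · rw [Measure.restrict_apply_univ, Measure.restrict_apply_univ]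
      exact hopen _ (hBΩ k) (hB k)
  rwa [Measure.restrict_eq_self_of_ae_mem (by rwa [ae_iff]),
    Measure.restrict_eq_self_of_ae_mem (by rwa [ae_iff])] at hr

end MeasureExt

end

end EinsteinVlasov

/-! ### Invariance of averaged solutions under the flow, for homogeneous test functions. -/

namespace EinsteinVlasov

noncomputable section

section Invariance

variable {n : ℕ} {M : TopologicalSpace.Opens (Coord n)} {g : MetricField n} {f : Coord n → ℝ}
  {Ψ : ℝ → Coord n × Coord n → Coord n × Coord n} {p : Coord n × Coord n}
  {a : Coord n × Coord n → ℝ}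

theorem continuousOn_flowDeriv (hg : IsLorentzianMetric 2 M g)
    (ha : ContDiffOn ℝ 1 a (puncturedSet M)) :
    ContinuousOn (fun p : Coord n × Coord n => flowDeriv g a p.1 p.2) (puncturedSet M) := by
  simp only [flowDeriv_eq_fderiv]
  exact (ha.continuousOn_fderiv_of_isOpen (isOpen_puncturedSet M) le_rfl).clm_apply
    (hg.contDiffOn_hamField.continuousOn.mono puncturedSet_subset)

/-- The derivative of `a` along the orbit of `p` at time `s`. -/
def orbitDeriv (g : MetricField n) (f : Coord n → ℝ)
    (Ψ : ℝ → Coord n × Coord n → Coord n × Coord n) (a : Coord n × Coord n → ℝ) (s : ℝ)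
    (p : Coord n × Coord n) : ℝ :=
  f (Ψ s p).1 / ‖(Ψ s p).2‖ * flowDeriv g a (Ψ s p).1 (Ψ s p).2

namespace IsReparametrizedFlow

theorem hasDerivAt_comp (h : IsReparametrizedFlow M g f Ψ)
    (ha : ContDiffOn ℝ 1 a (puncturedSet M)) (hp : p ∈ puncturedSet M) (s : ℝ) :
    HasDerivAt (fun t => a (Ψ t p)) (orbitDeriv g f Ψ a s p) s := by
  have hm := h.mem s p hp
  have h1 := ((ha.contDiffAt ((isOpen_puncturedSet M).mem_nhds hm)).differentiableAt
    one_ne_zero).hasFDerivAt.comp_hasDerivAt s (h.hasDerivAt s p hp)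
  refine h1.congr_deriv ?_
  rw [map_smul, orbitDeriv, flowDeriv_eq_fderiv, smul_eq_mul]

/-- The flow commutes with its generator: `a (Ψ (s + t) p) = a (Ψ s (Ψ t p))` is differentiated at
`t = 0` in two ways. -/
theorem orbitDeriv_eq (h : IsReparametrizedFlow M g f Ψ)
    (ha : ContDiffOn ℝ 1 a (puncturedSet M)) (hp : p ∈ puncturedSet M) (s : ℝ) :
    orbitDeriv g f Ψ a s p = f p.1 / ‖p.2‖ * flowDeriv g (fun q => a (Ψ s q)) p.1 p.2 := by
  have ha' : ContDiffOn ℝ 1 (fun q => a (Ψ s q)) (puncturedSet M) :=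
    ha.comp (h.contDiffOn s) (h.mem s)
  have h1 := h.hasDerivAt_comp ha' hp 0
  have h2 := (h.hasDerivAt_comp ha hp s)
  have h3 : HasDerivAt (fun t => a (Ψ (s + t) p)) (orbitDeriv g f Ψ a s p) 0 := by
    have := HasDerivAt.comp_const_add (f := fun t => a (Ψ t p)) s 0 (by simpa using h2)
    exact this
  have h4 : (fun t => a (Ψ (s + t) p)) = fun t => a (Ψ s (Ψ t p)) :=
    funext fun t => by rw [h.add s t p hp]
  rw [h4] at h3
  rw [h3.unique h1, orbitDeriv, h.zero p hp]

theorem continuousOn_orbitDeriv (h : IsReparametrizedFlow M g f Ψ)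
    (hg : IsLorentzianMetric 2 M g) (ha : ContDiffOn ℝ 1 a (puncturedSet M)) :
    ContinuousOn (fun z : ℝ × (Coord n × Coord n) => orbitDeriv g f Ψ a z.1 z.2)
      (univ ×ˢ puncturedSet M) := by
  have hmaps : MapsTo (fun z : ℝ × (Coord n × Coord n) => Ψ z.1 z.2) (univ ×ˢ puncturedSet M)
    (puncturedSet M) := fun z hz => h.mem z.1 z.2 hz.2
  have h1 : ContinuousOn (fun p : Coord n × Coord n => f p.1 / ‖p.2‖ * flowDeriv g a p.1 p.2)
      (puncturedSet M) :=
    ((h.continuous.comp continuous_fst).continuousOn.div continuous_snd.norm.continuousOn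
      fun p hp => norm_ne_zero_iff.2 hp.2).mul (continuousOn_flowDeriv hg ha)
  exact h1.comp h.continuousOn hmaps

/-- Differentiation under the integral sign along the flow. -/
theorem hasDerivAt_integral_flow (h : IsReparametrizedFlow M g f Ψ)
    (hg : IsLorentzianMetric 2 M g) (ha : ContDiffOn ℝ 1 a (puncturedSet M))
    {Θ : Type*} [MeasurableSpace Θ] {m : Measure Θ} [IsFiniteMeasure m]
    {Q : Θ → Coord n × Coord n} (hQ : AEMeasurable Q m) (hQm : ∀ᵐ θ ∂m, Q θ ∈ puncturedSet M)
    {w : Θ → ℝ} (hw : AEStronglyMeasurable w m) {L : Set (Coord n × Coord n)} (hL : IsCompact L)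
    (hLM : L ⊆ puncturedSet M) {C : ℝ} (hwC : ∀ᵐ θ ∂m, Q θ ∈ L → |w θ| ≤ C) (s₀ : ℝ)
    (hsupp : ∀ᵐ θ ∂m, Q θ ∉ L → ∀ s ∈ Metric.ball s₀ 1, a (Ψ s (Q θ)) = 0) :
    HasDerivAt (fun s => ∫ θ, a (Ψ s (Q θ)) * w θ ∂m)
      (∫ θ, orbitDeriv g f Ψ a s₀ (Q θ) * w θ ∂m) s₀ := by
  have hmeas : ∀ φ : Coord n × Coord n → ℝ, ContinuousOn φ (puncturedSet M) →
      AEStronglyMeasurable (fun θ => φ (Q θ)) m := by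
    intro φ hφ
    classical
    have h1 : Measurable ((puncturedSet M).piecewise φ fun _ => 0) :=
      hφ.measurable_piecewise continuousOn_const (isOpen_puncturedSet M).measurableSet
    refine (h1.comp_aemeasurable hQ).aestronglyMeasurable.congr ?_
    filter_upwards [hQm] with θ hθ
    exact piecewise_eq_of_mem _ _ _ hθ
  have haΨ : ∀ s, ContinuousOn (fun q => a (Ψ s q)) (puncturedSet M) := fun s =>
    ha.continuousOn.comp (h.contDiffOn s).continuousOn (h.mem s)
  obtain ⟨C₀, hC₀⟩ := hL.exists_bound_of_continuousOn ((haΨ s₀).mono hLM)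
  obtain ⟨C₁, hC₁⟩ := ((isCompact_closedBall s₀ (1 : ℝ)).prod hL).exists_bound_of_continuousOn
    ((h.continuousOn_orbitDeriv hg ha).mono (prod_mono (subset_univ _) hLM))
  have hzero : ∀ᵐ θ ∂m, Q θ ∉ L → ∀ s ∈ Metric.ball s₀ 1, orbitDeriv g f Ψ a s (Q θ) = 0 := by
    filter_upwards [hsupp, hQm] with θ hθ hθm hL s hs
    have h1 : (fun t => a (Ψ t (Q θ))) =ᶠ[𝓝 s] fun _ => 0 := by
      filter_upwards [Metric.isOpen_ball.mem_nhds hs] with t ht using hθ hL t ht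
    exact (h.hasDerivAt_comp ha hθm s).unique
      ((hasDerivAt_const s (0 : ℝ)).congr_of_eventuallyEq h1)
  have hs₀ : s₀ ∈ Metric.ball s₀ 1 := Metric.mem_ball_self one_pos
  refine (hasDerivAt_integral_of_dominated_loc_of_deriv_le (Metric.ball_mem_nhds s₀ one_pos)
    (F' := fun s θ => orbitDeriv g f Ψ a s (Q θ) * w θ) (bound := fun _ => |C₁| * |C|)
    (Eventually.of_forall fun s => (hmeas _ (haΨ s)).mul hw) ?_
    ((hmeas _ ?_).mul hw) ?_ (integrable_const _) ?_).2
  · refine Integrable.of_bound ((hmeas _ (haΨ s₀)).mul hw) (|C₀| * |C|) ?_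
    filter_upwards [hsupp, hwC] with θ hθ hθC
    rw [Pi.mul_apply, norm_mul]
    by_cases hθL : Q θ ∈ L
    · exact mul_le_mul ((hC₀ _ hθL).trans (le_abs_self _)) ((hθC hθL).trans (le_abs_self _))
        (norm_nonneg _) (abs_nonneg _)
    · rw [hθ hθL s₀ hs₀, norm_zero, zero_mul]
      positivity
  · exact (h.continuousOn_orbitDeriv hg ha).comp (f := fun q => (s₀, q))
      (by fun_prop) fun q hq => ⟨trivial, hq⟩
  · filter_upwards [hzero, hwC] with θ hθ hθC s hs
    rw [norm_mul]
    by_cases hθL : Q θ ∈ L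
    · exact mul_le_mul ((hC₁ (s, Q θ) ⟨Metric.ball_subset_closedBall hs, hθL⟩).trans
        (le_abs_self _)) ((hθC hθL).trans (le_abs_self _)) (norm_nonneg _) (abs_nonneg _)
    · rw [hθ hθL s hs, norm_zero, zero_mul]
      positivity
  · filter_upwards [hQm] with θ hθ s _
    exact (h.hasDerivAt_comp ha hθ s).mul_const (w θ)

/-- The image of a compact set under the flow for times in a ball. -/
theorem isCompact_image_flow (h : IsReparametrizedFlow M g f Ψ) {L : Set (Coord n × Coord n)}
    (hL : IsCompact L) (hLM : L ⊆ puncturedSet M) (s₀ : ℝ) :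
    IsCompact ((fun z : ℝ × (Coord n × Coord n) => Ψ (-z.1) z.2) '' (Metric.closedBall s₀ 1 ×ˢ L)) ∧
      (fun z : ℝ × (Coord n × Coord n) => Ψ (-z.1) z.2) '' (Metric.closedBall s₀ 1 ×ˢ L)
        ⊆ puncturedSet M := by
  constructor
  · refine ((isCompact_closedBall s₀ (1 : ℝ)).prod hL).image_of_continuousOn ?_
    exact h.continuousOn.comp (f := fun z : ℝ × (Coord n × Coord n) => (-z.1, z.2))
      (by fun_prop) fun z hz => ⟨trivial, hLM hz.2⟩
  · rintro _ ⟨z, hz, rfl⟩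
    exact h.mem _ _ (hLM hz.2)

theorem neg_flow_flow (h : IsReparametrizedFlow M g f Ψ) (hp : p ∈ puncturedSet M) (s : ℝ) :
    Ψ (-s) (Ψ s p) = p := by
  rw [← h.add _ _ p hp, neg_add_cancel, h.zero p hp]

end IsReparametrizedFlow

/-- The representative `(x, ξ / |ξ|)` of the ray through `(x, ξ)`. -/
def normalizeMomentum (p : Coord n × Coord n) : Coord n × Coord n :=
  (p.1, ‖p.2‖⁻¹ • p.2)

theorem norm_normalizeMomentum (hp : p.2 ≠ 0) : ‖(normalizeMomentum p).2‖ = 1 := by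
  simp only [normalizeMomentum, norm_smul, norm_inv, norm_norm]
  exact inv_mul_cancel₀ (norm_ne_zero_iff.2 hp)

theorem normalizeMomentum_mem (hp : p ∈ puncturedSet M) :
    normalizeMomentum p ∈ puncturedSet M :=
  smul_mem_puncturedSet hp (inv_pos.2 (norm_pos_iff.2 hp.2))

theorem normalizeMomentum_smul {c : ℝ} (hc : 0 < c) :
    normalizeMomentum (p.1, c • p.2) = normalizeMomentum p := by
  simp only [normalizeMomentum, norm_smul, Real.norm_of_nonneg hc.le, smul_smul, mul_inv]
  rw [mul_right_comm, inv_mul_cancel₀ hc.ne', one_mul]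

theorem normalizeMomentum_of_norm (hp : ‖p.2‖ = 1) : normalizeMomentum p = p := by
  simp [normalizeMomentum, hp]

theorem contDiffOn_normalizeMomentum :
    ContDiffOn ℝ 1 (normalizeMomentum (n := n)) (puncturedSet M) := by
  have h : ContDiffOn ℝ 1 (fun p : Coord n × Coord n => ‖p.2‖) (puncturedSet M) :=
    contDiff_snd.contDiffOn.norm ℝ fun p hp => hp.2
  exact contDiff_fst.contDiffOn.prodMk ((h.inv fun p hp => norm_ne_zero_iff.2 hp.2).smul
    contDiff_snd.contDiffOn)

theorem measurable_normalizeMomentum : Measurable (normalizeMomentum (n := n)) := by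
  unfold normalizeMomentum
  fun_prop

/-- This extends the values of `c` on unit covectors by homogeneity, so that homogeneous test
functions suffice to determine a measure on the unit cosphere bundle. -/
theorem isHomogeneousTestFunction_of_hasCompactSupport {c : Coord n × Coord n → ℝ}
    (hc : ContDiff ℝ 1 c) (hcs : HasCompactSupport c) (hcM : tsupport c ⊆ puncturedSet M) :
    IsHomogeneousTestFunction M fun p => ‖p.2‖ * c (normalizeMomentum p) := by
  refine ⟨?_, fun x hx ξ hξ r hr => ?_, Prod.fst '' tsupport c, hcs.isCompact.image continuous_fst,
    ?_, fun x hx hxK ξ hξ => ?_⟩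
  · exact (contDiff_snd.contDiffOn.norm ℝ fun p hp => hp.2).mul
      (hc.comp_contDiffOn (contDiffOn_normalizeMomentum (M := M)))
  · rw [normalizeMomentum_smul (p := (x, ξ)) hr, norm_smul, Real.norm_of_nonneg hr.le, mul_assoc]
  · rintro _ ⟨p, hp, rfl⟩
    exact (hcM hp).1
  · rw [image_eq_zero_of_notMem_tsupport (fun h => hxK ⟨_, h, rfl⟩), mul_zero]

/-- A homogeneous test function depends on finitely much of the flow: its pullbacks vanish outside
of a compact subset of the unit cosphere bundle. -/
theorem IsReparametrizedFlow.exists_compact_support (h : IsReparametrizedFlow M g f Ψ)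
    (ha : IsHomogeneousTestFunction M a) (s₀ : ℝ) :
    ∃ L : Set (Coord n × Coord n), IsCompact L ∧ L ⊆ puncturedSet M ∧
      ∀ p ∈ puncturedSet M, ‖p.2‖ = 1 → p ∉ L → ∀ s ∈ Metric.ball s₀ 1, a (Ψ s p) = 0 := by
  obtain ⟨K, hK, hKM, hKa⟩ := ha.compact
  have hKS : IsCompact (K ×ˢ Metric.sphere (0 : Coord n) 1) := hK.prod (isCompact_sphere _ _)
  have hKSM : K ×ˢ Metric.sphere (0 : Coord n) 1 ⊆ puncturedSet M := by
    rintro p ⟨hp1, hp2⟩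
    refine ⟨hKM hp1, fun h0 => ?_⟩
    rw [mem_sphere_zero_iff_norm, h0, norm_zero] at hp2
    exact zero_ne_one hp2
  -- The set is swept out backwards by the flow from the unit covectors over `K`, then normalized.
  -- Normalization commutes with the flow up to dilation.
  obtain ⟨hL, hLM⟩ := h.isCompact_image_flow hKS hKSM s₀
  refine ⟨_, hL.image_of_continuousOn
    (contDiffOn_normalizeMomentum.continuousOn.mono hLM), ?_, fun p hp hp1 hpL s hs => ?_⟩
  · rintro _ ⟨p, hp, rfl⟩
    exact normalizeMomentum_mem (hLM hp)
  · have hm := h.mem s p hp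
    refine hKa _ hm.1 (fun hx => hpL ?_) _ hm.2
    refine ⟨_, ⟨(s, normalizeMomentum (Ψ s p)), ⟨Metric.ball_subset_closedBall hs, hx, ?_⟩, rfl⟩, ?_⟩
    · rw [mem_sphere_zero_iff_norm]
      exact norm_normalizeMomentum hm.2
    · have hc : 0 < ‖(Ψ s p).2‖⁻¹ := inv_pos.2 (norm_pos_iff.2 hm.2)
      simp only [normalizeMomentum, h.smul (-s) _ hm _ hc, h.neg_flow_flow hp]
      exact (normalizeMomentum_smul hc).trans (normalizeMomentum_of_norm hp1)

theorem IsReparametrizedFlow.isHomogeneousTestFunction_comp (h : IsReparametrizedFlow M g f Ψ)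
    (ha : IsHomogeneousTestFunction M a) (s : ℝ) :
    IsHomogeneousTestFunction M fun p => a (Ψ s p) := by
  obtain ⟨L, hL, hLM, hLa⟩ := h.exists_compact_support ha s
  have hs : s ∈ Metric.ball s 1 := Metric.mem_ball_self one_pos
  have hhom : ∀ x ∈ M, ∀ ξ : Coord n, ξ ≠ 0 → ∀ c : ℝ, 0 < c →
      a (Ψ s (x, c • ξ)) = c * a (Ψ s (x, ξ)) := by
    intro x hx ξ hξ c hc
    rw [h.smul s (x, ξ) ⟨hx, hξ⟩ c hc]
    have hm := h.mem s (x, ξ) ⟨hx, hξ⟩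
    exact ha.homogeneous _ hm.1 _ hm.2 c hc
  refine ⟨ha.contDiffOn.comp (h.contDiffOn s) (h.mem s), hhom, Prod.fst '' L,
    hL.image continuous_fst, ?_, fun x hx hxL ξ hξ => ?_⟩
  · rintro _ ⟨p, hp, rfl⟩
    exact (hLM hp).1
  · have hpos := norm_pos_iff.2 hξ
    have h1 := hLa (normalizeMomentum (x, ξ)) (normalizeMomentum_mem ⟨hx, hξ⟩)
      (norm_normalizeMomentum hξ) (fun hL => hxL ⟨_, hL, rfl⟩) s hs
    have h2 := hhom x hx ξ hξ _ (inv_pos.2 hpos)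
    simp only [normalizeMomentum] at h1
    rw [h1] at h2
    exact (mul_eq_zero.1 h2.symm).resolve_left (inv_pos.2 hpos).ne'

/-- A finite measure on the unit cosphere bundle solving the radially averaged Vlasov equation is
invariant under the flow, when tested with functions that are homogeneous of degree `1`. -/
theorem IsReparametrizedFlow.integral_comp_flow (h : IsReparametrizedFlow M g f Ψ)
    (hg : IsLorentzianMetric 2 M g) {m : Measure (Coord n × Coord n)} [IsFiniteMeasure m]
    (hm : ∀ᵐ p ∂m, p ∈ puncturedSet M ∧ ‖p.2‖ = 1)
    (hT : ∀ a, IsHomogeneousTestFunction M a → ∫ p, flowDeriv g a p.1 p.2 ∂m = 0)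
    (ha : IsHomogeneousTestFunction M a) (s : ℝ) :
    ∫ p, a (Ψ s p) * (f p.1)⁻¹ ∂m = ∫ p, a p * (f p.1)⁻¹ ∂m := by
  -- The integrand of the derivative is `f / |ξ|` times `X (a ∘ Ψ s₀)`. On unit covectors the weight
  -- `1 / f` leaves `X (a ∘ Ψ s₀)`, and `a ∘ Ψ s₀` is again an admissible test function.
  have hd : ∀ s₀, HasDerivAt (fun s => ∫ p, a (Ψ s p) * (f p.1)⁻¹ ∂m) 0 s₀ := by
    intro s₀
    obtain ⟨L, hL, hLM, hLa⟩ := h.exists_compact_support ha s₀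
    have hfc : ContinuousOn (fun p : Coord n × Coord n => (f p.1)⁻¹) L :=
      (h.continuous.comp continuous_fst).continuousOn.inv₀ fun p hp => (h.pos _ (hLM hp).1).ne'
    obtain ⟨C, hC⟩ := hL.exists_bound_of_continuousOn hfc
    have h1 := h.hasDerivAt_integral_flow hg ha.contDiffOn (m := m) (Q := id) aemeasurable_id
      (hm.mono fun p hp => hp.1) (w := fun p => (f p.1)⁻¹)
      (h.continuous.measurable.comp measurable_fst).inv.aestronglyMeasurable hL hLM
      (Eventually.of_forall fun p hp => hC p hp) s₀
      (hm.mono fun p hp hpL => hLa p hp.1 hp.2 hpL)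
    refine h1.congr_deriv ?_
    rw [← hT _ (h.isHomogeneousTestFunction_comp ha s₀)]
    refine integral_congr_ae (hm.mono fun p hp => ?_)
    have hf := (h.pos _ hp.1.1).ne'
    simp only [id, h.orbitDeriv_eq ha.contDiffOn hp.1, hp.2, div_one]
    field_simp
  have := is_const_of_deriv_eq_zero (fun s => (hd s).differentiableAt) (fun s => (hd s).deriv) s 0
  rw [this]
  exact integral_congr_ae (hm.mono fun p hp => by simp only [h.zero p hp.1])

end Invariance

end

end EinsteinVlasov

/-! ### From invariance for measurable functions to the Vlasov equation on a level set of `ρ`. -/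

namespace EinsteinVlasov

noncomputable section

section Lift

variable {n : ℕ} {M : TopologicalSpace.Opens (Coord n)} {g : MetricField n} {f : Coord n → ℝ}
  {Ψ : ℝ → Coord n × Coord n → Coord n × Coord n} {p : Coord n × Coord n}
  {a : Coord n × Coord n → ℝ} {m : Measure (Coord n × Coord n)}

namespace IsReparametrizedFlow

theorem integrable_homogeneous [IsFiniteMeasure m] (h : IsReparametrizedFlow M g f Ψ)
    (hm : ∀ᵐ p ∂m, p ∈ puncturedSet M ∧ ‖p.2‖ = 1) (ha : IsHomogeneousTestFunction M a) :
    Integrable (fun p => a p * (f p.1)⁻¹) m := by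
  classical
  obtain ⟨L, hL, hLM, hLa⟩ := h.exists_compact_support ha 0
  have hfc : ContinuousOn (fun p : Coord n × Coord n => (f p.1)⁻¹) (puncturedSet M) :=
    (h.continuous.comp continuous_fst).continuousOn.inv₀ fun p hp => (h.pos _ hp.1).ne'
  have hc : ContinuousOn (fun p => a p * (f p.1)⁻¹) (puncturedSet M) :=
    ha.contDiffOn.continuousOn.mul hfc
  obtain ⟨C, hC⟩ := hL.exists_bound_of_continuousOn (hc.mono hLM)
  have hmeas : AEStronglyMeasurable (fun p => a p * (f p.1)⁻¹) m := by
    have h1 : Measurable ((puncturedSet M).piecewise (fun p => a p * (f p.1)⁻¹) fun _ => 0) :=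
      hc.measurable_piecewise continuousOn_const (isOpen_puncturedSet M).measurableSet
    refine h1.aestronglyMeasurable.congr ?_
    filter_upwards [hm] with p hp using piecewise_eq_of_mem _ _ _ hp.1
  refine Integrable.of_bound hmeas |C| (hm.mono fun p hp => ?_)
  by_cases hpL : p ∈ L
  · exact (hC p hpL).trans (le_abs_self _)
  · have := hLa p hp.1 hp.2 hpL 0 (Metric.mem_ball_self one_pos)
    rw [h.zero p hp.1] at this
    simp [this]

/-- The invariance of a solution of the radially averaged Vlasov equation under the flow, for
measurable functions. -/
theorem integral_comp_flow_of_measurable [IsFiniteMeasure m] (h : IsReparametrizedFlow M g f Ψ)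
    (hg : IsLorentzianMetric 2 M g) (hm : ∀ᵐ p ∂m, p ∈ puncturedSet M ∧ ‖p.2‖ = 1)
    (hT : ∀ a, IsHomogeneousTestFunction M a → ∫ p, flowDeriv g a p.1 p.2 ∂m = 0)
    {c : Coord n × Coord n → ℝ} (hc : Measurable c) (s : ℝ) :
    ∫ p, ‖(Ψ s p).2‖ * (f p.1)⁻¹ * c (normalizeMomentum (Ψ s p)) ∂m =
      ∫ p, (f p.1)⁻¹ * c p ∂m := by
  classical
  let P : Coord n × Coord n → Coord n × Coord n := (puncturedSet M).piecewise (Ψ s) id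
  have hP : Measurable P := (h.contDiffOn s).continuousOn.measurable_piecewise
    continuousOn_id (isOpen_puncturedSet M).measurableSet
  have hPΨ : ∀ p ∈ puncturedSet M, P p = Ψ s p := fun p hp => piecewise_eq_of_mem _ _ _ hp
  have hfm : Measurable fun p : Coord n × Coord n => (f p.1)⁻¹ :=
    (h.continuous.measurable.comp measurable_fst).inv
  have hw : Measurable fun p => ‖(P p).2‖ * (f p.1)⁻¹ := (measurable_snd.comp hP).norm.mul hfm
  have hRP : Measurable fun p => normalizeMomentum (P p) := measurable_normalizeMomentum.comp hP
  have hf0 : ∀ p ∈ puncturedSet M, 0 < (f p.1)⁻¹ := fun p hp => inv_pos.2 (h.pos _ hp.1)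
  -- Invariance is read as an equality of measures: `f⁻¹ m` equals its image under the normalized
  -- flow, with the factor `|Ψ s p|` lost by normalizing put into the density.
  let σ₁ := (m.withDensity fun p => ENNReal.ofReal (‖(P p).2‖ * (f p.1)⁻¹)).map
    fun p => normalizeMomentum (P p)
  let σ₂ := m.withDensity fun p => ENNReal.ofReal ((f p.1)⁻¹)
  have hΩ := (isOpen_puncturedSet M).measurableSet
  have hσ : σ₁ = σ₂ := by
    refine measure_eq_of_lintegral_smooth_eq (isOpen_puncturedSet M) ?_ ?_
      fun c hcd hcc hcM hc0 => ?_
    · rw [Measure.map_apply hRP hΩ.compl]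
      refine withDensity_absolutelyContinuous _ _ (measure_mono_null ?_ (ae_iff.1 hm))
      intro p hp hp'
      have hp2 : normalizeMomentum (P p) ∉ puncturedSet M := hp
      rw [hPΨ p hp'.1] at hp2
      exact hp2 (normalizeMomentum_mem (h.mem s p hp'.1))
    · have hz : m {p | ¬ (p ∈ puncturedSet M ∧ ‖p.2‖ = 1)} = 0 := ae_iff.1 hm
      refine withDensity_absolutelyContinuous _ _ (measure_mono_null ?_ hz)
      intro p hp hp'
      exact hp hp'.1
    · have ha := isHomogeneousTestFunction_of_hasCompactSupport (M := M)
        (hcd.of_le (mod_cast le_top)) hcc hcM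
      have e := h.integral_comp_flow hg hm hT ha s
      have i1 := h.integrable_homogeneous hm ha
      have i2 := h.integrable_homogeneous hm (h.isHomogeneousTestFunction_comp ha s)
      have hcm : Measurable fun p => ENNReal.ofReal (c p) :=
        hcd.continuous.measurable.ennreal_ofReal
      have l2 : ∫⁻ p, ENNReal.ofReal (c p) ∂σ₂ =
          ENNReal.ofReal (∫ p, ‖p.2‖ * c (normalizeMomentum p) * (f p.1)⁻¹ ∂m) := by
        rw [lintegral_withDensity_eq_lintegral_mul _ hfm.ennreal_ofReal hcm,
          ofReal_integral_eq_lintegral_ofReal i1 (hm.mono fun p hp => mul_nonneg (mul_nonneg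
            (norm_nonneg _) (hc0 _)) (hf0 p hp.1).le)]
        refine lintegral_congr_ae (hm.mono fun p hp => ?_)
        simp only [Pi.mul_apply, hp.2, one_mul, normalizeMomentum_of_norm hp.2]
        rw [ENNReal.ofReal_mul (hc0 p), mul_comm]
      have l1 : ∫⁻ p, ENNReal.ofReal (c p) ∂σ₁ = ENNReal.ofReal
          (∫ p, ‖(Ψ s p).2‖ * c (normalizeMomentum (Ψ s p)) * (f p.1)⁻¹ ∂m) := by
        have hcm' : Measurable fun p => ENNReal.ofReal (c (normalizeMomentum (P p))) :=
          hcm.comp hRP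
        rw [lintegral_map hcm hRP, lintegral_withDensity_eq_lintegral_mul _ hw.ennreal_ofReal hcm',
          ofReal_integral_eq_lintegral_ofReal i2 (hm.mono fun p hp => mul_nonneg (mul_nonneg
            (norm_nonneg _) (hc0 _)) (hf0 p hp.1).le)]
        refine lintegral_congr_ae (hm.mono fun p hp => ?_)
        simp only [Pi.mul_apply, hPΨ p hp.1]
        rw [← ENNReal.ofReal_mul (mul_nonneg (norm_nonneg _) (hf0 p hp.1).le), mul_right_comm]
      exact ⟨by rw [l1, l2, e], by rw [l2]; exact ENNReal.ofReal_lt_top⟩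
  have hI : ∫ p, c p ∂σ₁ = ∫ p, c p ∂σ₂ := by rw [hσ]
  rw [integral_map hRP.aemeasurable hc.aestronglyMeasurable,
    integral_withDensity_eq_integral_toReal_smul hw.ennreal_ofReal
      (Eventually.of_forall fun _ => ENNReal.ofReal_lt_top),
    integral_withDensity_eq_integral_toReal_smul hfm.ennreal_ofReal
      (Eventually.of_forall fun _ => ENNReal.ofReal_lt_top)] at hI
  convert hI using 1
  · refine integral_congr_ae (hm.mono fun p hp => ?_)
    simp only [hPΨ p hp.1, smul_eq_mul]
    rw [ENNReal.toReal_ofReal (mul_nonneg (norm_nonneg _) (hf0 p hp.1).le)]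
  · refine integral_congr_ae (hm.mono fun p hp => ?_)
    simp only [smul_eq_mul]
    rw [ENNReal.toReal_ofReal (hf0 p hp.1).le]

/-- The measure obtained by placing a solution of the radially averaged Vlasov equation on a level
set of a conserved function solves the Vlasov equation. -/
theorem integral_conserved_section [IsFiniteMeasure m] (h : IsReparametrizedFlow M g f Ψ)
    (hg : IsLorentzianMetric 2 M g) (hm : ∀ᵐ p ∂m, p ∈ nullSet M g ∧ ‖p.2‖ = 1)
    (hT : ∀ a, IsHomogeneousTestFunction M a → ∫ p, flowDeriv g a p.1 p.2 ∂m = 0)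
    {ρ : Coord n × Coord n → ℝ} (hρ : Measurable ρ) (hρ0 : ∀ p ∈ puncturedSet M, 0 < ρ p)
    (hρ1 : ∀ p ∈ puncturedSet M, ∀ c : ℝ, 0 < c → ρ (p.1, c • p.2) = c * ρ p)
    (hρΨ : ∀ p ∈ nullSet M g, ∀ s, ρ (Ψ s p) = ρ p)
    (ha : ContDiff ℝ 1 a) (hac : HasCompactSupport a) (haM : tsupport a ⊆ puncturedSet M) :
    ∫ p, ρ p ^ 2 * flowDeriv g a p.1 ((ρ p)⁻¹ • p.2) ∂m = 0 := by
  have hm' : ∀ᵐ p ∂m, p ∈ puncturedSet M ∧ ‖p.2‖ = 1 := hm.mono fun p hp => ⟨hp.1.1, hp.2⟩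
  let Q : Coord n × Coord n → Coord n × Coord n := fun p => (p.1, (ρ p)⁻¹ • p.2)
  have hQ : Measurable Q := by
    have := hρ.inv
    exact measurable_fst.prodMk (this.smul measurable_snd)
  have hQm : ∀ p ∈ puncturedSet M, Q p ∈ puncturedSet M := fun p hp =>
    smul_mem_puncturedSet hp (inv_pos.2 (hρ0 p hp))
  have hfm : Measurable fun p : Coord n × Coord n => (f p.1)⁻¹ :=
    (h.continuous.measurable.comp measurable_fst).inv
  -- `Q` moves a covector to the level `ρ = 1` on its ray. Conservation of `ρ` makes `Q` commute
  -- with the flow up to normalization, so invariance for `ρ · (a ∘ Q)` says that this integral does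
  -- not depend on `s`.
  have hconst : ∀ s, ∫ p, a (Ψ s (Q p)) * (ρ p * (f p.1)⁻¹) ∂m =
      ∫ p, (f p.1)⁻¹ * (ρ p * a (Q p)) ∂m := by
    intro s
    rw [← h.integral_comp_flow_of_measurable hg hm' hT
      (c := fun p => ρ p * a (Q p)) (hρ.mul (ha.continuous.measurable.comp hQ)) s]
    refine integral_congr_ae (hm.mono fun p hp => ?_)
    have hΩ := hp.1.1
    have hs := h.mem s p hΩ
    have hn : 0 < ‖(Ψ s p).2‖ := norm_pos_iff.2 hs.2
    have e1 : ρ (normalizeMomentum (Ψ s p)) = ‖(Ψ s p).2‖⁻¹ * ρ p := by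
      rw [← hρΨ p hp.1 s]
      exact hρ1 _ hs _ (inv_pos.2 hn)
    have e2 : Q (normalizeMomentum (Ψ s p)) = Ψ s (Q p) := by
      have h3 : Ψ s (Q p) = ((Ψ s p).1, (ρ p)⁻¹ • (Ψ s p).2) :=
        h.smul s p hΩ _ (inv_pos.2 (hρ0 p hΩ))
      rw [h3]
      simp only [Q, e1]
      simp only [normalizeMomentum, smul_smul, mul_inv, inv_inv]
      rw [mul_right_comm, mul_inv_cancel₀ hn.ne', one_mul]
    simp only [e1, e2]
    field_simp
  obtain ⟨hL, hLM⟩ := h.isCompact_image_flow hac.isCompact haM 0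
  set L := (fun z : ℝ × (Coord n × Coord n) => Ψ (-z.1) z.2) ''
    (Metric.closedBall 0 1 ×ˢ tsupport a) with hLdef
  have hwc : ContinuousOn (fun q : Coord n × Coord n => ‖q.2‖⁻¹ * (f q.1)⁻¹) L :=
    (continuous_snd.norm.continuousOn.inv₀ fun p hp => norm_ne_zero_iff.2 (hLM hp).2).mul
      ((h.continuous.comp continuous_fst).continuousOn.inv₀ fun p hp => (h.pos _ (hLM hp).1).ne')
  obtain ⟨C, hC⟩ := hL.exists_bound_of_continuousOn hwc
  have hQn : ∀ p ∈ puncturedSet M, ‖p.2‖ = 1 → ‖(Q p).2‖⁻¹ = ρ p := fun p hp hp1 => by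
    simp only [Q, norm_smul, hp1, mul_one, norm_inv, inv_inv, Real.norm_of_nonneg (hρ0 p hp).le]
  -- The function `ρ` need not be bounded, but `ρ p = |Q p|⁻¹` on unit covectors, which bounds the
  -- weight where `Q p` lies in the compact set `L`.
  have hd := h.hasDerivAt_integral_flow hg ha.contDiffOn (m := m) hQ.aemeasurable
    (hm.mono fun p hp => hQm p hp.1.1) (w := fun p => ρ p * (f p.1)⁻¹)
    (hρ.mul hfm).aestronglyMeasurable hL hLM
    (hm.mono fun p hp hpL => by
      have := hC _ hpL
      rwa [hQn p hp.1.1 hp.2] at this) 0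
    (hm.mono fun p hp hpL s hs => by
      refine image_eq_zero_of_notMem_tsupport fun hsupp => hpL ?_
      exact ⟨(s, Ψ s (Q p)), ⟨Metric.ball_subset_closedBall hs, hsupp⟩,
        h.neg_flow_flow (hQm p hp.1.1) s⟩)
  simp only [hconst] at hd
  -- The derivative at `s = 0` of a constant is zero. Its integrand is `(f / |Q p|) Xa (Q p) · (ρ /
  -- f)`, which equals `ρ² Xa (Q p)`.
  rw [← hd.unique (hasDerivAt_const _ _)]
  refine integral_congr_ae (hm.mono fun p hp => ?_)
  have hΩ := hp.1.1
  have hf := (h.pos _ hΩ.1).ne'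
  simp only [orbitDeriv, h.zero _ (hQm p hΩ), div_eq_mul_inv, hQn p hΩ hp.2]
  simp only [Q]
  field_simp

end IsReparametrizedFlow

end Lift

end

end EinsteinVlasov

/-! ### The cosphere bundle through unit representatives. -/

namespace EinsteinVlasov

noncomputable section

section CosphereBundle

variable {n : ℕ} {M : TopologicalSpace.Opens (Coord n)} {g : MetricField n}
  {a : Coord n × Coord n → ℝ}

/-- The inclusion of `T^*M` in the coordinate space. -/
def Cotangent.toCoord (p : Cotangent M) : Coord n × Coord n := (p.1, p.2)

theorem Cotangent.continuous_toCoord : Continuous (Cotangent.toCoord (M := M)) :=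
  (continuous_subtype_val.comp continuous_fst).prodMk continuous_snd

theorem Cotangent.toCoord_mem {p : Cotangent M} (hp : p.2 ≠ 0) : p.toCoord ∈ puncturedSet M :=
  ⟨p.1.2, hp⟩

namespace Cosphere

theorem rep_ne_zero (θ : Cosphere M) : θ.rep.2 ≠ 0 :=
  (Quotient.out (s := raySetoid M) θ).2

theorem mk_rep (θ : Cosphere M) : Cosphere.mk ⟨θ.rep, θ.rep_ne_zero⟩ = θ :=
  Quotient.out_eq (s := raySetoid M) θ

theorem mk_eq_mk {p q : PuncturedCotangent M} {c : ℝ} (hc : 0 < c) (h₁ : p.1.1 = q.1.1)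
    (h₂ : p.1.2 = c • q.1.2) : Cosphere.mk p = Cosphere.mk q :=
  Quotient.sound (s := raySetoid M) ⟨h₁, c, hc, h₂⟩

theorem continuous_mk : Continuous (Cosphere.mk (M := M)) :=
  continuous_quot_mk

theorem continuous_iff_comp_mk {X : Type*} [TopologicalSpace X] {F : Cosphere M → X} :
    Continuous F ↔ Continuous fun p => F (Cosphere.mk p) :=
  (isQuotientMap_quot_mk (r := (raySetoid M).r)).continuous_iff

/-- The unit covector spanning a ray. -/
def unitRep (θ : Cosphere M) : Coord n × Coord n := normalizeMomentum θ.rep.toCoord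

theorem unitRep_mem (θ : Cosphere M) : θ.unitRep ∈ puncturedSet M :=
  normalizeMomentum_mem (Cotangent.toCoord_mem θ.rep_ne_zero)

theorem norm_unitRep (θ : Cosphere M) : ‖θ.unitRep.2‖ = 1 :=
  norm_normalizeMomentum (p := θ.rep.toCoord) θ.rep_ne_zero

theorem unitRep_fst (θ : Cosphere M) : θ.unitRep.1 = θ.rep.1 := rfl

theorem rep_snd (θ : Cosphere M) : θ.rep.2 = ‖θ.rep.2‖ • θ.unitRep.2 := by
  simp only [unitRep, normalizeMomentum, Cotangent.toCoord, smul_smul]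
  rw [mul_inv_cancel₀ (norm_ne_zero_iff.2 θ.rep_ne_zero), one_smul]

theorem norm_rep_pos (θ : Cosphere M) : 0 < ‖θ.rep.2‖ := norm_pos_iff.2 θ.rep_ne_zero

theorem unitRep_mk (p : PuncturedCotangent M) :
    (Cosphere.mk p).unitRep = normalizeMomentum p.1.toCoord := by
  obtain ⟨h1, c, hc, h2⟩ := Cosphere.rep_mk p
  have : (Cosphere.mk p).rep.toCoord = (p.1.toCoord.1, c • p.1.toCoord.2) := by
    simp only [Cotangent.toCoord, h1, h2]
  rw [unitRep, this, normalizeMomentum_smul hc]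

theorem continuous_unitRep : Continuous (unitRep (M := M)) := by
  rw [continuous_iff_comp_mk]
  simp only [unitRep_mk]
  exact contDiffOn_normalizeMomentum.continuousOn.comp_continuous
    (Cotangent.continuous_toCoord.comp continuous_subtype_val) fun p => Cotangent.toCoord_mem p.2

theorem continuous_base : Continuous fun θ : Cosphere M => θ.rep.1 :=
  Topology.IsInducing.subtypeVal.continuous_iff.2 (continuous_fst.comp continuous_unitRep)

/-- This set is the continuous image of `K` times the unit sphere. -/
theorem isCompact_base_preimage {K : Set (Coord n)} (hK : IsCompact K) (hKM : K ⊆ M) :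
    IsCompact {θ : Cosphere M | (θ.rep.1 : Coord n) ∈ K} := by
  have h1 : IsCompact ((K ×ˢ Metric.sphere (0 : Coord n) 1)) := hK.prod (isCompact_sphere _ _)
  have hmem : ∀ p : ↥(K ×ˢ Metric.sphere (0 : Coord n) 1), p.1.2 ≠ 0 := fun p h0 => by
    have := p.2.2
    rw [h0, mem_sphere_zero_iff_norm, norm_zero] at this
    exact zero_ne_one this
  let F : ↥(K ×ˢ Metric.sphere (0 : Coord n) 1) → Cosphere M := fun p =>
    Cosphere.mk ⟨(⟨p.1.1, hKM p.2.1⟩, p.1.2), hmem p⟩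
  have hF : Continuous F := continuous_mk.comp (by fun_prop)
  have := isCompact_iff_isCompact_univ.1 h1
  convert this.image hF using 1
  ext θ
  simp only [mem_ofPred_eq, image_univ, mem_range]
  constructor
  · intro hθ
    refine ⟨⟨θ.unitRep, hθ, by simp [norm_unitRep]⟩, ?_⟩
    conv_rhs => rw [← mk_rep θ]
    exact mk_eq_mk (inv_pos.2 θ.norm_rep_pos) rfl rfl
  · rintro ⟨p, rfl⟩
    have := (Cosphere.rep_mk (M := M) ⟨(⟨p.1.1, hKM p.2.1⟩, p.1.2), hmem p⟩).1
    rw [this]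
    exact p.2.1

theorem hasCompactSupport_of_base {K : Set (Coord n)} (hK : IsCompact K) (hKM : K ⊆ M)
    {F : Cosphere M → ℝ} (hF : ∀ θ, (θ.rep.1 : Coord n) ∉ K → F θ = 0) : HasCompactSupport F := by
  refine (isCompact_base_preimage hK hKM).of_isClosed_subset (isClosed_tsupport _) ?_
  refine closure_minimal (fun θ hθ => ?_)
    (hK.isClosed.preimage (continuous_subtype_val.comp continuous_base))
  by_contra h
  exact hθ (hF θ h)

end Cosphere

theorem aestronglyMeasurable_comp_of_continuousOn {Θ : Type*} [MeasurableSpace Θ] {m : Measure Θ}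
    {Q : Θ → Coord n × Coord n} (hQ : AEMeasurable Q m) (hQm : ∀ᵐ θ ∂m, Q θ ∈ puncturedSet M)
    {φ : Coord n × Coord n → ℝ} (hφ : ContinuousOn φ (puncturedSet M)) :
    AEStronglyMeasurable (fun θ => φ (Q θ)) m := by
  classical
  have h1 : Measurable ((puncturedSet M).piecewise φ fun _ => 0) :=
    hφ.measurable_piecewise continuousOn_const (isOpen_puncturedSet M).measurableSet
  refine (h1.comp_aemeasurable hQ).aestronglyMeasurable.congr ?_
  filter_upwards [hQm] with θ hθ
  exact piecewise_eq_of_mem _ _ _ hθ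

/-- Let `A` dilate the momentum by `c`. Then `a ∘ A = c a`, and the geodesic field at `A p` is `c`
times the `A`-image of the field at `p`. Each relation contributes one factor `c`. -/
theorem flowDeriv_smul (g : MetricField n) (ha : IsHomogeneousTestFunction M a) {x ξ : Coord n}
    (hx : x ∈ M) (hξ : ξ ≠ 0) {c : ℝ} (hc : 0 < c) :
    flowDeriv g a x (c • ξ) = c ^ 2 * flowDeriv g a x ξ := by
  have hd : ∀ ξ : Coord n, ξ ≠ 0 → HasFDerivAt a (fderiv ℝ a (x, ξ)) (x, ξ) := fun ξ hξ =>
    ((ha.contDiffOn.contDiffAt ((isOpen_puncturedSet M).mem_nhds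
      (show (x, ξ) ∈ puncturedSet M from ⟨hx, hξ⟩))).differentiableAt one_ne_zero).hasFDerivAt
  let A : Coord n × Coord n →L[ℝ] Coord n × Coord n :=
    (ContinuousLinearMap.fst ℝ _ _).prod (c • ContinuousLinearMap.snd ℝ _ _)
  have h1 : HasFDerivAt (fun p => a (A p)) ((fderiv ℝ a (x, c • ξ)).comp A) (x, ξ) :=
    HasFDerivAt.comp (x, ξ) (hd (c • ξ) (smul_ne_zero hc.ne' hξ)) A.hasFDerivAt
  have h2 : HasFDerivAt (fun p => c * a p) (c • fderiv ℝ a (x, ξ)) (x, ξ) := (hd ξ hξ).const_mul c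
  have h3 : (fun p => a (A p)) =ᶠ[𝓝 (x, ξ)] fun p => c * a p := by
    filter_upwards [(isOpen_puncturedSet M).mem_nhds (show (x, ξ) ∈ puncturedSet M from ⟨hx, hξ⟩)]
      with p hp
    exact ha.homogeneous p.1 hp.1 p.2 hp.2 c hc
  have h4 := h1.unique (h2.congr_of_eventuallyEq h3)
  have h5 : hamField g (x, c • ξ) = c • A (hamField g (x, ξ)) := by
    simp only [hamField, raiseIndex_smul, geodesicForce_smul]
    ext1
    · rfl
    · simp [A, smul_smul, pow_two]
  rw [flowDeriv_eq_fderiv, flowDeriv_eq_fderiv, h5, map_smul]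
  have h6 := congrArg (fun B : Coord n × Coord n →L[ℝ] ℝ => B (hamField g (x, ξ))) h4
  simp only [ContinuousLinearMap.comp_apply, _root_.smul_apply, smul_eq_mul] at h6
  rw [h6, smul_eq_mul]
  ring

theorem pairing_smul (c : ℝ) (ξ v : Coord n) : pairing (c • ξ) v = c * pairing ξ v := by
  simp only [pairing, PiLp.smul_apply, smul_eq_mul, Finset.mul_sum, mul_assoc]

namespace Cosphere

theorem flowDeriv_rep (g : MetricField n) (ha : IsHomogeneousTestFunction M a) (θ : Cosphere M) :
    flowDeriv g a θ.rep.1 θ.rep.2 / ‖θ.rep.2‖ ^ 2 = flowDeriv g a θ.unitRep.1 θ.unitRep.2 := by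
  rw [rep_snd, flowDeriv_smul g ha θ.rep.1.2 θ.unitRep_mem.2 θ.norm_rep_pos, norm_smul, norm_norm,
    norm_unitRep, mul_one, mul_div_cancel_left₀ _ (pow_pos θ.norm_rep_pos 2).ne', unitRep_fst]

theorem pairing_rep (v : Coord n) (θ : Cosphere M) :
    pairing θ.rep.2 v ^ 2 / ‖θ.rep.2‖ ^ 2 = pairing θ.unitRep.2 v ^ 2 := by
  rw [rep_snd, pairing_smul, norm_smul, norm_norm, norm_unitRep, mul_one, mul_pow,
    mul_div_cancel_left₀ _ (pow_pos θ.norm_rep_pos 2).ne']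

theorem cometricForm_rep (g : MetricField n) (θ : Cosphere M) :
    cometricForm g θ.rep.1 θ.rep.2 θ.rep.2 / ‖θ.rep.2‖ ^ 2 =
      cometricForm g θ.unitRep.1 θ.unitRep.2 θ.unitRep.2 := by
  rw [rep_snd, cometricForm_smul, norm_smul, norm_norm, norm_unitRep, mul_one,
    mul_div_cancel_left₀ _ (pow_pos θ.norm_rep_pos 2).ne', unitRep_fst]

end Cosphere

/-- A radially averaged solution is concentrated on the zero mass shell. -/
theorem IsRadiallyAveragedSolution.ae_mem_nullSet (hg : IsLorentzianMetric 2 M g)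
    {ν : Measure (Cosphere M)} (hν : IsRadiallyAveragedSolution M g ν) :
    ∀ᵐ θ ∂ν, Cosphere.unitRep θ ∈ nullSet M g := by
  have := hν.finite
  obtain ⟨χ, hχ, hχc, hχs, hχ01, -, hχ1⟩ := exists_smooth_exhaustion M.isOpen
  let H : Cosphere M → ℝ := fun θ => cometricForm g θ.unitRep.1 θ.unitRep.2 θ.unitRep.2
  have hH : Continuous H := hg.contDiffOn_cometricForm.continuousOn.comp_continuous
    Cosphere.continuous_unitRep fun θ => puncturedSet_subset θ.unitRep_mem
  -- Testing with `χ k · H` gives `∫ χ k · H² dν = 0` with a nonnegative integrand. Compact support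
  -- in `x` alone suffices because the fibres are compact.
  have key : ∀ k, ∀ᵐ θ ∂ν, χ k (θ.rep.1 : Coord n) * H θ * H θ = 0 := by
    intro k
    have hc1 : Continuous fun θ : Cosphere M => χ k (θ.rep.1 : Coord n) :=
      (hχ k).continuous.comp (continuous_subtype_val.comp Cosphere.continuous_base)
    have hs1 : HasCompactSupport fun θ : Cosphere M => χ k (θ.rep.1 : Coord n) * H θ :=
      Cosphere.hasCompactSupport_of_base (hχc k).isCompact (hχs k) fun θ hθ => by
        rw [image_eq_zero_of_notMem_tsupport hθ, zero_mul]
    have hs2 : HasCompactSupport fun θ : Cosphere M => χ k (θ.rep.1 : Coord n) * H θ * H θ :=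
      hs1.mul_right
    have h1 := hν.null_support _ (hc1.mul hH) hs1
    have h2 : ∫ θ, χ k (θ.rep.1 : Coord n) * H θ * H θ ∂ν = 0 := by
      rw [← h1]
      refine integral_congr_ae (Eventually.of_forall fun θ => ?_)
      simp only
      rw [mul_div_assoc, Cosphere.cometricForm_rep]
      rfl
    have hcont : Continuous fun θ : Cosphere M => χ k (θ.rep.1 : Coord n) * H θ * H θ :=
      (hc1.mul hH).mul hH
    obtain ⟨C, hC⟩ := hs2.exists_bound_of_continuous hcont
    rw [integral_eq_zero_iff_of_nonneg (fun θ => by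
      simp only [Pi.zero_apply]
      rw [mul_assoc]
      exact mul_nonneg (hχ01 _ _).1 (mul_self_nonneg _))
      (Integrable.of_bound hcont.aestronglyMeasurable C (Eventually.of_forall hC))] at h2
    exact h2
  filter_upwards [ae_all_iff.2 key] with θ hθ
  refine ⟨θ.unitRep_mem, ?_⟩
  obtain ⟨k, hk⟩ := hχ1 {(θ.rep.1 : Coord n)} (by simp) isCompact_singleton
  have := hθ k
  rw [hk _ rfl, one_mul] at this
  exact mul_self_eq_zero.1 this

end CosphereBundle

end

end EinsteinVlasov

/-! ### Construction of the measure solution from a radially averaged one. -/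

namespace EinsteinVlasov

noncomputable section

section Lift

variable {n : ℕ} {M : TopologicalSpace.Opens (Coord n)} {g : MetricField n}

theorem continuous_pairing {X : Type*} [TopologicalSpace X] {u v : X → Coord n} (hu : Continuous u)
    (hv : Continuous v) : Continuous fun x => pairing (u x) (v x) := by
  unfold pairing
  fun_prop

theorem IsLorentzianMetric.continuous_flowDeriv (hg : IsLorentzianMetric 2 M g)
    {a : Coord n × Coord n → ℝ} (ha : ContDiff ℝ 1 a) :
    Continuous fun p : Cotangent M => flowDeriv g a p.1 p.2 := by
  have h : ContinuousOn (fun p => fderiv ℝ a p (hamField g p)) ((M : Set (Coord n)) ×ˢ univ) :=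
    (ha.continuous_fderiv one_ne_zero).continuousOn.clm_apply hg.contDiffOn_hamField.continuousOn
  simp only [flowDeriv_eq_fderiv]
  exact h.comp_continuous Cotangent.continuous_toCoord fun p => ⟨p.1.2, trivial⟩

theorem IsLorentzianMetric.continuous_cometricForm (hg : IsLorentzianMetric 2 M g) :
    Continuous fun p : Cotangent M => cometricForm g p.1 p.2 p.2 := by
  have h := hg.contDiffOn_cometricForm.continuousOn
  rw [continuousOn_iff_continuous_domRestrict] at h
  have := h.comp (Cotangent.continuous_toCoord.subtype_mk fun p => mk_mem_prod p.1.2 (mem_univ _))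
  simpa only [Function.comp_def, domRestrict_apply, Cotangent.toCoord] using this

/-- The section of `T^*M ∖ {0} → S^*M` that meets the ray `θ` at `|ξ| = (r θ)⁻¹`. -/
def Cosphere.lift (r : Cosphere M → ℝ) (hr : ∀ θ, 0 < r θ) (θ : Cosphere M) :
    PuncturedCotangent M :=
  ⟨(θ.rep.1, (r θ)⁻¹ • θ.unitRep.2), smul_ne_zero (inv_pos.2 (hr θ)).ne' θ.unitRep_mem.2⟩

theorem Cosphere.measurable_lift {r : Cosphere M → ℝ} {hr : ∀ θ, 0 < r θ} (hrm : Measurable r) :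
    Measurable (Cosphere.lift r hr) := by
  refine Measurable.subtype_mk (Cosphere.continuous_base.measurable.prodMk ?_)
  exact hrm.inv.smul (continuous_snd.comp Cosphere.continuous_unitRep).measurable

theorem Cosphere.mk_lift (r : Cosphere M → ℝ) (hr : ∀ θ, 0 < r θ) (θ : Cosphere M) :
    Cosphere.mk (Cosphere.lift r hr θ) = θ := by
  conv_rhs => rw [← mk_rep θ]
  refine mk_eq_mk (c := (r θ)⁻¹ * ‖θ.rep.2‖⁻¹)
    (mul_pos (inv_pos.2 (hr θ)) (inv_pos.2 θ.norm_rep_pos)) rfl ?_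
  rw [mul_smul]
  rfl

theorem Cosphere.norm_lift (r : Cosphere M → ℝ) (hr : ∀ θ, 0 < r θ) (θ : Cosphere M) :
    ‖(Cosphere.lift r hr θ).1.2‖ = (r θ)⁻¹ := by
  rw [lift, norm_smul, norm_unitRep, mul_one, Real.norm_of_nonneg (inv_pos.2 (hr θ)).le]

/-- The measure on `T^*M ∖ {0}` carried by the section `Cosphere.lift r` whose radial average
is `ν`. -/
def liftMeasure (ν : Measure (Cosphere M)) (r : Cosphere M → ℝ) (hr : ∀ θ, 0 < r θ) :
    Measure (PuncturedCotangent M) :=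
  (ν.withDensity fun θ => ENNReal.ofReal (r θ ^ 2)).map (Cosphere.lift r hr)

theorem lintegral_liftMeasure {ν : Measure (Cosphere M)} {r : Cosphere M → ℝ} {hr : ∀ θ, 0 < r θ}
    (hrm : Measurable r) {F : PuncturedCotangent M → ENNReal} (hF : Measurable F) :
    ∫⁻ p, F p ∂liftMeasure ν r hr =
      ∫⁻ θ, ENNReal.ofReal (r θ ^ 2) * F (Cosphere.lift r hr θ) ∂ν := by
  rw [liftMeasure, lintegral_map hF (Cosphere.measurable_lift hrm)]
  exact lintegral_withDensity_eq_lintegral_mul _ (by fun_prop)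
    (hF.comp (Cosphere.measurable_lift hrm))

theorem integral_liftMeasure {ν : Measure (Cosphere M)} {r : Cosphere M → ℝ} {hr : ∀ θ, 0 < r θ}
    (hrm : Measurable r) {F : PuncturedCotangent M → ℝ} (hF : Continuous F) :
    ∫ p, F p ∂liftMeasure ν r hr = ∫ θ, r θ ^ 2 * F (Cosphere.lift r hr θ) ∂ν := by
  rw [liftMeasure, integral_map (Cosphere.measurable_lift hrm).aemeasurable
    hF.aestronglyMeasurable,
    integral_withDensity_eq_integral_toReal_smul (by fun_prop) (by simp)]
  simp [sq_nonneg]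

theorem measurableEmbedding_punctured :
    MeasurableEmbedding (Subtype.val : PuncturedCotangent M → Cotangent M) :=
  MeasurableEmbedding.subtype_coe (isOpen_ne_fun continuous_snd continuous_const).measurableSet

theorem comap_map_punctured (m : Measure (PuncturedCotangent M)) :
    (m.map (Subtype.val : PuncturedCotangent M → Cotangent M)).comap Subtype.val = m :=
  measurableEmbedding_punctured.comap_map m

theorem lintegral_norm_sq_map_liftMeasure_lt_top {ν : Measure (Cosphere M)} [IsFiniteMeasure ν]
    {r : Cosphere M → ℝ} {hr : ∀ θ, 0 < r θ} (hrm : Measurable r) :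
    ∫⁻ p : Cotangent M, ENNReal.ofReal (‖p.2‖ ^ 2)
      ∂(liftMeasure ν r hr).map Subtype.val < ⊤ := by
  have : ∀ θ, ENNReal.ofReal (r θ ^ 2) *
      ENNReal.ofReal (‖(Cosphere.lift r hr θ).1.2‖ ^ 2) = 1 := fun θ => by
    rw [← ENNReal.ofReal_mul (sq_nonneg _), Cosphere.norm_lift, ← mul_pow,
      mul_inv_cancel₀ (hr θ).ne', one_pow, ENNReal.ofReal_one]
  rw [measurableEmbedding_punctured.lintegral_map, lintegral_liftMeasure hrm (by fun_prop)]
  simp only [this, lintegral_one]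
  exact measure_lt_top _ _

/-- A density on the null directions that is locally bounded over compact subsets of `M`
lifts to a locally finite measure. -/
theorem isLocallyFiniteMeasure_map_liftMeasure {ν : Measure (Cosphere M)} [IsFiniteMeasure ν]
    {r : Cosphere M → ℝ} {hr : ∀ θ, 0 < r θ} (hrm : Measurable r)
    (hb : ∀ K : Set (Coord n), IsCompact K → K ⊆ M →
      ∃ C : ℝ, ∀ᵐ θ ∂ν, (θ.rep.1 : Coord n) ∈ K → r θ ≤ C) :
    IsLocallyFiniteMeasure
      ((liftMeasure ν r hr).map (Subtype.val : PuncturedCotangent M → Cotangent M)) := by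
  refine ⟨fun p => ?_⟩
  obtain ⟨K, hK, hpK, hKM⟩ := exists_compact_subset M.isOpen p.1.2
  obtain ⟨C, hC⟩ := hb K hK hKM
  have hcl : IsClosed {q : Cotangent M | (q.1 : Coord n) ∈ K} :=
    hK.isClosed.preimage (continuous_subtype_val.comp continuous_fst)
  refine ⟨{q : Cotangent M | (q.1 : Coord n) ∈ K},
    (continuous_subtype_val.comp continuous_fst).continuousAt.preimage_mem_nhds
      (mem_interior_iff_mem_nhds.1 hpK), ?_⟩
  rw [Measure.map_apply measurable_subtype_coe hcl.measurableSet, liftMeasure,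
    Measure.map_apply (Cosphere.measurable_lift hrm) (measurable_subtype_coe hcl.measurableSet),
    withDensity_apply _ (Cosphere.measurable_lift hrm (measurable_subtype_coe hcl.measurableSet))]
  refine lt_of_le_of_lt (setLIntegral_mono_ae (g := fun _ => ENNReal.ofReal (C ^ 2))
    measurable_const.aemeasurable ?_) ?_
  · filter_upwards [hC] with θ hθ hm
    exact ENNReal.ofReal_le_ofReal (pow_le_pow_left₀ (hr θ).le (hθ hm) 2)
  · rw [setLIntegral_const]
    exact ENNReal.mul_lt_top ENNReal.ofReal_lt_top (measure_lt_top _ _)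

/-- The measure `ν` is transported to the unit covectors in coordinate space, where the flow
argument is formulated. -/
theorem IsRadiallyAveragedSolution.integral_conserved_section (hg : IsLorentzianMetric 2 M g)
    {ν : Measure (Cosphere M)} (hν : IsRadiallyAveragedSolution M g ν) {f : Coord n → ℝ}
    {Ψ : ℝ → Coord n × Coord n → Coord n × Coord n} (h : IsReparametrizedFlow M g f Ψ)
    {ρ : Coord n × Coord n → ℝ} (hρ : Measurable ρ) (hρ0 : ∀ p ∈ puncturedSet M, 0 < ρ p)
    (hρ1 : ∀ p ∈ puncturedSet M, ∀ c : ℝ, 0 < c → ρ (p.1, c • p.2) = c * ρ p)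
    (hρΨ : ∀ p ∈ nullSet M g, ∀ s, ρ (Ψ s p) = ρ p) {a : Coord n × Coord n → ℝ}
    (ha1 : ContDiff ℝ 1 a) (hac : HasCompactSupport a) (haM : tsupport a ⊆ puncturedSet M) :
    ∫ θ, ρ (Cosphere.unitRep θ) ^ 2 *
      flowDeriv g a θ.unitRep.1 ((ρ θ.unitRep)⁻¹ • θ.unitRep.2) ∂ν = 0 := by
  have := hν.finite
  have hae := hν.ae_mem_nullSet hg
  have hmu : Measurable (Cosphere.unitRep (M := M)) := Cosphere.continuous_unitRep.measurable
  have hm' : ∀ᵐ p ∂ν.map Cosphere.unitRep, p ∈ nullSet M g ∧ ‖p.2‖ = 1 := by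
    refine (ae_map_iff hmu.aemeasurable ((measurableSet_nullSet hg).inter
      (measurableSet_eq_fun (by fun_prop) measurable_const))).2 ?_
    filter_upwards [hae] with θ hθ
    exact ⟨hθ, θ.norm_unitRep⟩
  have hmp : ∀ᵐ p ∂ν.map Cosphere.unitRep, p ∈ puncturedSet M := hm'.mono fun p hp => hp.1.1
  have hT : ∀ a, IsHomogeneousTestFunction M a →
      ∫ p, flowDeriv g a p.1 p.2 ∂ν.map Cosphere.unitRep = 0 := fun b hb => by
    have hbm : AEStronglyMeasurable (fun p : Coord n × Coord n => flowDeriv g b p.1 p.2)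
        (ν.map Cosphere.unitRep) := aestronglyMeasurable_comp_of_continuousOn (Q := id)
      aemeasurable_id hmp (continuousOn_flowDeriv hg hb.contDiffOn)
    rw [integral_map hmu.aemeasurable hbm, ← hν.transport b hb]
    exact integral_congr_ae (Eventually.of_forall fun θ => (Cosphere.flowDeriv_rep g hb θ).symm)
  have key := h.integral_conserved_section hg hm' hT hρ hρ0 hρ1 hρΨ ha1 hac haM
  rw [integral_map hmu.aemeasurable] at key
  · exact key
  · refine (hρ.pow_const 2).aestronglyMeasurable.mul
      (aestronglyMeasurable_comp_of_continuousOn (Q := fun p => (p.1, (ρ p)⁻¹ • p.2))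
        (measurable_fst.prodMk (hρ.inv.smul measurable_snd)).aemeasurable ?_
        (continuousOn_flowDeriv hg ha1.contDiffOn))
    filter_upwards [hmp] with p hp
    exact smul_mem_puncturedSet hp (inv_pos.2 (hρ0 p hp))

/-- A radially averaged solution on a globally hyperbolic spacetime is the radial average of a
measure solution. -/
theorem IsRadiallyAveragedSolution.exists_isMeasureSolution (hg : IsLorentzianMetric 2 M g)
    (hM : GloballyHyperbolic M g) {ν : Measure (Cosphere M)}
    (hν : IsRadiallyAveragedSolution M g ν) :
    ∃ μ : Measure (Cotangent M), IsMeasureSolution M g μ ∧ IsRadialAverage μ ν := by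
  have := hν.finite
  obtain ⟨S, hS⟩ := hM
  obtain ⟨f, Ψ, h⟩ := exists_isReparametrizedFlow hg
  obtain ⟨ρ, hρ, hρ0, hρ1, hρc, hρΨ⟩ := h.exists_conserved hg hS
  have hae := hν.ae_mem_nullSet hg
  have hmu : Measurable (Cosphere.unitRep (M := M)) := Cosphere.continuous_unitRep.measurable
  let r : Cosphere M → ℝ := fun θ => ρ θ.unitRep
  have hr : ∀ θ, 0 < r θ := fun θ => hρ0 _ θ.unitRep_mem
  have hrm : Measurable r := hρ.comp hmu
  -- Continuity of `ρ` is available only on the null cone. The unit null covectors over `K` are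
  -- compact, and almost every ray over `K` has its unit representative among them.
  have hb : ∀ K : Set (Coord n), IsCompact K → K ⊆ M →
      ∃ C : ℝ, ∀ᵐ θ ∂ν, (θ.rep.1 : Coord n) ∈ K → r θ ≤ C := by
    intro K hK hKM
    have hKp : K ×ˢ Metric.sphere (0 : Coord n) 1 ⊆ puncturedSet M := fun p hp =>
      ⟨hKM hp.1, ne_zero_of_mem_unit_sphere ⟨p.2, hp.2⟩⟩
    have hcpt := (hK.prod (isCompact_sphere (0 : Coord n) 1)).diff
      (isOpen_puncturedSet_diff_nullSet hg)
    have hsub : (K ×ˢ Metric.sphere (0 : Coord n) 1) \ (puncturedSet M \ nullSet M g) ⊆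
        nullSet M g := fun p hp => by
      by_contra hn
      exact hp.2 ⟨hKp hp.1, hn⟩
    obtain ⟨C, hC⟩ := hcpt.bddAbove_image (hρc.mono hsub)
    refine ⟨C, ?_⟩
    filter_upwards [hae] with θ hθ hθK
    exact hC (mem_image_of_mem ρ ⟨⟨hθK, by simp [Cosphere.norm_unitRep]⟩, fun hn => hn.2 hθ⟩)
  -- By homogeneity `ρ (x, ω / ρ(x, ω)) = 1`, so the measure sits on a conserved level set.
  let m : Measure (PuncturedCotangent M) := liftMeasure ν r hr
  let μ : Measure (Cotangent M) := m.map Subtype.val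
  have hμm : μ.comap Subtype.val = m := comap_map_punctured m
  have hint : ∀ F : Cotangent M → ℝ, Continuous F →
      ∫ p, F p ∂μ = ∫ θ, r θ ^ 2 * F (Cosphere.lift r hr θ).1 ∂ν := fun F hF => by
    rw [measurableEmbedding_punctured.integral_map]
    exact integral_liftMeasure hrm (hF.comp continuous_subtype_val)
  refine ⟨μ, ⟨?_, isLocallyFiniteMeasure_map_liftMeasure hrm hb, ?_, ?_, ?_⟩, ?_⟩
  · intro Y hY
    rw [hν.einstein Y hY, hint (fun p => pairing p.2 (Y p.1) ^ 2) ((continuous_pairing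
      continuous_snd
      (hY.smooth.continuous.comp (continuous_subtype_val.comp continuous_fst))).pow 2)]
    refine integral_congr_ae (Eventually.of_forall fun θ => ?_)
    simp only [Cosphere.pairing_rep, Cosphere.lift, pairing_smul, mul_pow]
    rw [← mul_assoc, ← mul_pow, mul_inv_cancel₀ (hr θ).ne', one_pow, one_mul]
  · exact lintegral_norm_sq_map_liftMeasure_lt_top hrm
  · have hms : MeasurableSet {p : Cotangent M | cometricForm g p.1 p.2 p.2 ≠ 0} :=
      (isOpen_ne_fun hg.continuous_cometricForm continuous_const).measurableSet
    rw [Measure.map_apply measurable_subtype_coe hms]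
    change liftMeasure ν r hr _ = 0
    rw [liftMeasure, Measure.map_apply (Cosphere.measurable_lift hrm)
      (measurable_subtype_coe hms)]
    refine withDensity_absolutelyContinuous _ _ (measure_mono_null (fun θ hθ => ?_) hae)
    intro hθn
    refine hθ ?_
    change cometricForm g θ.unitRep.1 ((r θ)⁻¹ • θ.unitRep.2) ((r θ)⁻¹ • θ.unitRep.2) = 0
    rw [cometricForm_smul, hθn.2, mul_zero]
  · intro a ha
    have hms : MeasurableSet {p : Cotangent M | p.2 ≠ 0} :=
      (isOpen_ne_fun continuous_snd continuous_const).measurableSet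
    have hfull : ∀ᵐ p ∂μ, p ∈ {p : Cotangent M | p.2 ≠ 0} := by
      refine (ae_map_iff measurable_subtype_coe.aemeasurable hms).2 ?_
      exact Eventually.of_forall fun p => p.2
    have ha1 : ContDiff ℝ 1 a := ha.smooth.of_le (by exact_mod_cast le_top)
    rw [Measure.restrict_eq_self_of_ae_mem hfull, hint _ (hg.continuous_flowDeriv ha1)]
    exact hν.integral_conserved_section hg h hρ hρ0 hρ1 hρΨ ha1 ha.compact ha.support
  · intro φ hφ _
    rw [hμm, integral_liftMeasure hrm (F := fun p => φ (Cosphere.mk p) * ‖p.1.2‖ ^ 2)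
      ((hφ.comp Cosphere.continuous_mk).mul (by fun_prop))]
    refine integral_congr_ae (Eventually.of_forall fun θ => ?_)
    simp only [Cosphere.mk_lift, Cosphere.norm_lift]
    have := (hr θ).ne'
    field_simp

end Lift

end

end EinsteinVlasov

/-! ### Mollification: the Vlasov equation for `C^1` test functions. -/

namespace EinsteinVlasov

noncomputable section

section Mollification

open scoped Convolution

/-- A compactly supported `C^1` function is approximated by smooth functions in the `C^1` sense,
with supports in a fixed compact subset of any neighbourhood of its support. -/
theorem exists_contDiff_fderiv_approx {E : Type*} [NormedAddCommGroup E] [NormedSpace ℝ E]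
    [FiniteDimensional ℝ E] {U : Set E} (hU : IsOpen U) {a : E → ℝ} (ha : ContDiff ℝ 1 a)
    (hac : HasCompactSupport a) (haU : tsupport a ⊆ U) :
    ∃ K, IsCompact K ∧ K ⊆ U ∧ ∀ ε > 0, ∃ b : E → ℝ, ContDiff ℝ ∞ b ∧ tsupport b ⊆ K ∧
      ∀ p, ‖fderiv ℝ b p - fderiv ℝ a p‖ ≤ ε := by
  have := FiniteDimensional.proper ℝ E
  obtain ⟨δ, hδ, hK⟩ := hac.isCompact.exists_cthickening_subset_open hU haU
  refine ⟨Metric.cthickening δ (tsupport a), hac.isCompact.cthickening, hK, fun ε hε => ?_⟩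
  borelize E
  have hu : UniformContinuous (fderiv ℝ a) :=
    (hac.fderiv ℝ).uniformContinuous_of_continuous (ha.continuous_fderiv one_ne_zero)
  obtain ⟨η, hη, hηu⟩ := Metric.uniformContinuous_iff.1 hu ε hε
  have hmin : 0 < min η δ := lt_min hη hδ
  -- Radius at most `η` keeps the derivative within `ε`, and radius at most `δ` keeps the support in
  -- the fixed compact set.
  let φ : ContDiffBump (0 : E) := ⟨min η δ / 2, min η δ, half_pos hmin, half_lt_self hmin⟩
  let μ : Measure E := Measure.addHaar
  refine ⟨φ.normed μ ⋆[ContinuousLinearMap.lsmul ℝ ℝ, μ] a,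
    φ.hasCompactSupport_normed.contDiff_convolution_left _ φ.contDiff_normed
      ha.continuous.locallyIntegrable, ?_, fun p => ?_⟩
  · refine closure_minimal ((support_convolution_subset _).trans ?_) Metric.isClosed_cthickening
    rintro _ ⟨u, hu, v, hv, rfl⟩
    rw [φ.support_normed_eq, mem_ball_zero_iff] at hu
    refine Metric.mem_cthickening_of_dist_le (u + v) v δ _ (subset_tsupport _ hv) ?_
    rw [dist_eq_norm, add_sub_cancel_right]
    exact hu.le.trans (min_le_right _ _)
  · have h := hac.hasFDerivAt_convolution_right (ContinuousLinearMap.lsmul ℝ ℝ)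
      (φ.continuous_normed (μ := μ)).locallyIntegrable ha (μ := μ) p
    have hL : (ContinuousLinearMap.lsmul ℝ ℝ : ℝ →L[ℝ] ℝ →L[ℝ] ℝ).precompR E =
      (ContinuousLinearMap.lsmul ℝ ℝ : ℝ →L[ℝ] (E →L[ℝ] ℝ) →L[ℝ] (E →L[ℝ] ℝ)) := by
      ext; rfl
    rw [h.fderiv, hL, ← dist_eq_norm]
    refine φ.dist_normed_convolution_le
      (ha.continuous_fderiv one_ne_zero).aestronglyMeasurable fun x hx => (hηu ?_).le
    exact lt_of_lt_of_le hx (min_le_left _ _)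

end Mollification

section RadialAverage

variable {n : ℕ} {M : TopologicalSpace.Opens (Coord n)} {g : MetricField n}
  {a : Coord n × Coord n → ℝ} {m : Measure (Coord n × Coord n)}

/-- Finite energy provides the majorant `C |ξ|²` for dominated convergence. It serves both for
mollification and for removing the momentum cut-off. -/
theorem integral_flowDeriv_eq_zero_of_tendsto (hg : IsLorentzianMetric 2 M g)
    (hm : ∀ᵐ p ∂m, p ∈ puncturedSet M) (hE : Integrable (fun p => ‖p.2‖ ^ 2) m)
    {b : ℕ → Coord n × Coord n → ℝ} (hb : ∀ k, ContDiffOn ℝ 1 (b k) (puncturedSet M))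
    (h0 : ∀ k, ∫ p, flowDeriv g (b k) p.1 p.2 ∂m = 0) {C : ℝ}
    (hC : ∀ k, ∀ p ∈ puncturedSet M, |flowDeriv g (b k) p.1 p.2| ≤ C * ‖p.2‖ ^ 2)
    (hlim : ∀ p ∈ puncturedSet M,
      Tendsto (fun k => flowDeriv g (b k) p.1 p.2) atTop (𝓝 (flowDeriv g a p.1 p.2))) :
    ∫ p, flowDeriv g a p.1 p.2 ∂m = 0 := by
  have h := tendsto_integral_of_dominated_convergence (μ := m)
    (F := fun k p => flowDeriv g (b k) p.1 p.2) (f := fun p => flowDeriv g a p.1 p.2)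
    (fun p => C * ‖p.2‖ ^ 2)
    (fun k => aestronglyMeasurable_comp_of_continuousOn (Q := id) aemeasurable_id hm
      (continuousOn_flowDeriv hg (hb k))) (hE.const_mul C)
    (fun k => hm.mono (hC k)) (hm.mono hlim)
  simp only [h0] at h
  exact tendsto_nhds_unique h tendsto_const_nhds

theorem flowDeriv_eq_zero_of_eventuallyEq {x ξ : Coord n} (h : a =ᶠ[𝓝 (x, ξ)] fun _ => 0) :
    flowDeriv g a x ξ = 0 := by
  rw [flowDeriv_eq_fderiv, h.fderiv_eq]
  simp

/-- Smooth test functions may be replaced by `C^1` test functions in the Vlasov equation. -/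
theorem integral_flowDeriv_of_contDiff_one (hg : IsLorentzianMetric 2 M g)
    (hm : ∀ᵐ p ∂m, p ∈ puncturedSet M) (hE : Integrable (fun p => ‖p.2‖ ^ 2) m)
    (hT : ∀ b, IsTestFunction M b → ∫ p, flowDeriv g b p.1 p.2 ∂m = 0)
    (ha : ContDiff ℝ 1 a) (hac : HasCompactSupport a) (haM : tsupport a ⊆ puncturedSet M) :
    ∫ p, flowDeriv g a p.1 p.2 ∂m = 0 := by
  obtain ⟨K, hK, hKM, happ⟩ := exists_contDiff_fderiv_approx (isOpen_puncturedSet M) ha hac haM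
  choose b hb hbK hba using fun k : ℕ => happ (1 / (k + 1)) (by positivity)
  obtain ⟨A, hA⟩ := (hac.fderiv ℝ).exists_bound_of_continuous (ha.continuous_fderiv one_ne_zero)
  -- Only `|ξ|²` is assumed integrable. As `K` is compact and avoids the zero section, the field is
  -- at most `B |ξ|²` on it.
  have hcont : ContinuousOn (fun p => ‖hamField g p‖ / ‖p.2‖ ^ 2) K :=
    ((hg.contDiffOn_hamField.continuousOn.mono
      (hKM.trans puncturedSet_subset)).norm).div (by fun_prop)
      fun p hp => pow_ne_zero 2 (norm_ne_zero_iff.2 (hKM hp).2)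
  obtain ⟨B, hB⟩ := hK.exists_bound_of_continuousOn hcont
  have hA0 : 0 ≤ A := (norm_nonneg _).trans (hA 0)
  refine integral_flowDeriv_eq_zero_of_tendsto hg hm hE (b := b) (C := |(A + 1) * B|)
    (fun k => ((hb k).of_le (mod_cast le_top)).contDiffOn)
    (fun k => hT _ ⟨hb k, hK.of_isClosed_subset (isClosed_tsupport _) (hbK k),
      (hbK k).trans hKM⟩) (fun k p hp => ?_) fun p hp => ?_
  · by_cases hpK : p ∈ K
    · have h1 : ‖fderiv ℝ (b k) p‖ ≤ A + 1 := by
        have h2 := norm_sub_norm_le (fderiv ℝ (b k) p) (fderiv ℝ a p)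
        have h3 : (1 : ℝ) / (k + 1) ≤ 1 := by
          rw [div_le_one (by positivity)]
          linarith [Nat.cast_nonneg (α := ℝ) k]
        linarith [hba k p, hA p]
      have hpos : 0 < ‖p.2‖ ^ 2 := pow_pos (norm_pos_iff.2 hp.2) 2
      have h4 : ‖hamField g p‖ ≤ B * ‖p.2‖ ^ 2 := by
        have := (le_abs_self _).trans (hB p hpK)
        rwa [div_le_iff₀ hpos] at this
      rw [flowDeriv_eq_fderiv, ← Real.norm_eq_abs]
      calc ‖fderiv ℝ (b k) p (hamField g p)‖ ≤ ‖fderiv ℝ (b k) p‖ * ‖hamField g p‖ :=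
            ContinuousLinearMap.le_opNorm _ _
        _ ≤ (A + 1) * (B * ‖p.2‖ ^ 2) := by gcongr
        _ = (A + 1) * B * ‖p.2‖ ^ 2 := by ring
        _ ≤ _ := mul_le_mul_of_nonneg_right (le_abs_self _) hpos.le
    · rw [flowDeriv_eq_zero_of_eventuallyEq, abs_zero]
      · positivity
      · exact notMem_tsupport_iff_eventuallyEq.1 fun h => hpK (hbK k h)
  · simp only [flowDeriv_eq_fderiv]
    have h1 : Tendsto (fun k => fderiv ℝ (b k) p) atTop (𝓝 (fderiv ℝ a p)) := by
      rw [tendsto_iff_norm_sub_tendsto_zero]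
      exact squeeze_zero (fun _ => norm_nonneg _) (fun k => hba k p)
        tendsto_one_div_add_atTop_nhds_zero_nat
    exact ((ContinuousLinearMap.apply ℝ ℝ (hamField g p)).continuous.tendsto _).comp h1

/-- The cut-off in the momentum, `1` for `|log |ξ|²| ≤ t⁻¹` and `0` for `|log |ξ|²| ≥ 2 t⁻¹`. -/
def momentumCutoff (t : ℝ) (ξ : Coord n) : ℝ :=
  (⟨1, 2, one_pos, one_lt_two⟩ : ContDiffBump (0 : ℝ)) (t * Real.log (‖ξ‖ ^ 2))

theorem momentumCutoff_mem (t : ℝ) (ξ : Coord n) : momentumCutoff t ξ ∈ Icc (0 : ℝ) 1 :=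
  ⟨ContDiffBump.nonneg _, ContDiffBump.le_one _⟩

theorem contDiffAt_momentumCutoff (t : ℝ) {ξ : Coord n} (hξ : ξ ≠ 0) :
    ContDiffAt ℝ 1 (momentumCutoff t) ξ := by
  have h : ContDiffAt ℝ 1 (fun ξ : Coord n => Real.log (‖ξ‖ ^ 2)) ξ :=
    (contDiff_norm_sq ℝ).contDiffAt.log (pow_ne_zero 2 (norm_ne_zero_iff.2 hξ))
  exact (ContDiffBump.contDiff _).contDiffAt.comp ξ (contDiffAt_const.mul h)

theorem momentumCutoff_eq_zero {t : ℝ} {ξ : Coord n} (h : 2 ≤ |t * Real.log (‖ξ‖ ^ 2)|) :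
    momentumCutoff t ξ = 0 :=
  ContDiffBump.zero_of_le_dist _ (by simpa [Real.dist_eq] using h)

theorem momentumCutoff_eventuallyEq_one {t : ℝ} {ξ : Coord n} (hξ : ξ ≠ 0)
    (h : |t * Real.log (‖ξ‖ ^ 2)| < 1) : momentumCutoff t =ᶠ[𝓝 ξ] fun _ => 1 := by
  have hc : ContinuousAt (fun ξ : Coord n => |t * Real.log (‖ξ‖ ^ 2)|) ξ :=
    (continuousAt_const.mul (((continuous_norm.pow 2).continuousAt).log
      (pow_ne_zero 2 (norm_ne_zero_iff.2 hξ)))).abs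
  filter_upwards [hc.eventually_lt_const h] with η hη
  exact ContDiffBump.one_of_mem_closedBall _ (by simpa [Real.dist_eq] using hη.le)

/-- The radial derivative of the momentum cut-offs is uniformly of order `|ξ|⁻¹`. -/
theorem exists_fderiv_momentumCutoff_le :
    ∃ L : ℝ, ∀ t ∈ Icc (0 : ℝ) 1, ∀ ξ : Coord n, ξ ≠ 0 → ∀ v,
      |fderiv ℝ (momentumCutoff t) ξ v| ≤ L * (‖v‖ / ‖ξ‖) := by
  let ψ : ContDiffBump (0 : ℝ) := ⟨1, 2, one_pos, one_lt_two⟩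
  have hψ : ContDiff ℝ 1 ψ := ψ.contDiff
  obtain ⟨L, hL⟩ := ψ.hasCompactSupport.deriv.exists_bound_of_continuous
    (hψ.continuous_deriv le_rfl)
  refine ⟨2 * L, fun t ht ξ hξ v => ?_⟩
  have hn : 0 < ‖ξ‖ := norm_pos_iff.2 hξ
  have h1 : HasFDerivAt (fun ξ : Coord n => t * Real.log (‖ξ‖ ^ 2)) _ ξ :=
    ((hasStrictFDerivAt_norm_sq ξ).hasFDerivAt.log (pow_ne_zero 2 hn.ne')).const_mul t
  have h2 := ((hψ.differentiable one_ne_zero (t * Real.log (‖ξ‖ ^ 2))).hasDerivAt).comp_hasFDerivAt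
    ξ h1
  have h3 : fderiv ℝ (momentumCutoff t) ξ v =
      deriv ψ (t * Real.log (‖ξ‖ ^ 2)) * (t * ((‖ξ‖ ^ 2)⁻¹ * (2 * inner ℝ ξ v))) := by
    rw [show momentumCutoff t = ψ ∘ fun ξ : Coord n => t * Real.log (‖ξ‖ ^ 2) from rfl, h2.fderiv]
    simp
  have h4 := abs_real_inner_le_norm ξ v
  have h5 := hL (t * Real.log (‖ξ‖ ^ 2))
  rw [Real.norm_eq_abs] at h5
  rw [h3, abs_mul, abs_mul, abs_mul, abs_mul, abs_of_nonneg ht.1, abs_inv, abs_of_pos (pow_pos hn 2),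
    abs_two]
  calc _ ≤ L * (1 * ((‖ξ‖ ^ 2)⁻¹ * (2 * (‖ξ‖ * ‖v‖)))) := by
        have := ht.1
        have := ht.2
        have := (abs_nonneg _).trans h5
        gcongr
    _ = _ := by field_simp

end RadialAverage

end

end EinsteinVlasov

/-! ### Removal of the momentum cut-off and the radial average of a measure solution. -/

namespace EinsteinVlasov

noncomputable section

section RadialAverage

variable {n : ℕ} {M : TopologicalSpace.Opens (Coord n)} {g : MetricField n}
  {a : Coord n × Coord n → ℝ} {m : Measure (Coord n × Coord n)}

/-- This bounds a function on the unit covectors over `K` by compactness. Homogeneity then yields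
the growth rates `|ξ|` and `|ξ|²` in the estimates below. -/
theorem exists_bound_normalizeMomentum {W : Type*} [NormedAddCommGroup W]
    {φ : Coord n × Coord n → W} (hφ : ContinuousOn φ (puncturedSet M)) {K : Set (Coord n)}
    (hK : IsCompact K) (hKM : K ⊆ M) :
    ∃ C, 0 ≤ C ∧ ∀ x ∈ K, ∀ ξ : Coord n, ξ ≠ 0 → ‖φ (x, ‖ξ‖⁻¹ • ξ)‖ ≤ C := by
  have hsub : K ×ˢ Metric.sphere (0 : Coord n) 1 ⊆ puncturedSet M := fun p hp =>
    ⟨hKM hp.1, ne_zero_of_mem_unit_sphere ⟨p.2, hp.2⟩⟩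
  obtain ⟨C, hC⟩ := (hK.prod (isCompact_sphere (0 : Coord n) 1)).exists_bound_of_continuousOn
    (hφ.mono hsub)
  refine ⟨|C|, abs_nonneg _, fun x hx ξ hξ => (hC _ ⟨hx, ?_⟩).trans (le_abs_self _)⟩
  rw [mem_sphere_zero_iff_norm]
  exact norm_smul_inv_norm (𝕜 := ℝ) hξ

theorem IsHomogeneousTestFunction.exists_abs_le (ha : IsHomogeneousTestFunction M a)
    {K : Set (Coord n)} (hK : IsCompact K) (hKM : K ⊆ M) :
    ∃ C, 0 ≤ C ∧ ∀ x ∈ K, ∀ ξ : Coord n, ξ ≠ 0 → |a (x, ξ)| ≤ C * ‖ξ‖ := by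
  obtain ⟨C, hC0, hC⟩ := exists_bound_normalizeMomentum ha.contDiffOn.continuousOn hK hKM
  refine ⟨C, hC0, fun x hx ξ hξ => ?_⟩
  have hn : 0 < ‖ξ‖ := norm_pos_iff.2 hξ
  have h := hC x hx ξ hξ
  rw [ha.homogeneous x (hKM hx) ξ hξ _ (inv_pos.2 hn), Real.norm_eq_abs, abs_mul, abs_inv,
    abs_norm, inv_mul_le_iff₀ hn] at h
  linarith

theorem IsHomogeneousTestFunction.exists_abs_flowDeriv_le (hg : IsLorentzianMetric 2 M g)
    (ha : IsHomogeneousTestFunction M a) {K : Set (Coord n)} (hK : IsCompact K) (hKM : K ⊆ M) :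
    ∃ C, 0 ≤ C ∧ ∀ x ∈ K, ∀ ξ : Coord n, ξ ≠ 0 → |flowDeriv g a x ξ| ≤ C * ‖ξ‖ ^ 2 := by
  obtain ⟨C, hC0, hC⟩ :=
    exists_bound_normalizeMomentum (continuousOn_flowDeriv hg ha.contDiffOn) hK hKM
  refine ⟨C, hC0, fun x hx ξ hξ => ?_⟩
  have hn : 0 < ‖ξ‖ := norm_pos_iff.2 hξ
  have h := hC x hx ξ hξ
  rw [flowDeriv_smul g ha (hKM hx) hξ (inv_pos.2 hn), Real.norm_eq_abs, abs_mul, abs_pow, abs_inv,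
    abs_norm, inv_pow, inv_mul_le_iff₀ (pow_pos hn 2)] at h
  linarith

theorem IsLorentzianMetric.exists_norm_geodesicForce_le (hg : IsLorentzianMetric 2 M g)
    {K : Set (Coord n)} (hK : IsCompact K) (hKM : K ⊆ M) :
    ∃ C, 0 ≤ C ∧ ∀ x ∈ K, ∀ ξ : Coord n, ξ ≠ 0 → ‖geodesicForce g x ξ‖ ≤ C * ‖ξ‖ ^ 2 := by
  obtain ⟨C, hC0, hC⟩ := exists_bound_normalizeMomentum (φ := fun p => (hamField g p).2)
    (continuous_snd.comp_continuousOn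
      (hg.contDiffOn_hamField.continuousOn.mono puncturedSet_subset)) hK hKM
  refine ⟨C, hC0, fun x hx ξ hξ => ?_⟩
  have hn : 0 < ‖ξ‖ := norm_pos_iff.2 hξ
  have h : ‖geodesicForce g x (‖ξ‖⁻¹ • ξ)‖ ≤ C := hC x hx ξ hξ
  rw [geodesicForce_smul, norm_smul, norm_pow, norm_inv, norm_norm, inv_pow,
    inv_mul_le_iff₀ (pow_pos hn 2)] at h
  linarith

/-- The truncation of `a` to the momenta with `|log |ξ|²| ≤ 2 t⁻¹`. -/
def truncateMomentum (M : TopologicalSpace.Opens (Coord n)) (a : Coord n × Coord n → ℝ) (t : ℝ) :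
    Coord n × Coord n → ℝ :=
  (puncturedSet M).indicator fun p => a p * momentumCutoff t p.2

theorem truncateMomentum_eventuallyEq (a : Coord n × Coord n → ℝ) (t : ℝ) {p : Coord n × Coord n}
    (hp : p ∈ puncturedSet M) :
    truncateMomentum M a t =ᶠ[𝓝 p] fun p => a p * momentumCutoff t p.2 := by
  filter_upwards [(isOpen_puncturedSet M).mem_nhds hp] with q hq
  exact indicator_of_mem hq _

theorem exists_compact_truncateMomentum_eq_zero {K : Set (Coord n)} (hK : IsCompact K)
    (hKM : K ⊆ M) (haK : ∀ x ∈ M, x ∉ K → ∀ ξ : Coord n, ξ ≠ 0 → a (x, ξ) = 0) {t : ℝ}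
    (ht : 0 < t) :
    ∃ S ⊆ puncturedSet M, IsCompact S ∧ (∀ p ∈ S, p.1 ∈ K) ∧
      ∀ p ∉ S, truncateMomentum M a t p = 0 := by
  refine ⟨K ×ˢ (Metric.closedBall 0 (Real.exp t⁻¹) \ Metric.ball 0 (Real.exp (-t⁻¹))),
    fun p hp => ⟨hKM hp.1, fun h0 => hp.2.2 ?_⟩,
    hK.prod ((isCompact_closedBall _ _).diff Metric.isOpen_ball), fun p hp => hp.1,
    fun p hp => ?_⟩
  · rw [h0]
    exact Metric.mem_ball_self (Real.exp_pos _)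
  · by_cases hpM : p ∈ puncturedSet M
    · rw [truncateMomentum, indicator_of_mem hpM]
      by_cases hpK : p.1 ∈ K
      · have hn : 0 < ‖p.2‖ := norm_pos_iff.2 hpM.2
        rw [momentumCutoff_eq_zero, mul_zero]
        have h1 : t⁻¹ ≤ |Real.log ‖p.2‖| := by
          by_contra! h2
          obtain ⟨h3, h4⟩ := abs_lt.1 h2
          rw [Real.lt_log_iff_exp_lt hn] at h3
          rw [Real.log_lt_iff_lt_exp hn] at h4
          exact hp ⟨hpK, by simpa using h4.le, by simpa using h3.le⟩
        rw [Real.log_pow, abs_mul, abs_mul, abs_of_pos ht]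
        calc (2 : ℝ) = t * (2 * t⁻¹) := by field_simp
          _ ≤ _ := by
            push_cast
            rw [abs_two]
            gcongr
      · rw [haK p.1 hpM.1 hpK p.2 hpM.2, zero_mul]
    · exact indicator_of_notMem hpM _

/-- The cut-off depends on `ξ` alone, so its derivative along the field sees only the force. -/
theorem flowDeriv_truncateMomentum (ha : ContDiffOn ℝ 1 a (puncturedSet M)) (t : ℝ)
    {p : Coord n × Coord n} (hp : p ∈ puncturedSet M) :
    flowDeriv g (truncateMomentum M a t) p.1 p.2 =
      a p * fderiv ℝ (momentumCutoff t) p.2 (geodesicForce g p.1 p.2) +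
        momentumCutoff t p.2 * flowDeriv g a p.1 p.2 := by
  have h1 : HasFDerivAt a (fderiv ℝ a p) p :=
    ((ha.contDiffAt ((isOpen_puncturedSet M).mem_nhds hp)).differentiableAt
      one_ne_zero).hasFDerivAt
  have h2 : HasFDerivAt (momentumCutoff t) (fderiv ℝ (momentumCutoff t) p.2) p.2 :=
    ((contDiffAt_momentumCutoff t hp.2).differentiableAt one_ne_zero).hasFDerivAt
  have h3 := (h1.mul (h2.comp p hasFDerivAt_snd)).congr_of_eventuallyEq
    (truncateMomentum_eventuallyEq a t hp)
  rw [flowDeriv_eq_fderiv, flowDeriv_eq_fderiv, h3.fderiv]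
  rfl

/-- The Vlasov equation can be tested with homogeneous functions. -/
theorem integral_flowDeriv_of_homogeneous (hg : IsLorentzianMetric 2 M g)
    (hm : ∀ᵐ p ∂m, p ∈ puncturedSet M) (hE : Integrable (fun p => ‖p.2‖ ^ 2) m)
    (hT : ∀ b, IsTestFunction M b → ∫ p, flowDeriv g b p.1 p.2 ∂m = 0)
    (ha : IsHomogeneousTestFunction M a) : ∫ p, flowDeriv g a p.1 p.2 ∂m = 0 := by
  obtain ⟨K, hK, hKM, haK⟩ := ha.compact
  obtain ⟨A, hA0, hA⟩ := ha.exists_abs_le hK hKM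
  obtain ⟨B, hB0, hB⟩ := ha.exists_abs_flowDeriv_le hg hK hKM
  obtain ⟨F, hF0, hF⟩ := hg.exists_norm_geodesicForce_le hK hKM
  obtain ⟨L, hL⟩ := exists_fderiv_momentumCutoff_le (n := n)
  have ht0 : ∀ k : ℕ, (0 : ℝ) < 1 / (k + 1) := fun k => by positivity
  have ht1 : ∀ k : ℕ, (1 : ℝ) / (k + 1) ∈ Icc (0 : ℝ) 1 := fun k => by
    refine ⟨(ht0 k).le, ?_⟩
    rw [div_le_one (by positivity)]
    linarith [Nat.cast_nonneg (α := ℝ) k]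
  choose S hSM hS hSK hS0 using fun k => exists_compact_truncateMomentum_eq_zero hK hKM haK (ht0 k)
  have hz : ∀ k, ∀ p ∉ S k, truncateMomentum M a (1 / (k + 1)) =ᶠ[𝓝 p] fun _ => 0 :=
    fun k p hp => by
      filter_upwards [(hS k).isClosed.isOpen_compl.mem_nhds hp] with q hq
      exact hS0 k q hq
  have hb : ∀ k : ℕ, ContDiff ℝ 1 (truncateMomentum M a (1 / (k + 1))) := fun k => by
    rw [contDiff_iff_contDiffAt]
    intro p
    by_cases hp : p ∈ S k
    · exact ((ha.contDiffOn.contDiffAt ((isOpen_puncturedSet M).mem_nhds (hSM k hp))).mul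
        ((contDiffAt_momentumCutoff _ (hSM k hp).2).comp p contDiffAt_snd)).congr_of_eventuallyEq
          (truncateMomentum_eventuallyEq a _ (hSM k hp))
    · exact contDiffAt_const.congr_of_eventuallyEq (hz k p hp)
  have hts : ∀ k : ℕ, tsupport (truncateMomentum M a (1 / (k + 1))) ⊆ S k := fun k =>
    closure_minimal (fun p hp => by_contra fun h => hp (hS0 k p h)) (hS k).isClosed
  refine integral_flowDeriv_eq_zero_of_tendsto hg hm hE (C := A * (|L| * F) + B)
    (b := fun k : ℕ => truncateMomentum M a (1 / (k + 1))) (fun k => (hb k).contDiffOn)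
    (fun k => integral_flowDeriv_of_contDiff_one hg hm hE hT (hb k)
      ((hS k).of_isClosed_subset (isClosed_tsupport _) (hts k)) ((hts k).trans (hSM k)))
    (fun k p hp => ?_) fun p hp => ?_
  · by_cases hpS : p ∈ S k
    · have hpK := hSK k p hpS
      have hn : 0 < ‖p.2‖ := norm_pos_iff.2 hp.2
      -- The bound is `L / |ξ|` for the cut-off times `F |ξ|²` for the force. With `|a| ≤ A |ξ|` the
      -- error term has the same order `|ξ|²` as `Xa`, uniformly in `k`.
      have h1 : |fderiv ℝ (momentumCutoff (1 / ((k : ℝ) + 1))) p.2 (geodesicForce g p.1 p.2)| ≤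
          |L| * F * ‖p.2‖ := by
        refine (hL _ (ht1 k) p.2 hp.2 _).trans ?_
        calc _ ≤ |L| * (F * ‖p.2‖ ^ 2 / ‖p.2‖) := by
              gcongr
              · exact le_abs_self _
              · exact hF _ hpK _ hp.2
          _ = _ := by field_simp
      have h2 := momentumCutoff_mem (1 / ((k : ℝ) + 1)) p.2
      rw [flowDeriv_truncateMomentum ha.contDiffOn _ hp]
      refine (abs_add_le _ _).trans ?_
      rw [abs_mul, abs_mul, abs_of_nonneg h2.1]
      calc _ ≤ A * ‖p.2‖ * (|L| * F * ‖p.2‖) + 1 * (B * ‖p.2‖ ^ 2) := by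
            gcongr
            · exact hA _ hpK _ hp.2
            · exact h2.2
            · exact hB _ hpK _ hp.2
        _ = _ := by ring
    · rw [flowDeriv_eq_zero_of_eventuallyEq (hz k p hpS), abs_zero]
      positivity
  · have h1 : Tendsto (fun k : ℕ => |1 / ((k : ℝ) + 1) * Real.log (‖p.2‖ ^ 2)|) atTop (𝓝 0) := by
      simpa only [zero_mul, abs_zero] using
        (tendsto_one_div_add_atTop_nhds_zero_nat.mul_const (Real.log (‖p.2‖ ^ 2))).abs
    refine tendsto_const_nhds.congr' ?_
    filter_upwards [h1.eventually_lt_const one_pos] with k hk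
    have h2 : truncateMomentum M a (1 / (k + 1)) =ᶠ[𝓝 p] a := by
      filter_upwards [truncateMomentum_eventuallyEq a (1 / ((k : ℝ) + 1)) hp,
        (continuous_snd.tendsto p).eventually (momentumCutoff_eventuallyEq_one hp.2 hk)] with q h3 h4
      rw [h3, h4, mul_one]
    rw [flowDeriv_eq_fderiv, flowDeriv_eq_fderiv, h2.fderiv_eq]

/-- The radial average of a measure on `T^*M`. -/
def radialAverage (μ : Measure (Cotangent M)) : Measure (Cosphere M) :=
  ((μ.comap (Subtype.val : PuncturedCotangent M → Cotangent M)).withDensity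
    fun p => ENNReal.ofReal (‖p.1.2‖ ^ 2)).map Cosphere.mk

theorem integral_radialAverage (μ : Measure (Cotangent M)) {F : Cosphere M → ℝ}
    (hF : Continuous F) :
    ∫ θ, F θ ∂radialAverage μ = ∫ p : PuncturedCotangent M, F (Cosphere.mk p) * ‖p.1.2‖ ^ 2
      ∂μ.comap Subtype.val := by
  rw [radialAverage, integral_map Cosphere.continuous_mk.measurable.aemeasurable
    hF.aestronglyMeasurable,
    integral_withDensity_eq_integral_toReal_smul (by fun_prop) (by simp)]
  simp [mul_comm]

theorem integral_comap_punctured (μ : Measure (Cotangent M)) (F : Cotangent M → ℝ) :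
    ∫ p : PuncturedCotangent M, F p.1 ∂μ.comap Subtype.val = ∫ p in {p | p.2 ≠ 0}, F p ∂μ :=
  integral_subtype_comap (isOpen_ne_fun continuous_snd continuous_const).measurableSet F

theorem Cosphere.norm_smul_unitRep_mk (p : PuncturedCotangent M) :
    ‖p.1.2‖ • (Cosphere.mk p).unitRep.2 = p.1.2 := by
  rw [unitRep_mk]
  exact smul_inv_smul₀ (norm_ne_zero_iff.2 p.2) _

theorem Cosphere.unitRep_mk_fst (p : PuncturedCotangent M) :
    (Cosphere.mk p).unitRep.1 = p.1.1 := by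
  rw [unitRep_mk]
  rfl

/-- The radial average of a measure solution is a radially averaged solution. -/
theorem IsMeasureSolution.exists_isRadiallyAveragedSolution (hg : IsLorentzianMetric 2 M g)
    {μ : Measure (Cotangent M)} (hμ : IsMeasureSolution M g μ) :
    ∃ ν : Measure (Cosphere M), IsRadiallyAveragedSolution M g ν ∧ IsRadialAverage μ ν := by
  have hms : MeasurableSet {p : Cotangent M | p.2 ≠ 0} :=
    (isOpen_ne_fun continuous_snd continuous_const).measurableSet
  refine ⟨radialAverage μ, ⟨?_, fun Y hY => ?_, fun f hf hfc => ?_, fun a ha => ?_⟩,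
    fun φ hφ _ => integral_radialAverage μ hφ⟩
  · refine ⟨?_⟩
    rw [radialAverage, Measure.map_apply Cosphere.continuous_mk.measurable MeasurableSet.univ,
      preimage_univ, withDensity_apply _ MeasurableSet.univ, setLIntegral_univ]
    refine lt_of_le_of_lt ?_ hμ.vlasov.finite_energy
    have := lintegral_subtype_comap (μ := μ) hms fun p => ENNReal.ofReal (‖p.2‖ ^ 2)
    exact this.le.trans (setLIntegral_le_lintegral _ _)
  · have hc : Continuous fun θ : Cosphere M => pairing θ.unitRep.2 (Y θ.unitRep.1) ^ 2 :=
      (continuous_pairing (continuous_snd.comp Cosphere.continuous_unitRep)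
        (hY.smooth.continuous.comp (continuous_fst.comp Cosphere.continuous_unitRep))).pow 2
    simp only [Cosphere.pairing_rep]
    rw [hμ.einstein Y hY]
    refine Eq.trans ?_ (integral_radialAverage μ hc).symm
    have h0 : ∀ p : PuncturedCotangent M, pairing (Cosphere.mk p).unitRep.2
        (Y (Cosphere.mk p).unitRep.1) ^ 2 * ‖p.1.2‖ ^ 2 = pairing p.1.2 (Y p.1.1) ^ 2 := fun p => by
      rw [mul_comm, ← mul_pow, ← pairing_smul, Cosphere.norm_smul_unitRep_mk,
        Cosphere.unitRep_mk_fst]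
    simp only [h0]
    rw [integral_comap_punctured μ fun p => pairing p.2 (Y p.1) ^ 2]
    -- The zero section, which the radial average does not see, contributes nothing to the
    -- energy-momentum integral.
    refine (setIntegral_eq_integral_of_forall_compl_eq_zero fun p hp => ?_).symm
    have : p.2 = 0 := not_not.1 hp
    simp [pairing, this]
  · have hc : Continuous fun θ : Cosphere M =>
        f θ * cometricForm g θ.unitRep.1 θ.unitRep.2 θ.unitRep.2 := by
      refine hf.mul ?_
      exact hg.contDiffOn_cometricForm.continuousOn.comp_continuous
        Cosphere.continuous_unitRep fun θ => puncturedSet_subset θ.unitRep_mem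
    simp only [mul_div_assoc, Cosphere.cometricForm_rep]
    refine (integral_radialAverage μ hc).trans ?_
    have h0 : ∀ p : PuncturedCotangent M, f (Cosphere.mk p) * cometricForm g
        (Cosphere.mk p).unitRep.1 (Cosphere.mk p).unitRep.2 (Cosphere.mk p).unitRep.2 *
          ‖p.1.2‖ ^ 2 = f (Cosphere.mk p) * cometricForm g p.1.1 p.1.2 p.1.2 := fun p => by
      rw [mul_assoc, mul_comm (cometricForm _ _ _ _), ← cometricForm_smul,
        Cosphere.norm_smul_unitRep_mk, Cosphere.unitRep_mk_fst]
    simp only [h0]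
    have hnull : ∀ᵐ p : PuncturedCotangent M ∂μ.comap Subtype.val,
        cometricForm g p.1.1 p.1.2 p.1.2 = 0 := by
      have h1 := ae_restrict_of_ae (s := {p : Cotangent M | p.2 ≠ 0})
        (ae_iff.2 hμ.vlasov.null_support)
      rw [← map_comap_subtype_coe hms] at h1
      exact ae_of_ae_map measurable_subtype_coe.aemeasurable h1
    refine integral_eq_zero_of_ae (hnull.mono fun p hp => ?_)
    simp [hp]
  · have hc : Continuous fun θ : Cosphere M => flowDeriv g a θ.unitRep.1 θ.unitRep.2 :=
      (continuousOn_flowDeriv hg ha.contDiffOn).comp_continuous Cosphere.continuous_unitRep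
        fun θ => θ.unitRep_mem
    simp only [Cosphere.flowDeriv_rep g ha]
    refine (integral_radialAverage μ hc).trans ?_
    have h0 : ∀ p : PuncturedCotangent M, flowDeriv g a (Cosphere.mk p).unitRep.1
        (Cosphere.mk p).unitRep.2 * ‖p.1.2‖ ^ 2 = flowDeriv g a p.1.1 p.1.2 := fun p => by
      rw [mul_comm, ← flowDeriv_smul g ha (Cosphere.unitRep_mem _).1 (Cosphere.unitRep_mem _).2
        (norm_pos_iff.2 p.2), Cosphere.norm_smul_unitRep_mk, Cosphere.unitRep_mk_fst]
    simp only [h0]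
    -- The measure `μ` off the zero section is viewed in coordinate space, where the approximation
    -- lemmas are stated.
    let m : Measure (Coord n × Coord n) :=
      (μ.comap (Subtype.val : PuncturedCotangent M → Cotangent M)).map fun p => p.1.toCoord
    have hmeas : Measurable fun p : PuncturedCotangent M => p.1.toCoord :=
      Cotangent.continuous_toCoord.measurable.comp measurable_subtype_coe
    have hm : ∀ᵐ p ∂m, p ∈ puncturedSet M :=
      (ae_map_iff hmeas.aemeasurable (isOpen_puncturedSet M).measurableSet).2
        (Eventually.of_forall fun p => Cotangent.toCoord_mem p.2)
    have hint : ∀ b : Coord n × Coord n → ℝ, ContDiffOn ℝ 1 b (puncturedSet M) →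
        ∫ p, flowDeriv g b p.1 p.2 ∂m = ∫ p : PuncturedCotangent M, flowDeriv g b p.1.1 p.1.2
          ∂μ.comap Subtype.val := fun b hb => by
      have hbm : AEStronglyMeasurable (fun p : Coord n × Coord n => flowDeriv g b p.1 p.2) m :=
        aestronglyMeasurable_comp_of_continuousOn (Q := id) aemeasurable_id hm
          (continuousOn_flowDeriv hg hb)
      exact integral_map hmeas.aemeasurable hbm
    rw [← hint a ha.contDiffOn]
    refine integral_flowDeriv_of_homogeneous hg hm ?_ (fun b hb => ?_) ha
    · refine ⟨by fun_prop, ?_⟩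
      rw [hasFiniteIntegral_iff_ofReal (Eventually.of_forall fun p => sq_nonneg _),
        lintegral_map (by fun_prop) hmeas]
      refine lt_of_le_of_lt ?_ hμ.vlasov.finite_energy
      have := lintegral_subtype_comap (μ := μ) hms fun p => ENNReal.ofReal (‖p.2‖ ^ 2)
      exact this.le.trans (setLIntegral_le_lintegral _ _)
    · rw [hint b (hb.smooth.of_le (mod_cast le_top)).contDiffOn,
        integral_comap_punctured μ fun p => flowDeriv g b p.1 p.2]
      exact hμ.vlasov.transport b hb

end RadialAverage

end

end EinsteinVlasov

open EinsteinVlasov in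
theorem lemma2p4 {n : ℕ} (M : TopologicalSpace.Opens (Coord n)) (g : MetricField n)
    (hg : IsLorentzianMetric 2 M g) :
    (∀ μ : Measure (Cotangent M), IsMeasureSolution M g μ →
      ∃ ν : Measure (Cosphere M), IsRadiallyAveragedSolution M g ν ∧ IsRadialAverage μ ν) ∧
    (GloballyHyperbolic M g →
      ∀ ν : Measure (Cosphere M), IsRadiallyAveragedSolution M g ν →
        ∃ μ : Measure (Cotangent M), IsMeasureSolution M g μ ∧ IsRadialAverage μ ν) :=
  ⟨fun _ hμ => hμ.exists_isRadiallyAveragedSolution hg,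
    fun hM _ hν => hν.exists_isMeasureSolution hg hM⟩
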